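/- **Notation.** Let $\lambda$ be a Young diagram (English convention) with $n=|\lambda|$ boxes; a box $\square$ in row $a$ and column $b$ has content $c(\square)=b-a$. $\mathrm{RSSYT}(\lambda)$ is the set of labellings $T:\lambda\to\mathbb Z_{\ge0}$ weakly decreasing along rows and strictly decreasing down columns. $\mathrm{PSYT}(\lambda)$ is the set of labellings $\tau$ of $\lambda$ by formal products $jq^b$ ($1\le j\le n$, $b\ge0$), each $j$ occurring exactly once, strictly increasing along rows and columns for the order $jq^m<kq^\ell$ iff $m>\ell$, or $m=\ell$ and $j<k$; $\mathrm{SYT}(\lambda)\subset\mathrm{PSYT}(\lambda)$ consists of those with all exponents $0$, and $\mathrm{PSYT}(\lambda;T)$ of those whose exponents are given by $T:\lambda\to\mathbb Z_{\ge 0}$. If $\tau(\square)=iq^b$ put $c_\tau(i)=c(\square)$, $w_\tau(i)=b$. $s_i(\tau)$ is obtained by exchanging $i$ and $i+1$ (keeping exponents in place), when the result is in $\mathrm{PSYT}(\lambda)$; $\Psi(\tau)$ is obtained by replacing $kq^a$ by $(k-1)q^a$ for $k\ge2$ and $1q^a$ by $nq^{a+1}$. $\mathrm{PSYT}(\lambda)$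 is partially ordered by the relations $\Psi(\tau)>\tau$, and $s_i(\tau)>\tau$ if $w_\tau(i)<w_\tau(i+1)$, or if $w_\tau(i)=w_\tau(i+1)$ and $c_\tau(i)-c_\tau(i+1)>1$. $\mathrm{Min}(T)$ and $\mathrm{Top}(T)$ are the least and the greatest element of $\mathrm{PSYT}(\lambda;T)$. $S(T)$ is the standard tableau that numbers the boxes by decreasing value of $T$ and, for equal values, column by column (left to right, each from top to bottom). For $\tau\in\mathrm{PSYT}(\lambda;T)$, $\mathrm{Inv}(\tau)$ is the set of pairs $(\square_1,\square_2)$ of boxes with $S(T)(\square_1)<S(T)(\square_2)$ and $i>j$, where $\tau(\square_1)=iq^a$, $\tau(\square_2)=jq^b$. Let $\mu(T)$ be the composition of $n$ whose Young subgroup is generated by the $s_i$ such that $i$ and $i+1$ occur in the same row of $\mathrm{Min}(T)$ with the same exponent. Put $[m]_t!=\prod_{i=1}^m\frac{1-t^i}{1-t}$, $[\mu]_t!=\prod_k[\mu_k]_t!$, and $$K_T(q,t)=\frac{[\mu(T)]_t!}{[n]_t!}\prod_{(\square_1,\square_2)\in \mathrm{Inv}(\mathrm{Min}(T))}\frac{q^{T(\square_1)}t^{c(\square_1)}-q^{T(\square_2)}t^{c(\square_2)+1}}{q^{T(\square_1)}t^{c(\square_1)}-q^{T(\square_2)}t^{c(\square_2)}}.$$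 **Modules.** Over $\mathbb Q(q,t)$: the finite Hecke algebra $H_n$ is generated by $T_1,\dots,T_{n-1}$ with $(T_i-1)(T_i+t)=0$ and the braid relations. The positive affine Hecke algebra $A_n$ has in addition commuting generators $\theta_1,\dots,\theta_n$ with $\theta_{i+1}=tT_i^{-1}\theta_iT_i^{-1}$ and $T_i\theta_j=\theta_jT_i$ for $j\ne i,i+1$; put $\pi_n=t^{n-1}\theta_1T_1^{-1}\cdots T_{n-1}^{-1}$. The positive double affine Hecke algebra $D_n$ has in addition commuting generators $X_1,\dots,X_n$ with $X_{i+1}=tT_i^{-1}X_iT_i^{-1}$, $T_iX_j=X_jT_i$ for $j\neq i,i+1$, $\pi_nX_i=X_{i+1}\pi_n$ for $i<n$, and $\pi_nX_n=qX_1\pi_n$. In $H_n$ let $\bar\theta_1=1$, $\bar\theta_{i+1}=tT_i^{-1}\bar\theta_iT_i^{-1}$, $\bar\varphi_i=tT_i^{-1}\bar\theta_i-\bar\theta_i\,tT_i^{-1}$, and let $\rho_n:A_n\to H_n$ be the homomorphism $T_i\mapsto T_i$, $\theta_i\mapsto\bar\theta_i$. Write $\lambda$ also for the $H_n$-module spanned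 by $\mathrm{SYT}(\lambda)$ with $\bar\theta_i\tau=t^{c_\tau(i)}\tau$; $\bar\varphi_i\tau=(t^{c_\tau(i)}-t^{c_\tau(i+1)})s_i(\tau)$ if $s_i(\tau)>\tau$; $T_i\tau=\tau$ (resp. $-t\tau$) if $i,i+1$ lie in the same row (resp. column) of $\tau$. Let $V_\lambda=\mathrm{Ind}_{A_n}^{D_n}\rho_n^*(\lambda)$ and let $\epsilon^{(n)}=\frac1{[n]_t!}\sum_{\sigma\in\mathfrak S_n}t^{\binom n2-\ell(\sigma)}T_\sigma$. Let $F_\tau\in V_\lambda$, $\tau\in\mathrm{PSYT}(\lambda)$, be the non-symmetric vector-valued Macdonald polynomials: the family determined by $\theta_iF_\tau=q^{w_\tau(i)}t^{c_\tau(i)}F_\tau$; $F_\tau=1\otimes\tau$ for $\tau\in\mathrm{SYT}(\lambda)$; $\Big(tT_i^{-1}+\frac{(t-1)q^{w_\tau(i+1)}t^{c_\tau(i+1)}}{q^{w_\tau(i)}t^{c_\tau(i)}-q^{w_\tau(i+1)}t^{c_\tau(i+1)}}\Big)F_\tau=F_{s_i(\tau)}$ if $s_i(\tau)>\tau$; and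 $F_{\Psi(\tau)}=q^{w_\tau(1)}X_n\pi_n^{-1}F_\tau$. For $T\in\mathrm{RSSYT}(\lambda)$ let $U_T=\mathrm{span}\{F_\tau:\tau\in\mathrm{PSYT}(\lambda;T)\}$ and let $P_T$ be the unique element of $\epsilon^{(n)}(U_T)$ of the form $F_{\mathrm{Top}(T)}+\sum_{y\in\mathrm{PSYT}(\lambda;T)\setminus\{\mathrm{Top}(T)\}}\kappa_yF_y$. **Theorem (Pieri rule).** For $T\in\mathrm{RSSYT}(\lambda)$ and $1\le r\le n$, $$e_r[X_1+\dots+X_n]\,P_T=\sum_S d^{(r)}_{S,T}P_S,$$ where $S$ ranges over all $S\in\mathrm{RSSYT}(\lambda)$ that can be obtained from $T$ by adding $r$ ones to the boxes of $T$, at most one to each box, and $$\frac{d^{(r)}_{S,T}}{e_r(1,t,\dots,t^{n-1})\,K_S(q,t)}=\sum_{\substack{\tau\in\mathrm{PSYT}(\lambda;T)\\ \Psi^r(\tau)\in\mathrm{PSYT}(\lambda;S)}}t^{c_\tau(1)+\dots+c_\tau(r)}\prod_{(\square_1,\square_2)\in\mathrm{Inv}(\tau)}\frac{q^{T(\square_1)}t^{c(\square_1)+1}-q^{T(\square_2)}t^{c(\square_2)}}{q^{T(\square_1)}t^{c(\square_1)}-q^{T(\square_2)}t^{c(\square_2)}}\prod_{(\square_1,\square_2)\in\mathrm{Inv}(\Psi^r(\tau))}\frac{q^{S(\square_1)}t^{c(\square_1)}-q^{S(\square_2)}t^{c(\square_2)}}{q^{S(\square_1)}t^{c(\square_1)}-q^{S(\square_2)}t^{c(\square_2)+1}}.$$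 -/

import Mathlib

namespace VVMacdonald

noncomputable section

open Classical TensorProduct

/-! ### The base field `ℚ(q,t)` -/

/-- The field `ℚ(q,t)` of rational functions in two variables. -/
abbrev K : Type := FractionRing (MvPolynomial (Fin 2) ℚ)

/-- The parameter `q`. -/
def q : K := algebraMap (MvPolynomial (Fin 2) ℚ) K (MvPolynomial.X 0)

/-- The parameter `t`. -/
def t : K := algebraMap (MvPolynomial (Fin 2) ℚ) K (MvPolynomial.X 1)

theorem t_ne_zero : t ≠ 0 := by
  unfold t
  rw [Ne, IsFractionRing.to_map_eq_zero_iff]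
  exact MvPolynomial.X_ne_zero 1

/-- The `t`-factorial `[m]_t! = ∏_{i=1}^m (1 - t^i) / (1 - t)`. -/
def tFactorial (m : ℕ) : K := ∏ i ∈ Finset.range m, (1 - t ^ (i + 1)) / (1 - t)

/-! ### Indices

All indices start at `0`: the generators `T_1, …, T_{n-1}` are indexed by `Fin (n - 1)`, the
generators `θ_1, …, θ_n` and `X_1, …, X_n` and the labels `1, …, n` by `Fin n`.  The index
`i : Fin (n - 1)` of a `T` stands for the pair of neighbours `lo i`, `hi i` in `Fin n`. -/

/-- The smaller one of the two neighbours that belong to `i`. -/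
def lo {n : ℕ} (i : Fin (n - 1)) : Fin n := ⟨i.1, by omega⟩

/-- The larger one of the two neighbours that belong to `i`. -/
def hi {n : ℕ} (i : Fin (n - 1)) : Fin n := ⟨i.1 + 1, by omega⟩

/-! ### Hecke algebras -/

section Hecke

variable {R : Type*} [Ring R] [Algebra K R] {n : ℕ}

/-- The inverse of an element `x` with `(x - 1) (x + t) = 0`, see `mul_hInv` and `hInv_mul`. -/
def hInv (x : R) : R := t⁻¹ • (x + (t - 1) • (1 : R))

/-- The relations of the finite Hecke algebra, for a family `T` in some algebra. -/
inductive HeckeRel (T : Fin (n - 1) → R) : R → R → Prop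
  | quad (i : Fin (n - 1)) : HeckeRel T ((T i - 1) * (T i + t • (1 : R))) 0
  | braid (i j : Fin (n - 1)) (h : i.1 + 1 = j.1) :
      HeckeRel T (T i * T j * T i) (T j * T i * T j)
  | comm (i j : Fin (n - 1)) (h : i.1 + 1 < j.1) : HeckeRel T (T i * T j) (T j * T i)

/-- The relations of the positive affine Hecke algebra, for families `T`, `θ`. -/
inductive AffineRel (T : Fin (n - 1) → R) (θ : Fin n → R) : R → R → Prop
  | hecke (a b : R) (h : HeckeRel T a b) : AffineRel T θ a b
  | theta_comm (i j : Fin n) : AffineRel T θ (θ i * θ j) (θ j * θ i)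
  | theta_succ (i : Fin (n - 1)) :
      AffineRel T θ (θ (hi i)) (t • (hInv (T i) * θ (lo i) * hInv (T i)))
  | T_theta (i : Fin (n - 1)) (j : Fin n) (h₁ : j ≠ lo i) (h₂ : j ≠ hi i) :
      AffineRel T θ (T i * θ j) (θ j * T i)

/-- The element `π_n = t^{n-1} θ_1 T_1⁻¹ ⋯ T_{n-1}⁻¹` (for `n ≥ 1`). -/
def piElt (T : Fin (n - 1) → R) (θ : Fin n → R) : R :=
  if h : 0 < n then t ^ (n - 1) • (θ ⟨0, h⟩ * (List.ofFn fun i => hInv (T i)).prod) else 1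

/-- The relations of the positive double affine Hecke algebra, for families `T`, `θ`, `X`. -/
inductive DoubleRel (T : Fin (n - 1) → R) (θ X : Fin n → R) : R → R → Prop
  | affine (a b : R) (h : AffineRel T θ a b) : DoubleRel T θ X a b
  | X_comm (i j : Fin n) : DoubleRel T θ X (X i * X j) (X j * X i)
  | X_succ (i : Fin (n - 1)) :
      DoubleRel T θ X (X (hi i)) (t • (hInv (T i) * X (lo i) * hInv (T i)))
  | T_X (i : Fin (n - 1)) (j : Fin n) (h₁ : j ≠ lo i) (h₂ : j ≠ hi i) :
      DoubleRel T θ X (T i * X j) (X j * T i)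
  | pi_X (i : Fin (n - 1)) :
      DoubleRel T θ X (piElt T θ * X (lo i)) (X (hi i) * piElt T θ)
  | pi_X_last (i j : Fin n) (hlast : i.1 + 1 = n) (hfirst : j.1 = 0) :
      DoubleRel T θ X (piElt T θ * X i) (q • (X j * piElt T θ))

/-- `θ̄_{k+1}`, where `θ̄_1 = 1` and `θ̄_{i+1} = t T_i⁻¹ θ̄_i T_i⁻¹`; the value beyond `θ̄_n` is
irrelevant. -/
def thetaBarAux (T : Fin (n - 1) → R) : ℕ → R
  | 0 => 1
  | k + 1 => if h : k < n - 1 then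
      t • (hInv (T ⟨k, h⟩) * thetaBarAux T k * hInv (T ⟨k, h⟩)) else 0

/-- The elements `θ̄_1, …, θ̄_n`. -/
def thetaBar (T : Fin (n - 1) → R) (i : Fin n) : R := thetaBarAux T i.1

/-- The elements `φ̄_i = (t T_i⁻¹) θ̄_i - θ̄_i (t T_i⁻¹)`. -/
def phiBar (T : Fin (n - 1) → R) (i : Fin (n - 1)) : R :=
  (t • hInv (T i)) * thetaBar T (lo i) - thetaBar T (lo i) * (t • hInv (T i))

/-- `w` is a reduced word for the permutation `σ` in the simple transpositions. -/
def IsReducedWord (σ : Equiv.Perm (Fin n)) (w : List (Fin (n - 1))) : Prop :=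
  (w.map fun i => Equiv.swap (lo i) (hi i)).prod = σ ∧
    ∀ w' : List (Fin (n - 1)),
      (w'.map fun i => Equiv.swap (lo i) (hi i)).prod = σ → w.length ≤ w'.length

/-- A reduced word for `σ`. -/
def reducedWord (σ : Equiv.Perm (Fin n)) : List (Fin (n - 1)) :=
  Classical.epsilon (IsReducedWord σ)

/-- The trivial idempotent `ε^{(n)} = [n]_t!⁻¹ ∑_σ t^{C(n,2) - ℓ(σ)} T_σ`, where `T_σ` is the
product of the `T_i` along a reduced word of `σ` and `ℓ(σ)` is the length of that word. -/
def trivIdem (T : Fin (n - 1) → R) : R :=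
  (tFactorial n)⁻¹ • ∑ σ : Equiv.Perm (Fin n),
    t ^ ((n.choose 2 : ℤ) - ((reducedWord σ).length : ℤ)) • ((reducedWord σ).map T).prod

end Hecke

/-- The finite Hecke algebra `H_n`. -/
def HeckeAlg (n : ℕ) : Type :=
  RingQuot (HeckeRel (n := n) (FreeAlgebra.ι K : Fin (n - 1) → FreeAlgebra K (Fin (n - 1))))

instance (n : ℕ) : Ring (HeckeAlg n) := inferInstanceAs (Ring (RingQuot _))

instance (n : ℕ) : Algebra K (HeckeAlg n) := inferInstanceAs (Algebra K (RingQuot _))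

/-- The projection of the free algebra on the generators onto `HeckeAlg n`. -/
def HeckeAlg.mk (n : ℕ) : FreeAlgebra K (Fin (n - 1)) →ₐ[K] HeckeAlg n := RingQuot.mkAlgHom K _

/-- The generators `T_i` of `H_n`. -/
def HeckeAlg.T {n : ℕ} (i : Fin (n - 1)) : HeckeAlg n :=
  HeckeAlg.mk n (FreeAlgebra.ι K i)

/-- Symbols for the generators of the positive affine Hecke algebra. -/
inductive AffineGen (n : ℕ) : Type
  | T (i : Fin (n - 1)) : AffineGen n
  | theta (i : Fin n) : AffineGen n

/-- The positive affine Hecke algebra `A_n`. -/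
def AffineAlg (n : ℕ) : Type :=
  RingQuot (AffineRel (n := n) (fun i => FreeAlgebra.ι K (AffineGen.T i))
    (fun i => FreeAlgebra.ι K (AffineGen.theta i)))

instance (n : ℕ) : Ring (AffineAlg n) := inferInstanceAs (Ring (RingQuot _))

instance (n : ℕ) : Algebra K (AffineAlg n) := inferInstanceAs (Algebra K (RingQuot _))

/-- Symbols for the generators of the positive double affine Hecke algebra. -/
inductive DoubleGen (n : ℕ) : Type
  | T (i : Fin (n - 1)) : DoubleGen n
  | theta (i : Fin n) : DoubleGen n
  | X (i : Fin n) : DoubleGen n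

/-- The positive double affine Hecke algebra `D_n`. -/
def DoubleAlg (n : ℕ) : Type :=
  RingQuot (DoubleRel (n := n) (fun i => FreeAlgebra.ι K (DoubleGen.T i))
    (fun i => FreeAlgebra.ι K (DoubleGen.theta i)) (fun i => FreeAlgebra.ι K (DoubleGen.X i)))

instance (n : ℕ) : Ring (DoubleAlg n) := inferInstanceAs (Ring (RingQuot _))

instance (n : ℕ) : Algebra K (DoubleAlg n) := inferInstanceAs (Algebra K (RingQuot _))

/-- The projection of the free algebra on the generators onto `DoubleAlg n`. -/
def DoubleAlg.mk (n : ℕ) : FreeAlgebra K (DoubleGen n) →ₐ[K] DoubleAlg n := RingQuot.mkAlgHom K _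

/-- The generators `T_i` of `D_n`. -/
def DoubleAlg.T {n : ℕ} (i : Fin (n - 1)) : DoubleAlg n :=
  DoubleAlg.mk n (FreeAlgebra.ι K (DoubleGen.T i))

/-- The generators `θ_i` of `D_n`. -/
def DoubleAlg.theta {n : ℕ} (i : Fin n) : DoubleAlg n :=
  DoubleAlg.mk n (FreeAlgebra.ι K (DoubleGen.theta i))

/-- The generators `X_i` of `D_n`. -/
def DoubleAlg.X {n : ℕ} (i : Fin n) : DoubleAlg n :=
  DoubleAlg.mk n (FreeAlgebra.ι K (DoubleGen.X i))

/-! ### The homomorphisms `A_n → D_n` and `ρ_n : A_n → H_n` -/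

section Homs

variable {R : Type*} [Ring R] [Algebra K R] {R' : Type*} [Ring R'] [Algebra K R'] {n : ℕ}

theorem map_hInv (f : R →ₐ[K] R') (x : R) : f (hInv x) = hInv (f x) := by
  simp [hInv]

theorem HeckeRel.map (f : R →ₐ[K] R') {T : Fin (n - 1) → R} {a b : R} (h : HeckeRel T a b) :
    HeckeRel (fun i => f (T i)) (f a) (f b) := by
  cases h with
  | quad i => simpa using HeckeRel.quad (T := fun i => f (T i)) i
  | braid i j h => simpa using HeckeRel.braid (T := fun i => f (T i)) i j h
  | comm i j h => simpa using HeckeRel.comm (T := fun i => f (T i)) i j h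

theorem AffineRel.map (f : R →ₐ[K] R') {T : Fin (n - 1) → R} {θ : Fin n → R} {a b : R}
    (h : AffineRel T θ a b) :
    AffineRel (fun i => f (T i)) (fun i => f (θ i)) (f a) (f b) := by
  cases h with
  | hecke _ _ h => exact .hecke _ _ (h.map f)
  | theta_comm i j => simpa using AffineRel.theta_comm (T := fun i => f (T i)) (θ := fun i => f (θ i)) i j
  | theta_succ i =>
    simpa [map_hInv] using AffineRel.theta_succ (T := fun i => f (T i)) (θ := fun i => f (θ i)) i
  | T_theta i j h₁ h₂ =>
    simpa using AffineRel.T_theta (T := fun i => f (T i)) (θ := fun i => f (θ i)) i j h₁ h₂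

theorem mul_hInv {x : R} (h : (x - 1) * (x + t • (1 : R)) = 0) : x * hInv x = 1 := by
  have h2 : x * (x + (t - 1) • (1 : R)) = t • (1 : R) := by
    have : x * (x + (t - 1) • (1 : R)) = (x - 1) * (x + t • (1 : R)) + t • (1 : R) := by
      simp only [mul_add, sub_mul, sub_smul, mul_sub, mul_smul_comm, mul_one, one_mul, one_smul, smul_sub]
      abel
    rw [this, h, zero_add]
  rw [hInv, mul_smul_comm, h2, smul_smul, inv_mul_cancel₀ t_ne_zero, one_smul]

theorem hInv_mul {x : R} (h : (x - 1) * (x + t • (1 : R)) = 0) : hInv x * x = 1 := by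
  have : hInv x * x = x * hInv x := by
    simp only [hInv, smul_mul_assoc, mul_smul_comm, mul_add, add_mul, one_mul, mul_one]
  rw [this, mul_hInv h]

theorem commute_hInv {x y : R} (h : Commute x y) : Commute x (hInv y) :=
  Commute.smul_right (h.add_right ((Commute.one_right x).smul_right _)) _

theorem braid_inv {R : Type*} [Ring R] {a b a' b' : R} (ha' : a' * a = 1) (hb : b * b' = 1) (hb' : b' * b = 1)
    (ha : a * a' = 1) (h : a * b * a = b * a * b) : a * b' * a' = b' * a' * b := by
  have e : b' * a' * (a * b) = 1 := by
    rw [mul_assoc, ← mul_assoc a', ha', one_mul, hb']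
  calc a * b' * a' = b' * a' * (a * b) * (a * b' * a') := by rw [e, one_mul]
    _ = b' * a' * (a * b * a) * b' * a' := by simp only [mul_assoc]
    _ = b' * a' * b * (a * (b * b')) * a' := by rw [h]; simp only [mul_assoc]
    _ = b' * a' * b := by rw [hb, mul_one, mul_assoc, ha, mul_one]

theorem commute_thetaBarAux_of_lt {T : Fin (n - 1) → R}
    (hT : ∀ a b, HeckeRel T a b → a = b) (i : Fin (n - 1)) (k : ℕ) (hk : k < i.1 ∨ k = 0) :
    Commute (T i) (thetaBarAux T k) := by
  induction k with
  | zero => exact Commute.one_right _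
  | succ k ih =>
    have hkn : k < n - 1 := by omega
    have hc : Commute (T i) (T ⟨k, hkn⟩) :=
      (hT _ _ (HeckeRel.comm ⟨k, hkn⟩ i (by simp only; omega))).symm
    rw [thetaBarAux, dif_pos hkn]
    exact (((commute_hInv hc).mul_right (ih (by omega))).mul_right (commute_hInv hc)).smul_right _

theorem commute_thetaBarAux_of_gt {T : Fin (n - 1) → R}
    (hT : ∀ a b, HeckeRel T a b → a = b) (i : Fin (n - 1)) (m : ℕ) (hm : i.1 + 2 + m < n) :
    Commute (T i) (thetaBarAux T (i.1 + 2 + m)) := by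
  induction m with
  | zero =>
    have hj : i.1 + 1 < n - 1 := by omega
    have qi := hT _ _ (HeckeRel.quad i)
    have qj := hT _ _ (HeckeRel.quad ⟨i.1 + 1, hj⟩)
    have hb := hT _ _ (HeckeRel.braid i ⟨i.1 + 1, hj⟩ rfl)
    have hc := commute_thetaBarAux_of_lt hT ⟨i.1 + 1, hj⟩ i.1 (Or.inl (by simp))
    have e : thetaBarAux T (i.1 + 2 + 0) = t • (hInv (T ⟨i.1 + 1, hj⟩) *
        (t • (hInv (T i) * thetaBarAux T i.1 * hInv (T i))) * hInv (T ⟨i.1 + 1, hj⟩)) := by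
      rw [add_zero, thetaBarAux, dif_pos hj, thetaBarAux, dif_pos i.2]
    rw [e]
    generalize T ⟨i.1 + 1, hj⟩ = b at *
    generalize thetaBarAux T i.1 = x at *
    generalize T i = a at *
    have h1 := braid_inv (hInv_mul qi) (mul_hInv qj) (hInv_mul qj) (mul_hInv qi) hb
    have h2 := braid_inv (hInv_mul qj) (mul_hInv qi) (hInv_mul qi) (mul_hInv qj) hb.symm
    generalize hInv a = a' at *
    generalize hInv b = b' at *
    apply Commute.smul_right
    rw [mul_smul_comm, smul_mul_assoc]
    apply Commute.smul_right
    calc a * (b' * (a' * x * a') * b') = (a * b' * a') * x * a' * b' := by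
          simp only [mul_assoc]
      _ = b' * a' * (b * x) * a' * b' := by rw [h1]; simp only [mul_assoc]
      _ = b' * a' * x * (b * a' * b') := by rw [hc.eq]; simp only [mul_assoc]
      _ = b' * (a' * x * a') * b' * a := by rw [h2]; simp only [mul_assoc]
  | succ m ih =>
    have hkn : i.1 + 2 + m < n - 1 := by omega
    have hc : Commute (T i) (T ⟨i.1 + 2 + m, hkn⟩) :=
      hT _ _ (HeckeRel.comm i ⟨i.1 + 2 + m, hkn⟩ (by simp only; omega))
    rw [← add_assoc, thetaBarAux, dif_pos hkn]
    exact (((commute_hInv hc).mul_right (ih (by omega))).mul_right (commute_hInv hc)).smul_right _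

theorem commute_T_thetaBar {T : Fin (n - 1) → R} (hT : ∀ a b, HeckeRel T a b → a = b)
    (i : Fin (n - 1)) (j : Fin n) (h₁ : j ≠ lo i) (h₂ : j ≠ hi i) :
    Commute (T i) (thetaBar T j) := by
  have h₁' : j.1 ≠ i.1 := fun h => h₁ (Fin.ext h)
  have h₂' : j.1 ≠ i.1 + 1 := fun h => h₂ (Fin.ext h)
  rcases Nat.lt_or_ge j.1 i.1 with h | h
  · exact commute_thetaBarAux_of_lt hT i j.1 (Or.inl h)
  · obtain ⟨m, hm⟩ : ∃ m, j.1 = i.1 + 2 + m := ⟨j.1 - (i.1 + 2), by omega⟩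
    have := commute_thetaBarAux_of_gt hT i m (by omega)
    rwa [← hm] at this

theorem commute_thetaBarAux {T : Fin (n - 1) → R} (hT : ∀ a b, HeckeRel T a b → a = b)
    (j : Fin n) (k : ℕ) (hk : k < j.1) : Commute (thetaBarAux T k) (thetaBar T j) := by
  induction k with
  | zero => exact Commute.one_left _
  | succ k ih =>
    have hkn : k < n - 1 := by omega
    have hc : Commute (T ⟨k, hkn⟩) (thetaBar T j) :=
      commute_T_thetaBar hT _ j (fun h => by have := congrArg Fin.val h; simp [lo] at this; omega)
        (fun h => by have := congrArg Fin.val h; simp [hi] at this; omega)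
    have hc' := (commute_hInv hc.symm).symm
    rw [thetaBarAux, dif_pos hkn]
    exact ((hc'.mul_left (ih (by omega))).mul_left hc').smul_left _

/-- The elements `θ̄_i` satisfy the relations of the positive affine Hecke algebra. -/
theorem thetaBar_rel {T : Fin (n - 1) → R} (hT : ∀ a b, HeckeRel T a b → a = b) (a b : R)
    (h : AffineRel T (thetaBar T) a b) : a = b := by
  cases h with
  | hecke _ _ h => exact hT _ _ h
  | theta_comm i j =>
    rcases lt_trichotomy i j with h | h | h
    · exact commute_thetaBarAux hT j i.1 h
    · rw [h]
    · exact (commute_thetaBarAux hT i j.1 h).symm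
  | theta_succ i =>
    change thetaBarAux T (i.1 + 1) = _
    rw [thetaBarAux, dif_pos i.2]
    rfl
  | T_theta i j h₁ h₂ => exact commute_T_thetaBar hT i j h₁ h₂

end Homs

theorem HeckeAlg.mk_rel {n : ℕ} {a b : FreeAlgebra K (Fin (n - 1))}
    (h : HeckeRel (n := n) (FreeAlgebra.ι K) a b) : HeckeAlg.mk n a = HeckeAlg.mk n b :=
  RingQuot.mkAlgHom_rel K h

theorem HeckeAlg.rel {n : ℕ} (a b : HeckeAlg n) (h : HeckeRel (n := n) HeckeAlg.T a b) :
    a = b := by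
  cases h with
  | quad i => simpa [HeckeAlg.T] using HeckeAlg.mk_rel (HeckeRel.quad (n := n) (T := FreeAlgebra.ι K) i)
  | braid i j h =>
    simpa [HeckeAlg.T] using HeckeAlg.mk_rel (HeckeRel.braid (n := n) (T := FreeAlgebra.ι K) i j h)
  | comm i j h =>
    simpa [HeckeAlg.T] using HeckeAlg.mk_rel (HeckeRel.comm (n := n) (T := FreeAlgebra.ι K) i j h)

/-- The images of the generators of `A_n` under `ρ_n`. -/
def rhoGen (n : ℕ) : AffineGen n → HeckeAlg n
  | .T i => HeckeAlg.T i
  | .theta i => thetaBar HeckeAlg.T i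

/-- The homomorphism `ρ_n : A_n → H_n` with `T_i ↦ T_i` and `θ_i ↦ θ̄_i`. -/
def rho (n : ℕ) : AffineAlg n →ₐ[K] HeckeAlg n :=
  RingQuot.liftAlgHom K ⟨FreeAlgebra.lift K (rhoGen n), fun a b h => by
    have h' := h.map (FreeAlgebra.lift K (rhoGen n))
    simp only [FreeAlgebra.lift_ι_apply] at h'
    exact thetaBar_rel HeckeAlg.rel _ _ h'⟩

/-- The images of the generators of `A_n` in `D_n`. -/
def inclGen (n : ℕ) : AffineGen n → DoubleAlg n
  | .T i => DoubleAlg.T i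
  | .theta i => DoubleAlg.theta i

theorem DoubleAlg.mk_rel {n : ℕ} {a b : FreeAlgebra K (DoubleGen n)}
    (h : DoubleRel (n := n) (fun i => FreeAlgebra.ι K (DoubleGen.T i))
      (fun i => FreeAlgebra.ι K (DoubleGen.theta i)) (fun i => FreeAlgebra.ι K (DoubleGen.X i))
      a b) : DoubleAlg.mk n a = DoubleAlg.mk n b :=
  RingQuot.mkAlgHom_rel K h

/-- The generators of `A_n` as generators of `D_n`. -/
def toDoubleGen (n : ℕ) : AffineGen n → DoubleGen n
  | .T i => .T i
  | .theta i => .theta i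

theorem lift_inclGen (n : ℕ) : FreeAlgebra.lift K (inclGen n) =
    (DoubleAlg.mk n).comp (FreeAlgebra.lift K fun g => FreeAlgebra.ι K (toDoubleGen n g)) := by
  apply FreeAlgebra.hom_ext
  funext g
  cases g <;> simp [inclGen, toDoubleGen, DoubleAlg.T, DoubleAlg.theta]

/-- The homomorphism `A_n → D_n` with `T_i ↦ T_i` and `θ_i ↦ θ_i`. -/
def incl (n : ℕ) : AffineAlg n →ₐ[K] DoubleAlg n :=
  RingQuot.liftAlgHom K ⟨FreeAlgebra.lift K (inclGen n), fun a b h => by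
    have h' := h.map (FreeAlgebra.lift K fun g => FreeAlgebra.ι K (toDoubleGen n g))
    simp only [FreeAlgebra.lift_ι_apply] at h'
    rw [lift_inclGen]
    exact DoubleAlg.mk_rel (DoubleRel.affine _ _ h')⟩

/-! ### Tableaux

A Young diagram is Mathlib's `YoungDiagram` (English notation, a box is a pair
`(row, column)`), and `n` is its number of boxes `μ.card`. -/

/-- The boxes of a diagram. -/
abbrev Box (μ : YoungDiagram) : Type := {b : ℕ × ℕ // b ∈ μ.cells}

variable {μ : YoungDiagram}

/-- The row of a box. -/
def Box.row (b : Box μ) : ℕ := b.1.1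

/-- The column of a box. -/
def Box.col (b : Box μ) : ℕ := b.1.2

/-- The content `column - row` of a box. -/
def Box.content (b : Box μ) : ℤ := (b.col : ℤ) - (b.row : ℤ)

/-- Non-negative reverse semistandard tableaux: labellings by non-negative integers that are
weakly decreasing along rows and strictly decreasing along columns. -/
def IsRSSYT (T : Box μ → ℕ) : Prop :=
  (∀ a b : Box μ, a.row = b.row → a.col < b.col → T b ≤ T a) ∧
    ∀ a b : Box μ, a.col = b.col → a.row < b.row → T b < T a

/-- The order on the formal products `j q^m`, given as pairs `(j, m)`: `j q^m < k q^l` if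
`m > l`, or `m = l` and `j < k`. -/
def PLabelLt {n : ℕ} (x y : Fin n × ℕ) : Prop := y.2 < x.2 ∨ (x.2 = y.2 ∧ x.1 < y.1)

/-- Non-negative periodic standard tableaux: the box `b` carries the formal product
`j q^m` with `j = label b` (counted from `0`) and `m = wt b`. -/
@[ext] structure PSYT (μ : YoungDiagram) where
  /-- the number `j` in a label `j q^m` -/
  label : Box μ ≃ Fin μ.card
  /-- the exponent `m` in a label `j q^m` -/
  wt : Box μ → ℕ
  row_lt : ∀ a b : Box μ, a.row = b.row → a.col < b.col →
    PLabelLt (label a, wt a) (label b, wt b)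
  col_lt : ∀ a b : Box μ, a.col = b.col → a.row < b.row →
    PLabelLt (label a, wt a) (label b, wt b)

/-- Every diagram has a periodic standard tableau: number the boxes row by row. -/
instance : Nonempty (PSYT μ) := by
  let s : Finset (ℕ ×ₗ ℕ) := μ.cells.map toLex.toEmbedding
  have hs : s.card = μ.card := Finset.card_map _
  let g : Box μ ≃ s := toLex.subtypeEquiv fun b => by simp [s]
  let e : Fin μ.card ≃o s := s.orderIsoOfFin hs
  refine ⟨⟨g.trans e.symm.toEquiv, fun _ => 0, fun a b h₁ h₂ => Or.inr ⟨rfl, ?_⟩,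
    fun a b h₁ h₂ => Or.inr ⟨rfl, ?_⟩⟩⟩
  · exact e.symm.strictMono
      (show toLex a.1 < toLex b.1 from Prod.Lex.toLex_lt_toLex.2 (Or.inr ⟨h₁, h₂⟩))
  · exact e.symm.strictMono
      (show toLex a.1 < toLex b.1 from Prod.Lex.toLex_lt_toLex.2 (Or.inl h₂))

namespace PSYT

/-- `c_τ(i)`, the content of the box with the label `i q^b`. -/
def c (τ : PSYT μ) (i : Fin μ.card) : ℤ := (τ.label.symm i).content

/-- `w_τ(i)`, the exponent `b` in the label `i q^b`. -/
def w (τ : PSYT μ) (i : Fin μ.card) : ℕ := τ.wt (τ.label.symm i)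

/-- `σ = s_i(τ)`: the periodic standard tableau `σ` arises from `τ` by exchanging the numbers
`i` and `i + 1` in the labels, the exponents staying in place. -/
def IsSwap (i : Fin (μ.card - 1)) (τ σ : PSYT μ) : Prop :=
  σ.wt = τ.wt ∧ ∀ b, σ.label b = Equiv.swap (lo i) (hi i) (τ.label b)

theorem val_finRotate_symm {n : ℕ} (x : Fin n) :
    (((finRotate n).symm x : Fin n) : ℕ) = if x.1 = 0 then n - 1 else x.1 - 1 := by
  obtain ⟨y, rfl⟩ := (finRotate n).surjective x
  rw [Equiv.symm_apply_apply]
  cases n with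
  | zero => exact y.elim0
  | succ n =>
    rw [coe_finRotate]
    by_cases h : y = Fin.last n
    · simp [h]
    · simp [h]

theorem psi_lt {n : ℕ} {x y : Fin n × ℕ} (h : PLabelLt x y) :
    PLabelLt ((finRotate n).symm x.1, x.2 + if x.1.1 = 0 then 1 else 0)
      ((finRotate n).symm y.1, y.2 + if y.1.1 = 0 then 1 else 0) := by
  obtain ⟨x, a⟩ := x
  obtain ⟨y, b⟩ := y
  simp only [PLabelLt, Fin.lt_def, val_finRotate_symm] at h ⊢
  have hx := x.2
  have hy := y.2
  split_ifs <;> omega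

/-- The operation `Ψ`: a label `k q^a` becomes `(k-1) q^a` when `k ≥ 2`, and `1 q^a` becomes
`n q^{a+1}`. (With labels counted from `0`, `(finRotate n).symm` sends `k` to `k - 1` and `0` to
`n - 1`.) -/
def Psi (τ : PSYT μ) : PSYT μ where
  label := τ.label.trans (finRotate μ.card).symm
  wt b := τ.wt b + if (τ.label b).1 = 0 then 1 else 0
  row_lt a b h₁ h₂ := psi_lt (τ.row_lt a b h₁ h₂)
  col_lt a b h₁ h₂ := psi_lt (τ.col_lt a b h₁ h₂)

/-- The cover relations of the order on periodic standard tableaux: `Cover τ σ` says that `σ`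
covers `τ`. -/
inductive Cover : PSYT μ → PSYT μ → Prop
  | psi (τ : PSYT μ) : Cover τ τ.Psi
  | swap_wt (i : Fin (μ.card - 1)) (τ σ : PSYT μ) (h : IsSwap i τ σ)
      (hw : τ.w (lo i) < τ.w (hi i)) : Cover τ σ
  | swap_content (i : Fin (μ.card - 1)) (τ σ : PSYT μ) (h : IsSwap i τ σ)
      (hw : τ.w (lo i) = τ.w (hi i)) (hc : 1 < τ.c (lo i) - τ.c (hi i)) : Cover τ σ

/-- The partial order `τ ≤ σ` generated by the cover relations. -/
def Le (τ σ : PSYT μ) : Prop := Relation.ReflTransGen Cover τ σ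

/-- The strict order `τ < σ`. -/
def Lt (τ σ : PSYT μ) : Prop := Relation.TransGen Cover τ σ

/-- The tableau `Min(T)`: the least element of `PSYT(μ; T)`. -/
def minT (T : Box μ → ℕ) : PSYT μ :=
  Classical.epsilon fun τ => τ.wt = T ∧ ∀ σ : PSYT μ, σ.wt = T → Le τ σ

/-- The tableau `Top(T)`: the greatest element of `PSYT(μ; T)`. -/
def topT (T : Box μ → ℕ) : PSYT μ :=
  Classical.epsilon fun τ => τ.wt = T ∧ ∀ σ : PSYT μ, σ.wt = T → Le σ τ

end PSYT

/-- `PSYT(μ; T)`: the periodic standard tableaux with exponents `T`. -/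
abbrev PSYTOf (T : Box μ → ℕ) : Type := {τ : PSYT μ // τ.wt = T}

instance (T : Box μ → ℕ) : Fintype (PSYTOf T) :=
  Fintype.ofInjective (fun τ : PSYTOf T => τ.1.label) fun τ σ h =>
    Subtype.ext (PSYT.ext h (τ.2.trans σ.2.symm))

/-- Standard Young tableaux, as the periodic ones all of whose exponents are `0`. -/
abbrev SYT (μ : YoungDiagram) : Type := {τ : PSYT μ // ∀ b, τ.wt b = 0}

/-- `S(T)(a) < S(T)(b)` for the standard tableau `S(T)`, which numbers the boxes by decreasing
value of `T` and, for equal values, column by column from left to right and from top to bottom in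
each column. -/
def StdBefore (T : Box μ → ℕ) (a b : Box μ) : Prop :=
  T b < T a ∨ (T a = T b ∧ (a.col < b.col ∨ (a.col = b.col ∧ a.row < b.row)))

/-- The set `Inv(τ)` of inversion pairs of `τ`. -/
def Inv (τ : PSYT μ) : Finset (Box μ × Box μ) :=
  Finset.univ.filter fun p => StdBefore τ.wt p.1 p.2 ∧ τ.label p.2 < τ.label p.1

/-- The Young subgroup generated by the `s_i` such that `i` and `i + 1` occur in the same row of
`Min(T)` with the same exponent. -/
def youngSubgroup (T : Box μ → ℕ) : Subgroup (Equiv.Perm (Fin μ.card)) :=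
  Subgroup.closure {g | ∃ i : Fin (μ.card - 1), g = Equiv.swap (lo i) (hi i) ∧
    ((PSYT.minT T).label.symm (lo i)).row = ((PSYT.minT T).label.symm (hi i)).row ∧
    (PSYT.minT T).w (lo i) = (PSYT.minT T).w (hi i)}

/-- `[μ(T)]_t!`: the product of the `[m]_t!` over the parts `m` of the composition `μ(T)`, that is
over the sizes `m` of the orbits of the Young subgroup on the labels. -/
def muFactorial (T : Box μ → ℕ) : K :=
  ∏ ω : MulAction.orbitRel.Quotient (youngSubgroup T) (Fin μ.card), tFactorial (Nat.card ω.orbit)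

/-- The monomial `q^{T(b)} t^{c(b)}`. -/
def boxWeight (T : Box μ → ℕ) (b : Box μ) : K := q ^ T b * t ^ b.content

/-- The rational function `K_T(q,t)`. -/
def KT (T : Box μ → ℕ) : K :=
  muFactorial T / tFactorial μ.card * ∏ p ∈ Inv (PSYT.minT T),
    (boxWeight T p.1 - boxWeight T p.2 * t) / (boxWeight T p.1 - boxWeight T p.2)

/-! ### The modules -/

/-- The generator `τ` of the free `H_n`-module on `SYT(μ)`. -/
def gen (τ : SYT μ) : SYT μ →₀ HeckeAlg μ.card := Finsupp.single τ 1

/-- The relations that define the `H_n`-module `μ` on the generators `τ ∈ SYT(μ)`; the elements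
listed here are the ones that become zero. -/
inductive SpechtRel (μ : YoungDiagram) : (SYT μ →₀ HeckeAlg μ.card) → Prop
  | theta (τ : SYT μ) (i : Fin μ.card) :
      SpechtRel μ (thetaBar HeckeAlg.T i • gen τ -
        t ^ τ.1.c i • gen τ)
  | phi (τ σ : SYT μ) (i : Fin (μ.card - 1)) (h : PSYT.IsSwap i τ.1 σ.1)
      (hlt : PSYT.Lt τ.1 σ.1) :
      SpechtRel μ (phiBar HeckeAlg.T i • gen τ -
        (t ^ τ.1.c (lo i) - t ^ τ.1.c (hi i)) • gen σ)
  | row (τ : SYT μ) (i : Fin (μ.card - 1))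
      (h : (τ.1.label.symm (lo i)).row = (τ.1.label.symm (hi i)).row) :
      SpechtRel μ (HeckeAlg.T i • gen τ - gen τ)
  | col (τ : SYT μ) (i : Fin (μ.card - 1))
      (h : (τ.1.label.symm (lo i)).col = (τ.1.label.symm (hi i)).col) :
      SpechtRel μ (HeckeAlg.T i • gen τ + t • gen τ)

/-- The `H_n`-module `μ`, spanned by the standard tableaux with the above relations. -/
abbrev Specht (μ : YoungDiagram) : Type :=
  (SYT μ →₀ HeckeAlg μ.card) ⧸ Submodule.span (HeckeAlg μ.card) {x | SpechtRel μ x}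

/-- The vector `τ` in the module `μ`. -/
def Specht.vec (τ : SYT μ) : Specht μ := Submodule.Quotient.mk (gen τ)

/-- The induced module `V_μ = D_n ⊗_{A_n} ρ_n^*(μ)`: the quotient of `D_n ⊗ μ` (over the base
field) by the `D_n`-submodule spanned by all `d a ⊗ v - d ⊗ ρ_n(a) v` with `a ∈ A_n`. -/
abbrev V (μ : YoungDiagram) : Type :=
  (DoubleAlg μ.card ⊗[K] Specht μ) ⧸ Submodule.span (DoubleAlg μ.card)
    {x | ∃ (d : DoubleAlg μ.card) (a : AffineAlg μ.card) (v : Specht μ),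
      x = (d * incl μ.card a) ⊗ₜ[K] v - d ⊗ₜ[K] (rho μ.card a • v)}

/-- The vector `1 ⊗ v` in `V_μ`. -/
def V.one (v : Specht μ) : V μ := Submodule.Quotient.mk ((1 : DoubleAlg μ.card) ⊗ₜ[K] v)

/-! ### Macdonald polynomials -/

/-- The properties that determine the non-symmetric Macdonald polynomials `F_τ`. In the last one
`v` is `π_n⁻¹ F_τ`. -/
structure IsNonsymmetric (F : PSYT μ → V μ) : Prop where
  weight : ∀ (τ : PSYT μ) (i : Fin μ.card),
    DoubleAlg.theta i • F τ = (q ^ τ.w i * t ^ τ.c i) • F τ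
  std : ∀ τ : SYT μ, F τ.1 = V.one (Specht.vec τ)
  swap : ∀ (i : Fin (μ.card - 1)) (τ σ : PSYT μ), PSYT.IsSwap i τ σ → PSYT.Lt τ σ →
    (t • hInv (DoubleAlg.T i)) • F τ +
      ((t - 1) * (q ^ τ.w (hi i) * t ^ τ.c (hi i)) /
        (q ^ τ.w (lo i) * t ^ τ.c (lo i) - q ^ τ.w (hi i) * t ^ τ.c (hi i))) • F τ = F σ
  psi : ∀ (τ : PSYT μ) (first last : Fin μ.card), first.1 = 0 → last.1 + 1 = μ.card →
    ∃ v : V μ, piElt (n := μ.card) DoubleAlg.T DoubleAlg.theta • v = F τ ∧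
      F τ.Psi = q ^ τ.w first • (DoubleAlg.X last • v)

/-- The non-symmetric Macdonald polynomials `F_τ`: the unique family with these properties. (Every
`τ` is reached from a standard tableau by steps `τ ↦ Ψ(τ)` and `τ ↦ s_i(τ) > τ`.) -/
def nonsym : PSYT μ → V μ := Classical.epsilon IsNonsymmetric

/-- The space `U_T`, the span of the `F_τ` with `τ ∈ PSYT(μ; T)`. -/
def U (T : Box μ → ℕ) : Submodule K (V μ) :=
  Submodule.span K (Set.range fun τ : PSYTOf T => nonsym τ.1)

/-- `p ∈ ε^{(n)}(U_T)` is of the form `F_{Top(T)}` plus a linear combination of the other `F_y`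
with `y ∈ PSYT(μ; T)`. -/
def IsSymmetric (T : Box μ → ℕ) (p : V μ) : Prop :=
  (∃ u ∈ U T, p = trivIdem (DoubleAlg.T (n := μ.card)) • u) ∧
    ∃ κ : PSYTOf T → K, p = nonsym (PSYT.topT T) +
      ∑ y : PSYTOf T with y.1 ≠ PSYT.topT T, κ y • nonsym y.1

/-- The symmetric Macdonald polynomial `P_T`: the unique element with the property
`IsSymmetric T`. -/
def symP (T : Box μ → ℕ) : V μ := Classical.epsilon (IsSymmetric T)

/-! ### The Pieri coefficients -/

/-- The element `e_r[X_1 + ⋯ + X_n]` of `D_n`; the `X_i` commute with each other. -/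
def elemX (n r : ℕ) : DoubleAlg n :=
  ∑ s ∈ (Finset.univ : Finset (Fin n)).powersetCard r,
    ((s.sort (· ≤ ·)).map DoubleAlg.X).prod

/-- The value `e_r(1, t, …, t^{n-1})`. -/
def elemT (n r : ℕ) : K :=
  ∑ s ∈ (Finset.univ : Finset (Fin n)).powersetCard r, ∏ i ∈ s, t ^ (i : ℕ)

/-- The reverse semistandard tableaux obtained from `T` by adding `r` ones to the boxes, at most
one to each box. -/
def addOnes (T : Box μ → ℕ) (r : ℕ) : Finset (Box μ → ℕ) :=
  (((Finset.univ : Finset (Box μ)).powersetCard r).image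
    fun A b => T b + if b ∈ A then 1 else 0).filter IsRSSYT

/-- The coefficient `d^{(r)}_{S,T}`; the sum is over the `τ ∈ PSYT(μ; T)` with
`Ψ^r(τ) ∈ PSYT(μ; S)`. -/
def pieriCoeff (r : ℕ) (S T : Box μ → ℕ) : K :=
  elemT μ.card r * KT S * ∑ τ : PSYTOf T with (PSYT.Psi^[r] τ.1).wt = S,
    t ^ (∑ i : Fin μ.card with i.1 < r, τ.1.c i) *
      (∏ p ∈ Inv τ.1,
        (boxWeight T p.1 * t - boxWeight T p.2) / (boxWeight T p.1 - boxWeight T p.2)) *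
      ∏ p ∈ Inv (PSYT.Psi^[r] τ.1),
        (boxWeight S p.1 - boxWeight S p.2) / (boxWeight S p.1 - boxWeight S p.2 * t)

end

end VVMacdonald

/-! On vectors fixed by all `T i`, multiplication by e_r[X] can be traded for a single operator
followed by symmetrization. Put Y = t^{-(n-1)} X_n T_{n-1}⋯T_1 (`opY`) and let ε be `trivIdem`.
Because ε T_i = ε, the vectors ε X^s p with |s| = r are proportional to each other, and the ratios
are the powers of t whose sum is e_r(1,t,…,t^{n-1}). Since e_r[X] commutes with the T_i, this gives
e_r[X] p = e_r(1,…,t^{n-1}) ε Y^r p (`elem_smul_eq`). The operator Y acts by Y F_τ = t^{c_τ(1)}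
F_{Ψ(τ)}, so Y^r F_τ is a power of t times F_{Ψ^r(τ)} (`opY_pow_smul_nonsym`).

It remains to pass between the F_τ and the P_S. Each T_i maps F_τ to an explicit combination of F_τ
and F_{s_i(τ)} (`IsEigenFamily.T_smul`). Solving T_i p = p expresses P_T as a sum of the F_τ whose
coefficients are products over Inv(τ) (`IsEigenFamily.invariant_eq`, `symP_eq`). Conversely, ε F_σ
is a multiple of P_S, where S is the exponent function of σ. An upward swap multiplies ε F by one
explicit factor (`IsEigenFamily.trivIdem_smul_top`), so only σ = Min(S) has to be computed. There
the coefficient of F_{Top(S)} in ε F_{Min(S)} comes from one coset of a Young subgroup and equals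
[μ(S)]_t!/[n]_t! (`IsEigenFamily.trivIdem_smul_min`). If S is not reverse semistandard, then ε F_σ =
0, because Top(S) has consecutive labels in one column, where T_i acts by -t
(`IsEigenFamily.trivIdem_smul_eq_zero`). Inserting all this into ε Y^r P_T gives the formula.

The F_τ and P_T are defined by a choice operator, so their existence has to be proved. The F_τ are
built by recursion on a rank (`exists_isFamily`). The coherence of the recursion is the Yang–Baxter
equation together with the fact that Y rotates indices as Ψ rotates labels. The vector π_n⁻¹ F_τ is
pinned down by the injectivity of π_n (`piElt_injective`). It is never needed that F_τ is non-zero: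
for fixed exponents either all or none of the F_τ vanish, and the second case is trivial. -/

namespace VVMacdonald

noncomputable section

open Classical TensorProduct

/-! ### Relations in Hecke algebras -/

section HeckeRelations

set_option linter.unusedSectionVars false

variable {R : Type*} [Ring R] [Algebra K R] {n : ℕ} {T : Fin (n - 1) → R} {θ X : Fin n → R}

/-- The element `t T_i⁻¹`. -/
def opA (T : Fin (n - 1) → R) (i : Fin (n - 1)) : R := t • hInv (T i)

theorem opA_eq (i : Fin (n - 1)) : opA T i = T i + (t - 1) • (1 : R) := by
  rw [opA, hInv, smul_smul, mul_inv_cancel₀ t_ne_zero, one_smul]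

/-- The scalars in this and the next lemmas form an arbitrary commutative ring, so that
normalization by `module` does not meet the concrete field `K`. -/
theorem generic_quad {k : Type*} [CommRing k] [Algebra k R] {s : k} {a : R}
    (h : (a - 1) * (a + s • (1 : R)) = 0) : a * a = (1 - s) • a + s • (1 : R) := by
  have e : (a - 1) * (a + s • (1 : R)) = a * a - ((1 - s) • a + s • (1 : R)) := by
    simp only [mul_add, sub_mul, mul_smul_comm, mul_one, one_mul]
    module
  rw [e] at h
  exact sub_eq_zero.1 h

theorem generic_shift_sq {k : Type*} [CommRing k] [Algebra k R] {s : k} {a : R}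
    (h : a * a = (1 - s) • a + s • (1 : R)) :
    (a + (s - 1) • (1 : R)) * (a + (s - 1) • (1 : R)) =
      (s - 1) • (a + (s - 1) • (1 : R)) + s • (1 : R) := by
  simp only [mul_add, add_mul, smul_mul_assoc, mul_smul_comm, mul_one, one_mul, h]
  module

theorem generic_shift_braid {k : Type*} [CommRing k] [Algebra k R] {s : k} {a b : R}
    (ha : a * a = (1 - s) • a + s • (1 : R)) (hb : b * b = (1 - s) • b + s • (1 : R))
    (h : a * b * a = b * a * b) :
    (a + (s - 1) • (1 : R)) * (b + (s - 1) • (1 : R)) * (a + (s - 1) • (1 : R)) =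
      (b + (s - 1) • (1 : R)) * (a + (s - 1) • (1 : R)) * (b + (s - 1) • (1 : R)) := by
  simp only [mul_add, add_mul, smul_mul_assoc, mul_smul_comm, mul_one, one_mul, ha, hb, h]
  module

/-- After expansion, the quadratic and braid relations cancel everything except a multiple of `a -
b`; `hxyz` says that its coefficient vanishes. The hypothesis is met by the coefficients of the
intertwiners, see `swapCoeff_ybe`. -/
theorem generic_yang_baxter {k : Type*} [CommRing k] [Algebra k R] {s x y z : k} {a b : R}
    (ha : a * a = (s - 1) • a + s • (1 : R)) (hb : b * b = (s - 1) • b + s • (1 : R))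
    (h : a * b * a = b * a * b) (hxyz : x * y = z * (x + y + s - 1)) :
    (a + y • (1 : R)) * (b + z • (1 : R)) * (a + x • (1 : R)) =
      (b + x • (1 : R)) * (a + z • (1 : R)) * (b + y • (1 : R)) := by
  have h1 : (a + y • (1 : R)) * (b + z • (1 : R)) * (a + x • (1 : R)) -
      (b + x • (1 : R)) * (a + z • (1 : R)) * (b + y • (1 : R)) =
      (z * (x + y + s - 1) - x * y) • (a - b) := by
    simp only [mul_add, add_mul, smul_mul_assoc, mul_smul_comm, mul_one, one_mul, ha, hb, h]
    module
  rw [← sub_eq_zero, h1, hxyz, sub_self, zero_smul]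

theorem opA_mul_self (hT : ∀ a b, HeckeRel T a b → a = b) (i : Fin (n - 1)) :
    opA T i * opA T i = (t - 1) • opA T i + t • (1 : R) := by
  rw [opA_eq]
  exact generic_shift_sq (generic_quad (hT _ _ (HeckeRel.quad i)))

theorem opA_braid (hT : ∀ a b, HeckeRel T a b → a = b) {i j : Fin (n - 1)} (h : i.1 + 1 = j.1) :
    opA T i * opA T j * opA T i = opA T j * opA T i * opA T j := by
  rw [opA_eq, opA_eq]
  exact generic_shift_braid (generic_quad (hT _ _ (HeckeRel.quad i)))
    (generic_quad (hT _ _ (HeckeRel.quad j))) (hT _ _ (HeckeRel.braid i j h))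

theorem opA_comm (hT : ∀ a b, HeckeRel T a b → a = b) {i j : Fin (n - 1)} (h : i.1 + 1 < j.1) :
    Commute (opA T i) (opA T j) := by
  have hc : Commute (T i) (T j) := hT _ _ (HeckeRel.comm i j h)
  exact ((commute_hInv (commute_hInv hc).symm).symm.smul_right t).smul_left t

theorem yang_baxter (hT : ∀ a b, HeckeRel T a b → a = b) {i j : Fin (n - 1)} (h : i.1 + 1 = j.1)
    {x y z : K} (hxyz : x * y = z * (x + y + t - 1)) :
    (opA T i + y • (1 : R)) * (opA T j + z • (1 : R)) * (opA T i + x • (1 : R)) =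
      (opA T j + x • (1 : R)) * (opA T i + z • (1 : R)) * (opA T j + y • (1 : R)) := by
  exact generic_yang_baxter (opA_mul_self hT i) (opA_mul_self hT j) (opA_braid hT h) hxyz

/-- Relation between `t T_i⁻¹` and `θ_i`. -/
theorem opA_mul_theta_lo (h : ∀ a b, AffineRel T θ a b → a = b) (i : Fin (n - 1)) :
    θ (hi i) * opA T i = opA T i * θ (lo i) + (t - 1) • θ (hi i) := by
  have hs := h _ _ (AffineRel.theta_succ i)
  have hq := h _ _ (AffineRel.hecke _ _ (HeckeRel.quad i))
  have e : θ (hi i) * T i = opA T i * θ (lo i) := by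
    rw [hs, opA]
    simp only [smul_mul_assoc, mul_assoc, hInv_mul hq, mul_one]
  rw [← e, opA_eq]
  simp only [mul_add, mul_smul_comm, mul_one]

theorem opA_mul_theta_hi (h : ∀ a b, AffineRel T θ a b → a = b) (i : Fin (n - 1)) :
    θ (lo i) * opA T i = opA T i * θ (hi i) - (t - 1) • θ (hi i) := by
  have hs := h _ _ (AffineRel.theta_succ i)
  have hq := h _ _ (AffineRel.hecke _ _ (HeckeRel.quad i))
  have e : T i * θ (hi i) = θ (lo i) * opA T i := by
    rw [hs, opA]
    simp only [mul_smul_comm, ← mul_assoc, mul_hInv hq, one_mul]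
  rw [← e, opA_eq]
  simp only [add_mul, smul_mul_assoc, one_mul]
  abel

theorem opA_comm_theta (h : ∀ a b, AffineRel T θ a b → a = b) (i : Fin (n - 1)) (j : Fin n)
    (h₁ : j ≠ lo i) (h₂ : j ≠ hi i) : θ j * opA T i = opA T i * θ j := by
  have hc : Commute (θ j) (T i) := (h _ _ (AffineRel.T_theta i j h₁ h₂)).symm
  exact ((commute_hInv hc).smul_right t).eq

/-! ### The product of all generators -/

/-- The product `T_{k-1} ⋯ T_0`. -/
def descProd (T : Fin (n - 1) → R) : ℕ → R
  | 0 => 1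
  | k + 1 => if h : k < n - 1 then T ⟨k, h⟩ * descProd T k else descProd T k

theorem descProd_succ {k : ℕ} (h : k < n - 1) :
    descProd T (k + 1) = T ⟨k, h⟩ * descProd T k := by
  rw [descProd, dif_pos h]

theorem commute_descProd {x : R} {k : ℕ} (h : ∀ i : Fin (n - 1), i.1 < k → Commute x (T i)) :
    Commute x (descProd T k) := by
  induction k with
  | zero => exact Commute.one_right _
  | succ k ih =>
    rw [descProd]
    split_ifs with hk
    · exact (h _ (by simp)).mul_right (ih fun i hi => h i (by omega))
    · exact ih fun i hi => h i (by omega)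

/-- Going left, `T j` commutes with the factors below `T i`, the braid relation turns `T j * T i * T
j` into `T i * T j * T i`, and the new `T i` commutes with the factors above `T j`. -/
theorem descProd_mul (hT : ∀ a b, HeckeRel T a b → a = b) {i j : Fin (n - 1)}
    (hij : i.1 + 1 = j.1) {k : ℕ} (hk : j.1 < k) (hkn : k ≤ n - 1) :
    descProd T k * T j = T i * descProd T k := by
  induction k with
  | zero => omega
  | succ k ih =>
    rw [descProd_succ (by omega)]
    rcases Nat.lt_or_ge j.1 k with h | h
    · have hc : T i * T ⟨k, by omega⟩ = T ⟨k, by omega⟩ * T i :=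
        hT _ _ (HeckeRel.comm i ⟨k, by omega⟩ (by simp only; omega))
      rw [mul_assoc, ih h (by omega), ← mul_assoc, ← hc, mul_assoc]
    · have hjk : j = ⟨k, by omega⟩ := Fin.ext (by simp only; omega)
      rw [← hjk]
      obtain rfl : k = i.1 + 1 := by omega
      rw [descProd_succ (by omega)]
      have hc : Commute (T j) (descProd T i.1) := commute_descProd fun l hl =>
        (hT _ _ (HeckeRel.comm l j (by omega))).symm
      have hb := hT _ _ (HeckeRel.braid i j hij)
      change T j * (T i * _) * T j = T i * (T j * (T i * _))
      rw [mul_assoc, mul_assoc, ← hc.eq]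
      simp only [← mul_assoc]
      rw [hb]

theorem ofFn_hInv_mul_descProd (hT : ∀ a b, HeckeRel T a b → a = b) {k : ℕ} (hk : k ≤ n - 1) :
    (List.ofFn fun i : Fin k => hInv (T (i.castLE hk))).prod * descProd T k = 1 ∧
      descProd T k * (List.ofFn fun i : Fin k => hInv (T (i.castLE hk))).prod = 1 := by
  induction k with
  | zero => simp [descProd]
  | succ k ih =>
    rw [descProd_succ (by omega), List.ofFn_succ_last, List.prod_append]
    obtain ⟨h1, h2⟩ := ih (by omega)
    have hq := hT _ _ (HeckeRel.quad ⟨k, by omega⟩)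
    have e : Fin.castLE hk (Fin.last k) = ⟨k, by omega⟩ := rfl
    have e' : (fun i : Fin k => hInv (T (Fin.castLE hk i.castSucc))) =
      fun i : Fin k => hInv (T (i.castLE (by omega))) := rfl
    simp only [List.prod_cons, List.prod_nil, mul_one, e, e']
    constructor
    · rw [mul_assoc, ← mul_assoc (hInv _), hInv_mul hq, one_mul, h1]
    · rw [mul_assoc, ← mul_assoc (descProd T k), h2, one_mul, mul_hInv hq]

variable (T) in
/-- The product `T_0⁻¹ ⋯ T_{n-2}⁻¹`. -/
def descInv : R := (List.ofFn fun i => hInv (T i)).prod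

theorem descInv_mul (hT : ∀ a b, HeckeRel T a b → a = b) :
    descInv T * descProd T (n - 1) = 1 := (ofFn_hInv_mul_descProd hT le_rfl).1

theorem mul_descInv (hT : ∀ a b, HeckeRel T a b → a = b) :
    descProd T (n - 1) * descInv T = 1 := (ofFn_hInv_mul_descProd hT le_rfl).2

theorem piElt_eq (hn : 0 < n) : piElt T θ = t ^ (n - 1) • (θ ⟨0, hn⟩ * descInv T) := by
  rw [piElt, dif_pos hn, descInv]

theorem piElt_mul_descProd (hT : ∀ a b, HeckeRel T a b → a = b) (hn : 0 < n) :
    piElt T θ * descProd T (n - 1) = t ^ (n - 1) • θ ⟨0, hn⟩ := by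
  rw [piElt_eq hn, smul_mul_assoc, mul_assoc, descInv_mul hT, mul_one]

/-- The factor `descInv T` shifts the index as the inverse of `descProd_mul`, and `T j` commutes
with the first `θ` because `j` is not the first index. -/
theorem mul_piElt (h : ∀ a b, AffineRel T θ a b → a = b) {i j : Fin (n - 1)}
    (hij : i.1 + 1 = j.1) : T j * piElt T θ = piElt T θ * T i := by
  have hT : ∀ a b, HeckeRel T a b → a = b := fun a b r => h _ _ (.hecke _ _ r)
  have hn : 0 < n := by omega
  have h1 := descProd_mul hT hij (k := n - 1) j.2 le_rfl
  have h2 : T j * descInv T = descInv T * T i := by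
    calc T j * descInv T = descInv T * (descProd T (n - 1) * T j) * descInv T := by
          rw [← mul_assoc, descInv_mul hT, one_mul]
      _ = descInv T * T i := by rw [h1, mul_assoc, mul_assoc, mul_descInv hT, mul_one]
  have h3 := h _ _ (AffineRel.T_theta j ⟨0, hn⟩
    (fun e => by have := congrArg Fin.val e; simp [lo] at this; omega)
    (fun e => by have := congrArg Fin.val e; simp [hi] at this))
  rw [piElt_eq hn, mul_smul_comm, smul_mul_assoc, ← mul_assoc, h3, mul_assoc, h2, mul_assoc]

/-- In the induction the new factor `T k` passes through the full product and becomes `T (k + 1)`.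
The case `k = n - 2` yields `hInv_mul_descProd`: a double rotation carries the first generator to
the last one. -/
theorem descProd_sq (hT : ∀ a b, HeckeRel T a b → a = b) (h1 : 0 < n - 1) {k : ℕ}
    (hk : k + 1 ≤ n - 1) :
    descProd T k * descProd T (n - 1) * T ⟨0, h1⟩ = descProd T (n - 1) * descProd T (k + 1) := by
  induction k with
  | zero => rw [descProd_succ h1, descProd]; simp
  | succ k ih =>
    rw [descProd_succ (k := k) (by omega), descProd_succ (k := k + 1) (by omega), mul_assoc,
      mul_assoc, ← mul_assoc (descProd T k), ih (by omega), ← mul_assoc, ← mul_assoc]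
    rw [descProd_mul hT (i := ⟨k, by omega⟩) (j := ⟨k + 1, by omega⟩) rfl (by simp only; omega)
      le_rfl]

/-- The factor `hInv (T 0)` cancels the last factor of the product; the remaining generators `T k,
…, T 1` each lose one from their index when they pass `piElt`. -/
theorem descProd_mul_piElt (h : ∀ a b, AffineRel T θ a b → a = b) (h1 : 0 < n - 1) {k : ℕ}
    (hk : k + 1 ≤ n - 1) :
    descProd T (k + 1) * hInv (T ⟨0, h1⟩) * piElt T θ = piElt T θ * descProd T k := by
  have hT : ∀ a b, HeckeRel T a b → a = b := fun a b r => h _ _ (.hecke _ _ r)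
  induction k with
  | zero =>
    rw [descProd_succ h1, descProd, mul_one, mul_hInv (hT _ _ (.quad _)), one_mul, mul_one]
  | succ k ih =>
    rw [descProd_succ (k := k + 1) (by omega), mul_assoc, mul_assoc, ← mul_assoc (descProd T _),
      ih (by omega), ← mul_assoc,
      mul_piElt h (i := ⟨k, by omega⟩) (j := ⟨k + 1, by omega⟩) rfl, mul_assoc,
      descProd_succ (k := k) (by omega)]

end HeckeRelations

end

end VVMacdonald

/-! ### The double affine Hecke algebra: the operator Y and elementary symmetric polynomials in the
X_i. -/

namespace VVMacdonald

noncomputable section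

open Classical TensorProduct

section DoubleRelations

set_option linter.unusedSectionVars false

variable {R : Type*} [Ring R] [Algebra K R] {n : ℕ} {T : Fin (n - 1) → R} {θ X : Fin n → R}

theorem DoubleRel.toAffine (h : ∀ a b, DoubleRel T θ X a b → a = b) :
    ∀ a b, AffineRel T θ a b → a = b := fun _ _ r => h _ _ (.affine _ _ r)

theorem DoubleRel.toHecke (h : ∀ a b, DoubleRel T θ X a b → a = b) :
    ∀ a b, HeckeRel T a b → a = b := fun _ _ r => h _ _ (.affine _ _ (.hecke _ _ r))

theorem T_mul_X_hi (h : ∀ a b, DoubleRel T θ X a b → a = b) (i : Fin (n - 1)) :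
    T i * X (hi i) = t • (X (lo i) * hInv (T i)) := by
  rw [h _ _ (.X_succ i), mul_smul_comm, ← mul_assoc, ← mul_assoc,
    mul_hInv (DoubleRel.toHecke h _ _ (.quad i)), one_mul]

theorem X_hi_mul_T (h : ∀ a b, DoubleRel T θ X a b → a = b) (i : Fin (n - 1)) :
    X (hi i) * T i = t • (hInv (T i) * X (lo i)) := by
  rw [h _ _ (.X_succ i), smul_mul_assoc, mul_assoc,
    hInv_mul (DoubleRel.toHecke h _ _ (.quad i)), mul_one]

theorem commute_T_X (h : ∀ a b, DoubleRel T θ X a b → a = b) {i : Fin (n - 1)} {j : Fin n}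
    (h₁ : j.1 ≠ i.1) (h₂ : j.1 ≠ i.1 + 1) : Commute (T i) (X j) :=
  h _ _ (.T_X i j (fun e => h₁ (congrArg Fin.val e)) (fun e => h₂ (congrArg Fin.val e)))

/-- Both products equal t X_i T_i⁻¹ X_i, by the relation between X_i and X_{i+1}. -/
theorem commute_T_X_mul_X (h : ∀ a b, DoubleRel T θ X a b → a = b) (i : Fin (n - 1)) :
    Commute (T i) (X (hi i) * X (lo i)) := by
  change T i * (X (hi i) * X (lo i)) = X (hi i) * X (lo i) * T i
  rw [← mul_assoc, T_mul_X_hi h, smul_mul_assoc, mul_assoc, ← mul_smul_comm, ← X_hi_mul_T h,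
    ← mul_assoc, h _ _ (.X_comm (lo i) (hi i))]

variable (T X) in
/-- The element `Y = t^{-(n-1)} X_n T_{n-1} ⋯ T_1` of the double affine Hecke algebra. -/
def opY (hn : 0 < n) : R :=
  (t ^ (n - 1))⁻¹ • (X ⟨n - 1, by omega⟩ * descProd T (n - 1))

/-- This lemma, `T_last_mul_opY_sq`, `theta_mul_opY` and `theta_last_mul_opY` show that Y rotates
indices as Ψ rotates labels. Here `T i` commutes with X_n because `i` is not the last index, so only
the shift through `descProd` matters. -/
theorem T_mul_opY (h : ∀ a b, DoubleRel T θ X a b → a = b) (hn : 0 < n) {i j : Fin (n - 1)}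
    (hij : i.1 + 1 = j.1) : T i * opY T X hn = opY T X hn * T j := by
  have hc : Commute (T i) (X ⟨n - 1, by omega⟩) :=
    commute_T_X h (by simp only; omega) (by simp only; omega)
  rw [opY, mul_smul_comm, ← mul_assoc, hc.eq, mul_assoc,
    ← descProd_mul (DoubleRel.toHecke h) hij j.2 le_rfl, smul_mul_assoc, mul_assoc]

theorem descProd_mul_X_last (h : ∀ a b, DoubleRel T θ X a b → a = b) {l : Fin (n - 1)}
    (hl : l.1 + 1 = n - 1) :
    descProd T (n - 1) * X (hi l) = t • (X (lo l) * hInv (T l) * descProd T (n - 2)) := by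
  have hc : Commute (X (hi l)) (descProd T l.1) := commute_descProd fun i hi' =>
    (commute_T_X h (by simp only [hi]; omega) (by simp only [hi]; omega)).symm
  have e : descProd T (n - 1) = T l * descProd T l.1 :=
    (congrArg (descProd T) hl).symm.trans (descProd_succ l.2)
  have e2 : n - 2 = l.1 := by omega
  rw [e, mul_assoc, ← hc.eq, ← mul_assoc, T_mul_X_hi h, smul_mul_assoc, e2]

theorem hInv_mul_descProd (hT : ∀ a b, HeckeRel T a b → a = b) {l z : Fin (n - 1)}
    (hl : l.1 + 1 = n - 1) (hz : z.1 = 0) :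
    descProd T (n - 2) * descProd T (n - 1) * T z =
      T l * (descProd T (n - 2) * descProd T (n - 1)) := by
  have hz' : z = ⟨0, by omega⟩ := Fin.ext hz
  have e2 : n - 2 = l.1 := by omega
  have e : descProd T (n - 1) = T l * descProd T l.1 :=
    (congrArg (descProd T) hl).symm.trans (descProd_succ l.2)
  rw [hz', e2, descProd_sq hT (by omega) (k := l.1) (by omega), ← mul_assoc, ← e, hl]

/-- The last generator cannot be moved through a single Y within the T_i, but two rotations bring it
to the first one. Up to a scalar, Y² is X_n X_{n-1}, which commutes with T_{n-1}, times an element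
that intertwines the last and the first generator. -/
theorem T_last_mul_opY_sq (h : ∀ a b, DoubleRel T θ X a b → a = b) (hn : 0 < n)
    {l z : Fin (n - 1)} (hl : l.1 + 1 = n - 1) (hz : z.1 = 0) :
    T l * (opY T X hn * opY T X hn) = opY T X hn * opY T X hn * T z := by
  have hT := DoubleRel.toHecke h
  have e : (⟨n - 1, by omega⟩ : Fin n) = hi l := Fin.ext (by simp only [hi]; omega)
  have e1 : X (hi l) * descProd T (n - 1) * (X (hi l) * descProd T (n - 1)) =
      t • (X (hi l) * X (lo l) * (hInv (T l) * (descProd T (n - 2) * descProd T (n - 1)))) := by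
    rw [mul_assoc, ← mul_assoc (descProd T (n - 1)), descProd_mul_X_last h hl]
    simp only [mul_smul_comm, smul_mul_assoc, mul_assoc]
  have hq := hT _ _ (.quad l)
  have key : T l * (X (hi l) * X (lo l) * (hInv (T l) *
      (descProd T (n - 2) * descProd T (n - 1)))) = X (hi l) * X (lo l) * (hInv (T l) *
      (descProd T (n - 2) * descProd T (n - 1))) * T z := by
    rw [← mul_assoc, (commute_T_X_mul_X h l).eq, mul_assoc _ _ (T z), mul_assoc _ _ (T z),
      hInv_mul_descProd hT hl hz, mul_assoc (X (hi l) * _), ← mul_assoc (T l),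
      ← mul_assoc (hInv (T l)), mul_hInv hq, hInv_mul hq]
  simp only [opY, e, smul_mul_assoc, mul_smul_comm, e1, key]

theorem theta_zero_mul_opY (h : ∀ a b, DoubleRel T θ X a b → a = b) (hn : 0 < n)
    {z : Fin (n - 1)} (hz : z.1 = 0) :
    θ (lo z) * opY T X hn = opY T X hn * θ (hi z) := by
  have hT := DoubleRel.toHecke h
  have hA := DoubleRel.toAffine h
  let l : Fin (n - 1) := ⟨n - 2, by omega⟩
  have hl : l.1 + 1 = n - 1 := by simp only [l]; omega
  have hz' : lo z = ⟨0, hn⟩ := Fin.ext hz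
  have e : (⟨n - 1, by omega⟩ : Fin n) = hi l := Fin.ext (by simp only [hi]; omega)
  have hqz := hT _ _ (.quad z)
  have hql := hT _ _ (.quad l)
  -- Writing θ_1 through π_n makes the relation π_n X_{n-1} = X_n π_n applicable.
  have hθ : t ^ (n - 1) • θ (lo z) = piElt T θ * descProd T (n - 1) := by
    rw [piElt_mul_descProd hT hn, hz']
  have ht : t ^ (n - 1) ≠ 0 := pow_ne_zero _ t_ne_zero
  have hθ1 : t ^ (n - 1) • θ (hi z) =
      t • (hInv (T z) * (piElt T θ * descProd T (n - 1)) * hInv (T z)) := by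
    rw [← hθ, hA _ _ (.theta_succ z), smul_comm]
    simp only [mul_smul_comm, smul_mul_assoc]
  have hd : descProd T (n - 1) * hInv (T z) * piElt T θ = piElt T θ * descProd T (n - 2) := by
    have := descProd_mul_piElt hA (k := n - 2) (by omega) (by omega)
    rw [show n - 2 + 1 = n - 1 by omega] at this
    rw [← this]
    congr 4
    exact Fin.ext hz
  have hcc : hInv (T l) * (descProd T (n - 2) * descProd T (n - 1)) =
      descProd T (n - 2) * descProd T (n - 1) * hInv (T z) := by
    have := hInv_mul_descProd hT hl hz
    calc _ = hInv (T l) * (descProd T (n - 2) * descProd T (n - 1) * T z) * hInv (T z) := by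
          rw [mul_assoc, mul_assoc _ (T z), mul_hInv hqz, mul_one]
      _ = _ := by rw [this, ← mul_assoc, hInv_mul hql, one_mul]
  have key : t ^ (n - 1) • (θ (lo z) * (X (hi l) * descProd T (n - 1))) =
      t ^ (n - 1) • (X (hi l) * descProd T (n - 1) * θ (hi z)) := by
    have hp : piElt T θ * X (lo l) = X (hi l) * piElt T θ := h _ _ (.pi_X l)
    rw [← smul_mul_assoc, hθ, ← mul_smul_comm, hθ1, ← mul_assoc, mul_assoc (piElt T θ),
      descProd_mul_X_last h hl, mul_smul_comm, mul_smul_comm, smul_mul_assoc]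
    congr 1
    calc piElt T θ * (X (lo l) * hInv (T l) * descProd T (n - 2)) * descProd T (n - 1)
        = piElt T θ * X (lo l) * (hInv (T l) * (descProd T (n - 2) * descProd T (n - 1))) := by
          simp only [mul_assoc]
      _ = X (hi l) * (piElt T θ * descProd T (n - 2)) * (descProd T (n - 1) * hInv (T z)) := by
          rw [hp, hcc]; simp only [mul_assoc]
      _ = _ := by rw [← hd]; simp only [mul_assoc]
  have key' := (smul_right_injective R ht) key
  simp only [opY, e, mul_smul_comm, smul_mul_assoc, key']

theorem theta_mul_opY (h : ∀ a b, DoubleRel T θ X a b → a = b) (hn : 0 < n) (i : Fin (n - 1)) :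
    θ (lo i) * opY T X hn = opY T X hn * θ (hi i) := by
  have hT := DoubleRel.toHecke h
  have hA := DoubleRel.toAffine h
  obtain ⟨k, hk⟩ := i
  induction k with
  | zero => exact theta_zero_mul_opY h hn rfl
  | succ k ih =>
    have ih' := ih (by omega)
    have e : lo (⟨k + 1, hk⟩ : Fin (n - 1)) = hi ⟨k, by omega⟩ := rfl
    have hq := hT _ _ (.quad ⟨k, by omega⟩)
    have hq' := hT _ _ (.quad ⟨k + 1, by omega⟩)
    have hY : hInv (T ⟨k, by omega⟩) * opY T X hn = opY T X hn * hInv (T ⟨k + 1, hk⟩) := by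
      have := T_mul_opY h hn (i := ⟨k, by omega⟩) (j := ⟨k + 1, hk⟩) rfl
      simp only [hInv, smul_mul_assoc, add_mul, this, one_mul, mul_smul_comm, mul_add, mul_one]
    rw [hA _ _ (.theta_succ ⟨k + 1, hk⟩), e, hA _ _ (.theta_succ ⟨k, by omega⟩), smul_mul_assoc,
      mul_assoc, hY, mul_assoc, ← mul_assoc (θ _), ih', mul_smul_comm]
    congr 1
    rw [← mul_assoc, ← mul_assoc, hY, hA _ _ (.theta_succ ⟨k, by omega⟩)]
    simp only [mul_assoc]

/-- Families that satisfy `Z_{i+1} = t T_i⁻¹ Z_i T_i⁻¹`, such as the `θ_i` and the `X_i`. -/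
theorem succ_family (Z : Fin n → R)
    (hZ : ∀ i, Z (hi i) = t • (hInv (T i) * Z (lo i) * hInv (T i))) (hn : 0 < n) :
    Z ⟨n - 1, by omega⟩ =
      t ^ (n - 1) • (descProd (fun i => hInv (T i)) (n - 1) * Z ⟨0, hn⟩ * descInv T) := by
  have key : ∀ k (hk : k ≤ n - 1), Z ⟨k, by omega⟩ =
      t ^ k • (descProd (fun i => hInv (T i)) k * Z ⟨0, hn⟩ *
        (List.ofFn fun i : Fin k => hInv (T (i.castLE hk))).prod) := by
    intro k hk
    induction k with
    | zero => simp [descProd]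
    | succ k ih =>
      have := hZ ⟨k, by omega⟩
      have ih' := ih (by omega)
      change Z ⟨k + 1, _⟩ = t • (_ * Z ⟨k, _⟩ * _) at this
      rw [this, ih', descProd_succ (by omega), List.ofFn_succ_last, List.prod_append]
      have e' : (fun i : Fin k => hInv (T (Fin.castLE hk i.castSucc))) =
        fun i : Fin k => hInv (T (i.castLE (by omega))) := rfl
      have e : Fin.castLE hk (Fin.last k) = ⟨k, by omega⟩ := rfl
      simp only [List.prod_cons, List.prod_nil, mul_one, mul_smul_comm, smul_mul_assoc, smul_smul,
        mul_assoc, pow_succ', e', e]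
  exact key (n - 1) le_rfl

/-- One has θ_n = T_{n-1}⁻¹⋯T_1⁻¹ π_n and Y = T_{n-1}⁻¹⋯T_1⁻¹ X_1, so the relation π_n X_n = q X_1
π_n supplies the factor `q`. -/
theorem theta_last_mul_opY (h : ∀ a b, DoubleRel T θ X a b → a = b) (hn : 0 < n) :
    θ ⟨n - 1, by omega⟩ * opY T X hn = q • (opY T X hn * θ ⟨0, hn⟩) := by
  have hT := DoubleRel.toHecke h
  have hA := DoubleRel.toAffine h
  have ht : t ^ (n - 1) ≠ 0 := pow_ne_zero _ t_ne_zero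
  have h1 := succ_family θ (fun i => hA _ _ (.theta_succ i)) hn
  have h2 := succ_family X (fun i => h _ _ (.X_succ i)) hn
  rw [mul_assoc, ← mul_smul_comm, ← piElt_eq hn] at h1
  have hY : opY T X hn = descProd (fun i => hInv (T i)) (n - 1) * X ⟨0, hn⟩ := by
    rw [opY, h2, smul_mul_assoc, smul_smul, inv_mul_cancel₀ ht, one_smul, mul_assoc,
      descInv_mul hT, mul_one]
  have hp := h _ _ (.pi_X_last ⟨n - 1, by omega⟩ ⟨0, hn⟩ (by simp only; omega) rfl)
  rw [h1]
  conv_lhs => rw [opY]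
  rw [mul_smul_comm, mul_assoc, ← mul_assoc (piElt T θ), hp, smul_mul_assoc, mul_assoc (X _),
    piElt_mul_descProd hT hn, mul_smul_comm, mul_smul_comm, mul_smul_comm, smul_comm, smul_smul,
    smul_smul, hY]
  simp only [mul_assoc]
  congr 1
  field_simp

/-! ### Monomials in the `X_i` -/

variable (X) in
/-- The product of the `X_i` over the `i ∈ s`. -/
def xMon (s : Finset (Fin n)) : R := ((s.sort (· ≤ ·)).map X).prod

theorem xMon_insert (hX : ∀ i j, X i * X j = X j * X i) {a : Fin n} {s : Finset (Fin n)}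
    (ha : a ∉ s) : xMon X (insert a s) = X a * xMon X s := by
  have hp : ((insert a s).sort (· ≤ ·)).Perm (a :: s.sort (· ≤ ·)) := by
    rw [← Multiset.coe_eq_coe, Finset.sort_eq, ← Multiset.cons_coe, Finset.sort_eq,
      Finset.insert_val_of_notMem ha]
  rw [xMon, xMon, ← List.prod_cons, ← List.map_cons]
  exact (hp.map X).prod_eq' (List.pairwise_map.2 (List.pairwise_of_forall fun i j => hX i j))

theorem commute_xMon {x : R} {s : Finset (Fin n)} (h : ∀ j ∈ s, Commute x (X j)) :
    Commute x (xMon X s) := by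
  rw [xMon]
  apply Commute.list_prod_right
  intro y hy
  obtain ⟨j, hj, rfl⟩ := List.mem_map.1 hy
  exact h j ((Finset.mem_sort _).1 hj)

theorem lo_ne_hi (i : Fin (n - 1)) : lo i ≠ hi i := fun h => by
  have := congrArg Fin.val h
  simp [lo, hi] at this

theorem commute_T_xMon_of_notMem (h : ∀ a b, DoubleRel T θ X a b → a = b) {i : Fin (n - 1)}
    {s : Finset (Fin n)} (h1 : lo i ∉ s) (h2 : hi i ∉ s) : Commute (T i) (xMon X s) :=
  commute_xMon fun j hj => h _ _ (.T_X i j (fun e => h1 (e ▸ hj)) (fun e => h2 (e ▸ hj)))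

theorem commute_T_xMon_of_mem (h : ∀ a b, DoubleRel T θ X a b → a = b) {i : Fin (n - 1)}
    {s : Finset (Fin n)} (h1 : lo i ∈ s) (h2 : hi i ∈ s) : Commute (T i) (xMon X s) := by
  have hX : ∀ i j, X i * X j = X j * X i := fun i j => h _ _ (.X_comm i j)
  obtain ⟨s', rfl, hl, hh⟩ : ∃ s', s = insert (hi i) (insert (lo i) s') ∧ lo i ∉ s' ∧ hi i ∉ s' := by
    refine ⟨(s.erase (hi i)).erase (lo i), ?_, by simp, by simp⟩
    rw [Finset.insert_erase (Finset.mem_erase.2 ⟨lo_ne_hi i, h1⟩), Finset.insert_erase h2]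
  rw [xMon_insert hX (by simp [(lo_ne_hi i).symm, hh]), xMon_insert hX hl, ← mul_assoc]
  exact (commute_T_X_mul_X h i).mul_right (commute_T_xMon_of_notMem h hl hh)

theorem T_mul_xMon_hi (h : ∀ a b, DoubleRel T θ X a b → a = b) {i : Fin (n - 1)}
    {s : Finset (Fin n)} (h1 : lo i ∉ s) (h2 : hi i ∉ s) :
    T i * xMon X (insert (hi i) s) = t • (xMon X (insert (lo i) s) * hInv (T i)) := by
  have hX : ∀ i j, X i * X j = X j * X i := fun i j => h _ _ (.X_comm i j)
  have hc := (commute_hInv (commute_T_xMon_of_notMem h h1 h2).symm).symm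
  rw [xMon_insert hX h1, xMon_insert hX h2, ← mul_assoc, T_mul_X_hi h, smul_mul_assoc, mul_assoc,
    hc.eq, mul_assoc]

theorem T_mul_xMon_lo (h : ∀ a b, DoubleRel T θ X a b → a = b) {i : Fin (n - 1)}
    {s : Finset (Fin n)} (h1 : lo i ∉ s) (h2 : hi i ∉ s) :
    T i * xMon X (insert (lo i) s) =
      xMon X (insert (hi i) s) * T i - (t - 1) • xMon X (insert (lo i) s) := by
  have hX : ∀ i j, X i * X j = X j * X i := fun i j => h _ _ (.X_comm i j)
  have hc := (commute_T_xMon_of_notMem h h1 h2)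
  have e := X_hi_mul_T h i
  rw [← smul_mul_assoc] at e
  change _ = opA T i * _ at e
  rw [opA_eq, add_mul, smul_mul_assoc, one_mul] at e
  rw [xMon_insert hX h1, xMon_insert hX h2, mul_assoc, ← hc.eq, ← mul_assoc, ← mul_assoc, e]
  simp only [add_mul, smul_mul_assoc]
  abel

/-- The elementary symmetric polynomials in the `X_i` commute with the `T_i`. -/
theorem commute_T_elem (h : ∀ a b, DoubleRel T θ X a b → a = b) (i : Fin (n - 1)) (r : ℕ) :
    Commute (T i) (∑ s ∈ (Finset.univ : Finset (Fin n)).powersetCard r, xMon X s) := by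
  let sw : Equiv.Perm (Fin n) := Equiv.swap (lo i) (hi i)
  -- The failure of `T i` to permute the monomials is a difference of values of `g` at the swapped
  -- set and at `s`. It cancels in the sum, because the swap permutes the sets with `r` elements.
  let g : Finset (Fin n) → R := fun s =>
    if lo i ∈ s ∧ hi i ∉ s then (t - 1) • xMon X s else 0
  have hsw : ∀ s : Finset (Fin n), lo i ∈ s.map sw.toEmbedding ↔ hi i ∈ s := by
    intro s
    simp [Finset.mem_map_equiv, sw]
  have hsw' : ∀ s : Finset (Fin n), hi i ∈ s.map sw.toEmbedding ↔ lo i ∈ s := by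
    intro s
    simp [Finset.mem_map_equiv, sw]
  have hmem : ∀ (s : Finset (Fin n)) (x : Fin n), x ≠ lo i → x ≠ hi i →
      (x ∈ s.map sw.toEmbedding ↔ x ∈ s) := by
    intro s x h1 h2
    simp [Finset.mem_map_equiv, sw, Equiv.swap_apply_of_ne_of_ne h1 h2]
  have hfix : ∀ s : Finset (Fin n), (lo i ∈ s ↔ hi i ∈ s) → s.map sw.toEmbedding = s := by
    intro s hs
    ext x
    by_cases h1 : x = lo i
    · rw [h1, hsw, hs]
    by_cases h2 : x = hi i
    · rw [h2, hsw', hs]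
    exact hmem s x h1 h2
  have key : ∀ s : Finset (Fin n), T i * xMon X s =
      xMon X (s.map sw.toEmbedding) * T i + g (s.map sw.toEmbedding) - g s := by
    intro s
    by_cases h1 : lo i ∈ s <;> by_cases h2 : hi i ∈ s
    · rw [hfix s (by tauto), (commute_T_xMon_of_mem h h1 h2).eq]; abel
    · have e : s = insert (lo i) (s.erase (lo i)) := (Finset.insert_erase h1).symm
      have e' : s.map sw.toEmbedding = insert (hi i) (s.erase (lo i)) := by
        ext x
        by_cases hx1 : x = lo i
        · rw [hx1, hsw]; simp [h2, lo_ne_hi i]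
        by_cases hx2 : x = hi i
        · rw [hx2, hsw']; simp [h1]
        rw [hmem s x hx1 hx2]; simp [hx1, hx2]
      have g1 : g s = (t - 1) • xMon X s := if_pos ⟨h1, h2⟩
      have g2 : g (s.map sw.toEmbedding) = 0 := if_neg (by rw [hsw, hsw']; tauto)
      rw [g1, g2, add_zero, e']
      conv_lhs => rw [e]
      conv_rhs => rw [e]
      rw [T_mul_xMon_lo h (by simp) (by simp [h2])]
      simp
    · have e : s = insert (hi i) (s.erase (hi i)) := (Finset.insert_erase h2).symm
      have e' : s.map sw.toEmbedding = insert (lo i) (s.erase (hi i)) := by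
        ext x
        by_cases hx1 : x = lo i
        · rw [hx1, hsw]; simp [h2]
        by_cases hx2 : x = hi i
        · rw [hx2, hsw']; simp [h1, (lo_ne_hi i).symm]
        rw [hmem s x hx1 hx2]; simp [hx1, hx2]
      have g1 : g s = 0 := if_neg (by tauto)
      have g2 : g (s.map sw.toEmbedding) = (t - 1) • xMon X (s.map sw.toEmbedding) :=
        if_pos (by rw [hsw, hsw']; tauto)
      rw [g1, g2, e']
      conv_lhs => rw [e]
      rw [T_mul_xMon_hi h (by simp [h1]) (by simp), ← mul_smul_comm]
      change _ * opA T i = _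
      rw [opA_eq, mul_add, mul_smul_comm, mul_one, sub_zero]
    · rw [hfix s (by tauto), (commute_T_xMon_of_notMem h h1 h2).eq]; abel
  have hsum : ∀ f : Finset (Fin n) → R,
      ∑ s ∈ (Finset.univ : Finset (Fin n)).powersetCard r, f (s.map sw.toEmbedding) =
      ∑ s ∈ (Finset.univ : Finset (Fin n)).powersetCard r, f s := by
    intro f
    refine Finset.sum_nbij' (fun s => s.map sw.toEmbedding) (fun s => s.map sw.toEmbedding)
      ?_ ?_ ?_ ?_ ?_
    · intro s hs; simpa [Finset.mem_powersetCard] using hs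
    · intro s hs; simpa [Finset.mem_powersetCard] using hs
    · intro s _; ext x; simp [Finset.mem_map_equiv, sw]
    · intro s _; ext x; simp [Finset.mem_map_equiv, sw]
    · intro s _; rfl
  change T i * _ = _ * T i
  rw [Finset.mul_sum, Finset.sum_congr rfl fun s _ => key s, Finset.sum_sub_distrib,
    Finset.sum_add_distrib, hsum g, hsum (fun s => xMon X s * T i), ← Finset.sum_mul]
  abel

/-! ### Action of monomials on invariant vectors -/

variable {M : Type*} [AddCommGroup M] [Module K M] [Module R M] [IsScalarTower K R M]

theorem hInv_smul_of_invariant {x : R} {p : M} (h : x • p = p) : hInv x • p = p := by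
  rw [hInv, smul_assoc, add_smul, h, smul_assoc, one_smul]
  rw [show p + (t - 1) • p = t • p by rw [sub_smul, one_smul]; abel, smul_smul,
    inv_mul_cancel₀ t_ne_zero, one_smul]

/-- The top subset with `r` elements. -/
def topSet (n r : ℕ) : Finset (Fin n) := Finset.univ.filter fun x => n - r ≤ x.1

/-- Since T_i X_{i+1} = t X_i T_i⁻¹ and T_i⁻¹ fixes `p`, the product T_{n-1}⋯T_1 lowers every index
of the current top monomial by one, with a factor `t` each time. The factor X_n of Y then completes
the next top monomial. -/
theorem opY_pow_smul (h : ∀ a b, DoubleRel T θ X a b → a = b) (hn : 0 < n) {p : M}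
    (hp : ∀ i, T i • p = p) {r : ℕ} (hr : r ≤ n) :
    opY T X hn ^ r • p = (t ^ ∑ x ∈ topSet n r, x.1)⁻¹ • (xMon X (topSet n r) • p) := by
  have hX : ∀ i j, X i * X j = X j * X i := fun i j => h _ _ (.X_comm i j)
  induction r with
  | zero =>
    have : topSet n 0 = ∅ := by
      ext x; simp [topSet]
    simp [this, xMon]
  | succ r ih =>
    rw [pow_succ', mul_smul, ih (by omega), opY]
    -- `S m` is the index set after the first `m` generators have acted: the indices already met are
    -- lowered by one, the others are still in place.
    let S : ℕ → Finset (Fin n) := fun m => Finset.univ.filter fun x =>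
      (x.1 < m ∧ n - r - 1 ≤ x.1) ∨ (m < x.1 ∧ n - r ≤ x.1)
    have hS0 : topSet n r = S 0 := by
      ext x
      simp only [topSet, S, Finset.mem_filter, Finset.mem_univ, true_and]
      omega
    -- The truncated subtraction is intended: no factor `t` appears before the smallest index of the
    -- monomial is met.
    have key : ∀ m, m ≤ n - 1 → descProd T m • (xMon X (S 0) • p) =
        t ^ (m - (n - r - 1)) • (xMon X (S m) • p) := by
      intro m hm
      induction m with
      | zero => simp [descProd]
      | succ m ihm =>
        rw [descProd_succ (by omega), mul_smul, ihm (by omega), smul_comm, ← mul_smul (T _)]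
        have hlo : lo (⟨m, by omega⟩ : Fin (n - 1)) ∉ S m := by simp [S, lo]
        by_cases hc : n - r ≤ m + 1
        · have hhi : hi (⟨m, by omega⟩ : Fin (n - 1)) ∈ S m := by
            simp only [S, hi, Finset.mem_filter, Finset.mem_univ, true_and]; omega
          have e : S m = insert (hi ⟨m, by omega⟩) ((S m).erase (hi ⟨m, by omega⟩)) :=
            (Finset.insert_erase hhi).symm
          have e' : S (m + 1) = insert (lo ⟨m, by omega⟩) ((S m).erase (hi ⟨m, by omega⟩)) := by
            ext x
            simp only [S, lo, hi, Finset.mem_filter, Finset.mem_univ, true_and, Finset.mem_insert,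
              Finset.mem_erase, Fin.ext_iff, ne_eq]
            omega
          rw [e, T_mul_xMon_hi h (by simp [hlo]) (by simp), ← e', smul_assoc, mul_smul,
            hInv_smul_of_invariant (hp _), smul_smul, ← pow_succ,
            show m - (n - r - 1) + 1 = m + 1 - (n - r - 1) by omega]
        · have hhi : hi (⟨m, by omega⟩ : Fin (n - 1)) ∉ S m := by
            simp only [S, hi, Finset.mem_filter, Finset.mem_univ, true_and]; omega
          have e' : S (m + 1) = S m := by
            ext x
            simp only [S, Finset.mem_filter, Finset.mem_univ, true_and]
            omega
          rw [(commute_T_xMon_of_notMem h hlo hhi).eq, mul_smul, hp, e',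
            show m - (n - r - 1) = m + 1 - (n - r - 1) by omega]
    have hins : topSet n (r + 1) = insert ⟨n - 1, by omega⟩ (S (n - 1)) := by
      ext x
      have := x.2
      simp only [topSet, S, Finset.mem_filter, Finset.mem_univ, true_and, Finset.mem_insert,
        Fin.ext_iff]
      omega
    have hnot : (⟨n - 1, by omega⟩ : Fin n) ∉ S (n - 1) := by simp [S]
    have hsum : (n - 1) + ∑ x ∈ topSet n r, x.1 = ∑ x ∈ topSet n (r + 1), x.1 + r := by
      have e : topSet n (r + 1) = insert ⟨n - r - 1, by omega⟩ (topSet n r) := by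
        ext x
        simp only [topSet, Finset.mem_filter, Finset.mem_univ, true_and, Finset.mem_insert,
          Fin.ext_iff]
        omega
      rw [e, Finset.sum_insert (by simp [topSet]; omega)]
      simp only
      omega
    rw [smul_assoc, mul_smul, smul_comm (descProd T _), smul_comm (X _), hS0, key _ le_rfl,
      smul_comm (X _), ← mul_smul (X _), ← xMon_insert hX hnot, ← hins, ← hS0, smul_smul, smul_smul]
    congr 1
    have ht := t_ne_zero
    have h3 : t ^ (n - 1) * t ^ (∑ x ∈ topSet n r, x.1) = t ^ (∑ x ∈ topSet n (r + 1), x.1) * t ^ r := by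
      rw [← pow_add, ← pow_add, hsum]
    rw [show n - 1 - (n - r - 1) = r by omega, ← mul_inv, h3, mul_inv, mul_assoc,
      inv_mul_cancel₀ (pow_ne_zero _ ht), mul_one]

/-- On invariant vectors an elementary symmetric polynomial in the `X_i` is the symmetrization
of a power of `Y`. -/
theorem elem_smul_eq (h : ∀ a b, DoubleRel T θ X a b → a = b) (hn : 0 < n) {e : R}
    (heT : ∀ i, e * T i = e) (he : ∀ p : M, (∀ i, T i • p = p) → e • p = p) {p : M}
    (hp : ∀ i, T i • p = p) {r : ℕ} (hr : r ≤ n) :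
    (∑ s ∈ (Finset.univ : Finset (Fin n)).powersetCard r, xMon X s) • p =
      elemT n r • (e • (opY T X hn ^ r • p)) := by
  have ht := t_ne_zero
  have inv : ∀ i, T i • ((∑ s ∈ (Finset.univ : Finset (Fin n)).powersetCard r, xMon X s) • p) =
      (∑ s ∈ (Finset.univ : Finset (Fin n)).powersetCard r, xMon X s) • p := fun i => by
    rw [← mul_smul, (commute_T_elem h i r).eq, mul_smul, hp]
  -- Replacing `lo i` by `hi i` in `s` costs one factor `t`, because `e * T i = e`. The sum of the
  -- `n - x` drops with each such move, which is the measure of the induction.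
  have key : ∀ k (s : Finset (Fin n)), s.card = r → ∑ x ∈ s, (n - x.1) = k →
      e • (xMon X s • p) =
        (t ^ (∑ x ∈ s, x.1) * (t ^ (∑ x ∈ topSet n r, x.1))⁻¹) • (e • (xMon X (topSet n r) • p)) := by
    intro k
    induction k using Nat.strong_induction_on with
    | _ k ih =>
      intro s hs hk
      by_cases hex : ∃ i : Fin (n - 1), lo i ∈ s ∧ hi i ∉ s
      · obtain ⟨i, h1, h2⟩ := hex
        have e1 : s = insert (lo i) (s.erase (lo i)) := (Finset.insert_erase h1).symm
        have hn1 : lo i ∉ s.erase (lo i) := by simp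
        have hn2 : hi i ∉ s.erase (lo i) := by simp [h2]
        have hcard : (insert (hi i) (s.erase (lo i))).card = r := by
          rw [Finset.card_insert_of_notMem hn2, Finset.card_erase_add_one h1, hs]
        have hs1 : ∑ x ∈ s, (n - x.1) = (n - i.1) + ∑ x ∈ s.erase (lo i), (n - x.1) := by
          conv_lhs => rw [e1]
          rw [Finset.sum_insert hn1]; rfl
        have hs2 : ∑ x ∈ s, x.1 = i.1 + ∑ x ∈ s.erase (lo i), x.1 := by
          conv_lhs => rw [e1]
          rw [Finset.sum_insert hn1]; rfl
        have hi' := i.2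
        have := ih (∑ x ∈ insert (hi i) (s.erase (lo i)), (n - x.1)) (by
          rw [Finset.sum_insert hn2]; simp only [hi]; omega) _ hcard rfl
        have hT := T_mul_xMon_hi h hn1 hn2
        rw [← e1] at hT
        have h3 : e • (xMon X (insert (hi i) (s.erase (lo i))) • p) = t • (e • (xMon X s • p)) := by
          rw [← heT i, mul_smul, ← mul_smul (T i), hT, smul_assoc, mul_smul,
            hInv_smul_of_invariant (hp i), smul_comm, heT]
        rw [h3, Finset.sum_insert hn2] at this
        have e4 : (hi i).1 + ∑ x ∈ s.erase (lo i), x.1 = ∑ x ∈ s, x.1 + 1 := by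
          rw [hs2]; simp only [hi]; omega
        rw [e4, pow_succ', mul_assoc, mul_smul] at this
        exact smul_right_injective M ht this
      · push Not at hex
        -- When no index can be raised, `s` is closed under successors, hence a final segment.
        have hs' : s = topSet n r := by
          have hup : ∀ k (x : Fin n), x ∈ s → ∀ hk : x.1 + k < n, (⟨x.1 + k, hk⟩ : Fin n) ∈ s := by
            intro k x hx
            induction k with
            | zero => intro _; simpa using hx
            | succ k ihk =>
              intro hk
              exact hex ⟨x.1 + k, by omega⟩ (ihk (by omega))
          apply Finset.eq_of_subset_of_card_le
          · intro x hx
            simp only [topSet, Finset.mem_filter, Finset.mem_univ, true_and]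
            have hsub : Finset.univ.filter (fun y : Fin n => x.1 ≤ y.1) ⊆ s := by
              intro y hy
              simp only [Finset.mem_filter, Finset.mem_univ, true_and] at hy
              have := hup (y.1 - x.1) x hx (by omega)
              have e : (⟨x.1 + (y.1 - x.1), by omega⟩ : Fin n) = y := Fin.ext (by simp only; omega)
              rwa [e] at this
            have hc := Finset.card_le_card hsub
            have : (Finset.univ.filter (fun y : Fin n => x.1 ≤ y.1)).card = n - x.1 := by
              have : Finset.univ.filter (fun y : Fin n => x.1 ≤ y.1) = Finset.Ici x := by
                ext y; simp only [Finset.mem_filter, Finset.mem_univ, true_and, Finset.mem_Ici, Fin.le_def]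
              rw [this, Fin.card_Ici]
            omega
          · rw [hs]
            have : (topSet n r).card = r := by
              rcases Nat.eq_zero_or_pos r with h0 | h0
              · subst h0
                rw [Finset.card_eq_zero]
                ext x; simp [topSet]
              · have : topSet n r = Finset.Ici (⟨n - r, by omega⟩ : Fin n) := by
                  ext y; simp [topSet, Fin.le_def]
                rw [this, Fin.card_Ici]
                simp only
                omega
            omega
        rw [hs', mul_inv_cancel₀ (pow_ne_zero _ ht), one_smul]
  -- The vector on the left is again invariant, so `e` may be put in front of it. Then every
  -- monomial becomes a multiple of the top one, and the multiples add up to `elemT n r`.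
  rw [← he _ inv, Finset.sum_smul, Finset.smul_sum, opY_pow_smul h hn hp hr,
    Finset.sum_congr rfl fun s hs => key _ s (Finset.mem_powersetCard.1 hs).2 rfl,
    ← Finset.sum_smul, smul_comm e (_ : K), elemT, smul_smul (∑ s ∈ _, _) (t ^ _)⁻¹, Finset.sum_mul]
  congr 1
  refine Finset.sum_congr rfl fun s _ => ?_
  rw [Finset.prod_pow_eq_pow_sum]

end DoubleRelations

end

end VVMacdonald

/-! ### Recursive families, lengths of permutations, and the symmetrizer. -/

namespace VVMacdonald

noncomputable section

open Classical TensorProduct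

/-! ### Families defined by recursion along a rank function -/

/-- A family can be built by recursion on a rank if all the values prescribed for an element
agree, provided that the family is as prescribed on the elements of smaller rank. -/
theorem exists_family {P V : Type*} [Nonempty V] (rk : P → ℕ) (E : P → ((P → V) → V) → Prop)
    (hloc : ∀ x f, E x f → ∀ F G : P → V, (∀ y, rk y < rk x → F y = G y) → f F = f G)
    (hpair : ∀ x (F : P → V), (∀ y f, rk y < rk x → E y f → F y = f F) →
      ∀ f g, E x f → E x g → f F = g F) :
    ∃ F : P → V, ∀ x f, E x f → F x = f F := by
  let d : V := Classical.arbitrary V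
  -- The recursion follows one arbitrarily chosen prescription at each element and puts a default
  -- value at elements of larger or equal rank; `hloc` makes that default irrelevant.
  let F : P → V := (measure rk).wf.fix fun x rec =>
    if h : ∃ f, E x f then (Classical.choose h) (fun y => if hy : rk y < rk x then rec y hy else d)
    else d
  have hF : ∀ x, ∀ h : ∃ f, E x f, F x = (Classical.choose h) F := by
    intro x h
    have e : F x = if h : ∃ f, E x f then
        (Classical.choose h) (fun y => if rk y < rk x then F y else d) else d :=
      (measure rk).wf.fix_eq _ x
    rw [e, dif_pos h]
    refine hloc x _ (Classical.choose_spec h) _ _ fun y hy => ?_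
    rw [if_pos hy]
  refine ⟨F, ?_⟩
  have key : ∀ m x, rk x = m → ∀ f, E x f → F x = f F := by
    intro m
    induction m using Nat.strong_induction_on with
    | _ m ih =>
      rintro x rfl f hf
      rw [hF x ⟨f, hf⟩]
      exact hpair x F (fun y g hy hg => ih _ hy y rfl g hg) _ _ (Classical.choose_spec ⟨f, hf⟩) hf
  exact fun x f hf => key _ x rfl f hf

/-! ### Simple transpositions and inversions -/

/-- The simple transposition that belongs to `i`. -/
abbrev simpleSwap {n : ℕ} (i : Fin (n - 1)) : Equiv.Perm (Fin n) := Equiv.swap (lo i) (hi i)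

section Swaps

set_option linter.unusedSectionVars false

variable {n : ℕ}

theorem simpleSwap_of_ne {i : Fin (n - 1)} {x : Fin n} (h1 : x.1 ≠ i.1) (h2 : x.1 ≠ i.1 + 1) :
    simpleSwap i x = x :=
  Equiv.swap_apply_of_ne_of_ne (fun h => h1 (congrArg Fin.val h)) fun h => h2 (congrArg Fin.val h)

theorem val_simpleSwap (i : Fin (n - 1)) (x : Fin n) :
    (simpleSwap i x).1 = if x.1 = i.1 then i.1 + 1 else if x.1 = i.1 + 1 then i.1 else x.1 := by
  rw [simpleSwap, Equiv.swap_apply_def]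
  simp only [Fin.ext_iff, lo, hi]
  split_ifs <;> rfl

theorem simpleSwap_lt_iff (i : Fin (n - 1)) {x y : Fin n} (h : ¬(x = lo i ∧ y = hi i))
    (h' : ¬(x = hi i ∧ y = lo i)) : simpleSwap i x < simpleSwap i y ↔ x < y := by
  simp only [Fin.ext_iff, lo, hi] at h h'
  rw [Fin.lt_def, Fin.lt_def, val_simpleSwap, val_simpleSwap]
  split_ifs <;> omega

theorem simpleSwap_comm {i j : Fin (n - 1)} (h : i.1 + 1 < j.1) :
    simpleSwap i * simpleSwap j = simpleSwap j * simpleSwap i := by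
  ext x
  simp only [Equiv.Perm.mul_apply, val_simpleSwap]
  split_ifs <;> omega

theorem simpleSwap_braid {i j : Fin (n - 1)} (h : i.1 + 1 = j.1) :
    simpleSwap i * simpleSwap j * simpleSwap i = simpleSwap j * simpleSwap i * simpleSwap j := by
  have e : hi i = lo j := Fin.ext h
  have h1 : lo i ≠ lo j := fun h' => by have := congrArg Fin.val h'; simp only [lo] at this; omega
  have h2 : lo i ≠ hi j := fun h' => by
    have := congrArg Fin.val h'; simp only [lo, hi] at this; omega
  rw [simpleSwap, simpleSwap, e, Equiv.swap_mul_swap_mul_swap h1 h2, Equiv.swap_comm (lo i),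
    Equiv.swap_comm (lo j) (hi j), Equiv.swap_mul_swap_mul_swap (lo_ne_hi j).symm h2.symm,
    Equiv.swap_comm]

variable {B : Type*} [Fintype B]

/-- The inversions of a labelling `L` with respect to a relation `R`. -/
def invs (R : B → B → Prop) (L : B ≃ Fin n) : Finset (B × B) :=
  Finset.univ.filter fun p => R p.1 p.2 ∧ L p.2 < L p.1

theorem mem_invs {R : B → B → Prop} {L : B ≃ Fin n} {p : B × B} :
    p ∈ invs R L ↔ R p.1 p.2 ∧ L p.2 < L p.1 := by simp [invs]

/-- A simple transposition keeps the relative order of all pairs of labels except `lo i`, `hi i`, so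
the set of inversions changes by exactly one pair. -/
theorem invs_swap {R : B → B → Prop} (hR : ∀ a b, R a b → ¬R b a) {L : B ≃ Fin n}
    {i : Fin (n - 1)} (h : R (L.symm (hi i)) (L.symm (lo i))) :
    (L.symm (hi i), L.symm (lo i)) ∉ invs R (L.trans (simpleSwap i)) ∧
      invs R L = insert (L.symm (hi i), L.symm (lo i)) (invs R (L.trans (simpleSwap i))) := by
  have hlt : lo i < hi i := Fin.lt_def.2 (by simp [lo, hi])
  constructor
  · rw [mem_invs]
    simp only [Equiv.trans_apply, Equiv.apply_symm_apply, Equiv.swap_apply_left,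
      Equiv.swap_apply_right]
    rintro ⟨_, h2⟩
    exact lt_asymm hlt h2
  · ext ⟨a, b⟩
    rw [Finset.mem_insert, mem_invs, mem_invs]
    simp only [Equiv.trans_apply, Prod.mk.injEq]
    by_cases h1 : L a = hi i ∧ L b = lo i
    · obtain ⟨h1, h2⟩ := h1
      obtain rfl := (Equiv.symm_apply_eq L).2 h1.symm
      obtain rfl := (Equiv.symm_apply_eq L).2 h2.symm
      simp only [Equiv.apply_symm_apply, and_self, true_or, iff_true]
      exact ⟨h, hlt⟩
    · have h1' : ¬(a = L.symm (hi i) ∧ b = L.symm (lo i)) := by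
        rintro ⟨rfl, rfl⟩
        simp at h1
      by_cases h2 : L a = lo i ∧ L b = hi i
      · obtain ⟨h2, h3⟩ := h2
        obtain rfl := (Equiv.symm_apply_eq L).2 h2.symm
        obtain rfl := (Equiv.symm_apply_eq L).2 h3.symm
        have := hR _ _ h
        simp only [this, false_and, or_false, false_iff]
        exact h1'
      · rw [simpleSwap_lt_iff i (by tauto) (by tauto)]
        tauto

theorem card_invs_swap {R : B → B → Prop} (hR : ∀ a b, R a b → ¬R b a) {L : B ≃ Fin n}
    {i : Fin (n - 1)} (h : R (L.symm (hi i)) (L.symm (lo i))) :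
    (invs R L).card = (invs R (L.trans (simpleSwap i))).card + 1 := by
  obtain ⟨h1, h2⟩ := invs_swap hR h
  rw [h2, Finset.card_insert_of_notMem h1]

/-- Without a descent, `R` holds between boxes with consecutive labels, hence by transitivity along
all labels, and no inversion is left. -/
theorem exists_descent {R : B → B → Prop} (hR : ∀ a b, R a b → ¬R b a)
    (htr : ∀ a b c, R a b → R b c → R a c) (htot : ∀ a b, a ≠ b → R a b ∨ R b a)
    {L : B ≃ Fin n} (h : (invs R L).Nonempty) :
    ∃ i : Fin (n - 1), R (L.symm (hi i)) (L.symm (lo i)) := by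
  by_contra hcon
  push Not at hcon
  have h1 : ∀ i : Fin (n - 1), R (L.symm (lo i)) (L.symm (hi i)) := fun i =>
    (htot _ _ fun e => lo_ne_hi i (L.symm.injective e)).resolve_right (hcon i)
  have h2 : ∀ (k : ℕ) (x : Fin n) (hk : x.1 + k + 1 < n),
      R (L.symm x) (L.symm ⟨x.1 + k + 1, hk⟩) := by
    intro k x
    induction k with
    | zero => intro hk; exact h1 ⟨x.1, by omega⟩
    | succ k ih =>
      intro hk
      exact htr _ _ _ (ih (by omega)) (h1 ⟨x.1 + k + 1, by omega⟩)
  obtain ⟨⟨a, b⟩, hab⟩ := h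
  rw [mem_invs] at hab
  have hlt := Fin.lt_def.1 hab.2
  have := h2 ((L a).1 - (L b).1 - 1) (L b) (by simp only at hlt; omega)
  have e : (⟨(L b).1 + ((L a).1 - (L b).1 - 1) + 1, by simp only at hlt; omega⟩ : Fin n) = L a :=
    Fin.ext (by simp only at hlt ⊢; omega)
  rw [e, Equiv.symm_apply_apply, Equiv.symm_apply_apply] at this
  exact hR _ _ hab.1 this

theorem equiv_eq_of_lt_imp {L L' : B ≃ Fin n} (h : ∀ a b, L a < L b → L' a < L' b) : L = L' := by
  have hm : StrictMono (L.symm.trans L') := fun x y hxy => h _ _ (by simpa using hxy)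
  have := hm.range_inj (strictMono_id (α := Fin n)) |>.1
    (by rw [Set.range_id, Equiv.range_eq_univ])
  ext b
  have := congrFun this (L b)
  simp at this
  rw [this]

theorem eq_of_invs_eq_empty {R : B → B → Prop} (htot : ∀ a b, a ≠ b → R a b ∨ R b a)
    {L L' : B ≃ Fin n} (h : invs R L = ∅) (h' : invs R L' = ∅) : L = L' := by
  apply equiv_eq_of_lt_imp
  intro a b hab
  have hne : a ≠ b := fun e => by subst e; exact lt_irrefl _ hab
  rcases htot a b hne with hR | hR
  · rcases lt_trichotomy (L' a) (L' b) with h1 | h1 | h1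
    · exact h1
    · exact absurd (L'.injective h1) hne
    · have : (a, b) ∈ invs R L' := mem_invs.2 ⟨hR, h1⟩
      rw [h'] at this
      simp at this
  · have : (b, a) ∈ invs R L := mem_invs.2 ⟨hR, hab⟩
    rw [h] at this
    simp at this

end Swaps

/-! ### The elements `T_σ` -/

section Length

set_option linter.unusedSectionVars false

variable {n : ℕ}

/-- The number of inversions of a permutation. -/
def len (σ : Equiv.Perm (Fin n)) : ℕ := (invs (· < ·) σ).card

theorem len_swap_mul {σ : Equiv.Perm (Fin n)} {i : Fin (n - 1)}
    (h : σ.symm (hi i) < σ.symm (lo i)) : len σ = len (simpleSwap i * σ) + 1 :=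
  card_invs_swap (R := (· < ·)) (fun _ _ => lt_asymm) h

theorem len_swap_mul' {σ : Equiv.Perm (Fin n)} {i : Fin (n - 1)}
    (h : σ.symm (lo i) < σ.symm (hi i)) : len (simpleSwap i * σ) = len σ + 1 := by
  have h' : (simpleSwap i * σ).symm (hi i) < (simpleSwap i * σ).symm (lo i) := by
    change σ.symm ((simpleSwap i).symm (hi i)) < σ.symm ((simpleSwap i).symm (lo i))
    simpa using h
  rw [len_swap_mul h', ← mul_assoc]
  simp

theorem symm_swap_mul (σ : Equiv.Perm (Fin n)) (i : Fin (n - 1)) (x : Fin n) :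
    (simpleSwap i * σ).symm x = σ.symm (simpleSwap i x) := by
  change σ.symm ((simpleSwap i).symm x) = _
  rw [Equiv.symm_swap]

theorem symm_lo_ne_hi (σ : Equiv.Perm (Fin n)) (i : Fin (n - 1)) :
    σ.symm (lo i) < σ.symm (hi i) ∨ σ.symm (hi i) < σ.symm (lo i) :=
  lt_or_gt_of_ne fun e => lo_ne_hi i (σ.symm.injective e)

theorem len_inv (σ : Equiv.Perm (Fin n)) : len σ⁻¹ = len σ := by
  have key : ∀ τ : Equiv.Perm (Fin n), len τ⁻¹ ≤ len τ := by
    intro τ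
    refine Finset.card_le_card_of_injOn (fun p => (τ⁻¹ p.2, τ⁻¹ p.1)) ?_ ?_
    · intro p hp
      have hp' := mem_invs.1 (Finset.mem_coe.1 hp)
      rw [Finset.mem_coe, mem_invs]
      simp only [← Equiv.Perm.mul_apply, mul_inv_cancel, Equiv.Perm.one_apply]
      exact ⟨hp'.2, hp'.1⟩
    · intro p _ p' _ h
      simp only [Prod.mk.injEq, EmbeddingLike.apply_eq_iff_eq] at h
      exact Prod.ext h.2 h.1
  exact le_antisymm (key σ) (by simpa using key σ⁻¹)

theorem len_one : len (1 : Equiv.Perm (Fin n)) = 0 := by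
  rw [len, Finset.card_eq_zero]
  ext p
  rw [mem_invs]
  simp only [Equiv.Perm.coe_one, id_eq, Finset.notMem_empty, iff_false, not_and, not_lt]
  exact le_of_lt

theorem eq_one_of_len {σ : Equiv.Perm (Fin n)} (h : len σ = 0) : σ = 1 :=
  eq_of_invs_eq_empty (R := (· < ·)) (fun _ _ h => lt_or_gt_of_ne h) (Finset.card_eq_zero.1 h)
    (Finset.card_eq_zero.1 len_one)

theorem exists_descent_of_ne_one {σ : Equiv.Perm (Fin n)} (h : σ ≠ 1) :
    ∃ i : Fin (n - 1), σ.symm (hi i) < σ.symm (lo i) :=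
  exists_descent (R := (· < ·)) (fun _ _ => lt_asymm) (fun _ _ _ => lt_trans)
    (fun _ _ h => lt_or_gt_of_ne h)
    (Finset.nonempty_iff_ne_empty.2 fun e => h (eq_one_of_len (Finset.card_eq_zero.2 e)))

/-- The permutation given by a word in the simple transpositions. -/
def wordPerm (w : List (Fin (n - 1))) : Equiv.Perm (Fin n) :=
  (w.map fun i => Equiv.swap (lo i) (hi i)).prod

theorem wordPerm_cons (i : Fin (n - 1)) (w : List (Fin (n - 1))) :
    wordPerm (i :: w) = simpleSwap i * wordPerm w := by simp [wordPerm]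

theorem len_wordPerm_le (w : List (Fin (n - 1))) : len (wordPerm w) ≤ w.length := by
  induction w with
  | nil => simp [wordPerm, len_one]
  | cons i w ih =>
    rw [wordPerm_cons, List.length_cons]
    rcases symm_lo_ne_hi (wordPerm w) i with h | h
    · rw [len_swap_mul' h]; omega
    · have := len_swap_mul h; omega

theorem exists_word (σ : Equiv.Perm (Fin n)) : ∃ w, wordPerm w = σ ∧ w.length = len σ := by
  obtain ⟨m, hm⟩ : ∃ m, len σ = m := ⟨_, rfl⟩
  induction m generalizing σ with
  | zero => exact ⟨[], by simp [wordPerm, eq_one_of_len hm], by simp [hm]⟩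
  | succ m ih =>
    obtain ⟨i, hi'⟩ := exists_descent_of_ne_one (σ := σ) (by
      rintro rfl
      rw [len_one] at hm
      omega)
    have h1 := len_swap_mul hi'
    obtain ⟨w, hw, hl⟩ := ih (simpleSwap i * σ) (by omega)
    refine ⟨i :: w, ?_, ?_⟩
    · rw [wordPerm_cons, hw, ← mul_assoc]; simp
    · rw [List.length_cons, hl, h1]

/-- The choice in `reducedWord` is justified, since a word of length `len σ` exists and no word for
`σ` is shorter than its number of inversions. -/
theorem reducedWord_spec (σ : Equiv.Perm (Fin n)) :
    wordPerm (reducedWord σ) = σ ∧ (reducedWord σ).length = len σ := by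
  obtain ⟨w, hw, hl⟩ := exists_word σ
  have hred : IsReducedWord σ w := ⟨hw, fun w' hw' => by
    have := len_wordPerm_le w'
    rw [wordPerm, hw'] at this
    omega⟩
  have hspec : IsReducedWord σ (reducedWord σ) := Classical.epsilon_spec ⟨w, hred⟩
  refine ⟨hspec.1, le_antisymm ?_ ?_⟩
  · rw [← hl]; exact hspec.2 w hw
  · have := len_wordPerm_le (reducedWord σ)
    rwa [show wordPerm (reducedWord σ) = σ from hspec.1] at this

variable {R : Type*} [Ring R] [Algebra K R] {T : Fin (n - 1) → R}

/-- This is the independence of T_σ from the reduced word. By `exists_family` only two descents `i`,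
`j` of the same `σ` have to be compared: for distant indices the commutation relation does it, for
neighbours the braid relation after two further descents on each side. -/
theorem exists_basis_family (hT : ∀ a b, HeckeRel T a b → a = b) :
    ∃ D : Equiv.Perm (Fin n) → R, D 1 = 1 ∧
      ∀ σ i, σ.symm (hi i) < σ.symm (lo i) → D σ = T i * D (simpleSwap i * σ) := by
  let E : Equiv.Perm (Fin n) → ((Equiv.Perm (Fin n) → R) → R) → Prop := fun σ f =>
    (σ = 1 ∧ f = fun _ => 1) ∨
      ∃ i : Fin (n - 1), σ.symm (hi i) < σ.symm (lo i) ∧ f = fun D => T i * D (simpleSwap i * σ)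
  have one_desc : ∀ i : Fin (n - 1),
      ¬(1 : Equiv.Perm (Fin n)).symm (hi i) < (1 : Equiv.Perm (Fin n)).symm (lo i) := by
    intro i h
    have := len_swap_mul h
    rw [len_one] at this
    omega
  suffices hex : ∃ D : Equiv.Perm (Fin n) → R, ∀ σ f, E σ f → D σ = f D by
    obtain ⟨D, hD⟩ := hex
    exact ⟨D, hD 1 _ (Or.inl ⟨rfl, rfl⟩), fun σ i h => hD σ _ (Or.inr ⟨i, h, rfl⟩)⟩
  refine exists_family len E ?_ ?_
  · rintro σ f (⟨rfl, rfl⟩ | ⟨i, h, rfl⟩) F G hFG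
    · rfl
    · simp only
      rw [hFG _ (by have := len_swap_mul h; omega)]
  · intro σ F hF
    have step : ∀ ρ (i : Fin (n - 1)), len ρ < len σ → ρ.symm (hi i) < ρ.symm (lo i) →
        F ρ = T i * F (simpleSwap i * ρ) := fun ρ i h1 h2 => hF ρ _ h1 (Or.inr ⟨i, h2, rfl⟩)
    have main : ∀ i j : Fin (n - 1), i.1 < j.1 → σ.symm (hi i) < σ.symm (lo i) →
        σ.symm (hi j) < σ.symm (lo j) →
        T i * F (simpleSwap i * σ) = T j * F (simpleSwap j * σ) := by
      intro i j hij h1 h2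
      have l1 := len_swap_mul h1
      have l2 := len_swap_mul h2
      rcases Nat.lt_or_ge (i.1 + 1) j.1 with h | h
      · have f1 : simpleSwap i (hi j) = hi j := simpleSwap_of_ne (by simp [hi]; omega) (by simp [hi]; omega)
        have f2 : simpleSwap i (lo j) = lo j := simpleSwap_of_ne (by simp [lo]; omega) (by simp [lo]; omega)
        have f3 : simpleSwap j (hi i) = hi i := simpleSwap_of_ne (by simp [hi]; omega) (by simp [hi]; omega)
        have f4 : simpleSwap j (lo i) = lo i := simpleSwap_of_ne (by simp [lo]; omega) (by simp [lo]; omega)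
        rw [step (simpleSwap i * σ) j (by omega) (by rwa [symm_swap_mul, symm_swap_mul, f1, f2]),
          step (simpleSwap j * σ) i (by omega) (by rwa [symm_swap_mul, symm_swap_mul, f3, f4]),
          ← mul_assoc, ← mul_assoc, ← mul_assoc, ← mul_assoc, simpleSwap_comm h,
          hT _ _ (.comm i j h)]
      · have hij' : i.1 + 1 = j.1 := by omega
        have elo : lo j = hi i := Fin.ext (by simp [lo, hi, hij'])
        have f1 : simpleSwap i (hi j) = hi j := simpleSwap_of_ne (by simp [hi]; omega) (by simp [hi]; omega)
        have f2 : simpleSwap j (lo i) = lo i := simpleSwap_of_ne (by simp [lo]; omega) (by simp [lo]; omega)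
        have g1 : simpleSwap i (hi i) = lo i := Equiv.swap_apply_right _ _
        have g2 : simpleSwap i (lo i) = hi i := Equiv.swap_apply_left _ _
        have g3 : simpleSwap j (hi i) = hi j := by rw [← elo]; exact Equiv.swap_apply_left _ _
        have g4 : simpleSwap j (hi j) = hi i := by rw [← elo]; exact Equiv.swap_apply_right _ _
        rw [elo] at h2
        have a1 : (simpleSwap i * σ).symm (hi j) < (simpleSwap i * σ).symm (lo j) := by
          rw [elo, symm_swap_mul, symm_swap_mul, f1, g1]; exact h2.trans h1
        have a2 : (simpleSwap j * (simpleSwap i * σ)).symm (hi i) <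
            (simpleSwap j * (simpleSwap i * σ)).symm (lo i) := by
          simp only [symm_swap_mul, g3, f2, f1, g2]; exact h2
        have b1 : (simpleSwap j * σ).symm (hi i) < (simpleSwap j * σ).symm (lo i) := by
          rw [symm_swap_mul, symm_swap_mul, g3, f2]; exact h2.trans h1
        have b2 : (simpleSwap i * (simpleSwap j * σ)).symm (hi j) <
            (simpleSwap i * (simpleSwap j * σ)).symm (lo j) := by
          simp only [elo, symm_swap_mul, f1, g1, g4, f2]
          exact h1
        have m1 := len_swap_mul a1
        have m2 := len_swap_mul b1
        rw [step (simpleSwap i * σ) j (by omega) a1,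
          step (simpleSwap j * (simpleSwap i * σ)) i (by omega) a2,
          step (simpleSwap j * σ) i (by omega) b1,
          step (simpleSwap i * (simpleSwap j * σ)) j (by omega) b2]
        have e : simpleSwap i * (simpleSwap j * (simpleSwap i * σ)) =
            simpleSwap j * (simpleSwap i * (simpleSwap j * σ)) := by
          rw [← mul_assoc, ← mul_assoc, simpleSwap_braid hij']; simp only [mul_assoc]
        rw [e, ← mul_assoc, ← mul_assoc, hT _ _ (.braid i j hij')]
        simp only [mul_assoc]
    rintro f g (⟨rfl, rfl⟩ | ⟨i, h, rfl⟩) (⟨h1, rfl⟩ | ⟨j, h', rfl⟩)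
    · rfl
    · exact absurd h' (one_desc j)
    · subst h1; exact absurd h (one_desc i)
    · rcases lt_trichotomy i.1 j.1 with h1 | h1 | h1
      · exact main i j h1 h h'
      · rw [Fin.ext h1]
      · exact (main j i h1 h' h).symm

theorem prod_eq_of_reduced {D : Equiv.Perm (Fin n) → R} (h1 : D 1 = 1)
    (hD : ∀ σ i, σ.symm (hi i) < σ.symm (lo i) → D σ = T i * D (simpleSwap i * σ))
    (w : List (Fin (n - 1))) (hw : w.length = len (wordPerm w)) :
    (w.map T).prod = D (wordPerm w) := by
  induction w with
  | nil => simp [wordPerm, h1]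
  | cons i w ih =>
    rw [wordPerm_cons] at hw ⊢
    have hle := len_wordPerm_le w
    rw [List.length_cons] at hw
    rcases symm_lo_ne_hi (wordPerm w) i with h | h
    · have hl := len_swap_mul' h
      rw [hD _ i (by rw [symm_swap_mul, symm_swap_mul]; simpa using h), ← mul_assoc]
      simp only [List.map_cons, List.prod_cons, Equiv.swap_mul_self, one_mul]
      rw [ih (by omega)]
    · have := len_swap_mul h
      omega

/-- The properties of the symmetrizer that are used below. -/
theorem exists_T_basis (hT : ∀ a b, HeckeRel T a b → a = b) :
    ∃ D : Equiv.Perm (Fin n) → R, D 1 = 1 ∧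
      (∀ σ i, σ.symm (lo i) < σ.symm (hi i) → D (simpleSwap i * σ) = T i * D σ) ∧
      (∀ σ i, σ (lo i) < σ (hi i) → D (σ * simpleSwap i) = D σ * T i) ∧
      (∀ w : List (Fin (n - 1)), w.length = len (wordPerm w) →
        (w.map T).prod = D (wordPerm w)) ∧
      trivIdem T = (tFactorial n)⁻¹ • ∑ σ, t ^ ((n.choose 2 : ℤ) - (len σ : ℤ)) • D σ := by
  obtain ⟨D, h1, hD⟩ := exists_basis_family hT
  have hw := prod_eq_of_reduced h1 hD
  refine ⟨D, h1, ?_, ?_, hw, ?_⟩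
  · intro σ i h
    rw [hD (simpleSwap i * σ) i (by rw [symm_swap_mul, symm_swap_mul]; simpa using h), ← mul_assoc]
    simp
  · intro σ i h
    obtain ⟨w, rfl, hl⟩ := exists_word σ
    have e : wordPerm (w ++ [i]) = wordPerm w * simpleSwap i := by simp [wordPerm]
    have hlen : len (wordPerm w * simpleSwap i) = len (wordPerm w) + 1 := by
      rw [← len_inv, ← len_inv (wordPerm w), mul_inv_rev, Equiv.swap_inv]
      exact len_swap_mul' (σ := (wordPerm w)⁻¹) h
    rw [← e, ← hw _ hl, ← hw _ (by rw [e, hlen, List.length_append, hl]; rfl)]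
    simp
  · rw [trivIdem]
    congr 1
    refine Finset.sum_congr rfl fun σ _ => ?_
    obtain ⟨h3, h4⟩ := reducedWord_spec σ
    rw [hw _ (by rw [h3, h4]), h3, h4]

theorem zpow_sub_succ (a : ℤ) (m : ℕ) :
    t ^ (a - (m : ℤ)) = t * t ^ (a - ((m + 1 : ℕ) : ℤ)) := by
  rw [← zpow_one_add₀ t_ne_zero]
  congr 1
  push_cast
  ring

theorem T_mul_trivIdem (hT : ∀ a b, HeckeRel T a b → a = b) (i : Fin (n - 1)) :
    T i * trivIdem T = trivIdem T := by
  obtain ⟨D, h1, hD, -, -, he⟩ := exists_T_basis hT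
  have hq := generic_quad (hT _ _ (.quad i))
  rw [he, mul_smul_comm]
  congr 1
  let x : Equiv.Perm (Fin n) → R := fun σ => t ^ ((n.choose 2 : ℤ) - (len σ : ℤ)) • D σ
  let up : Equiv.Perm (Fin n) → Prop := fun σ => σ.symm (lo i) < σ.symm (hi i)
  have hup : ∀ σ, up (simpleSwap i * σ) ↔ ¬up σ := by
    intro σ
    simp only [up]
    rw [symm_swap_mul, symm_swap_mul, Equiv.swap_apply_left, Equiv.swap_apply_right]
    rcases symm_lo_ne_hi σ i with h | h
    · simp [h, h.le]
    · simp [h, h.le]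
  -- The permutations are paired by left multiplication with `simpleSwap i`. In the total, `x σ`
  -- receives 1 from its partner if multiplication by the swap lengthens `σ`, and `t` from its
  -- partner plus `1 - t` from itself otherwise.
  have key : ∀ σ, T i * x σ = (if up σ then t else 1) • x (simpleSwap i * σ) +
      (if up σ then 0 else 1 - t) • x σ := by
    intro σ
    by_cases h : up σ
    · simp only [h, if_true, zero_smul, add_zero, x]
      rw [hD σ i h, mul_smul_comm, len_swap_mul' h, smul_smul, ← zpow_sub_succ]
    · have h' : up (simpleSwap i * σ) := (hup σ).2 h
      have e : simpleSwap i * (simpleSwap i * σ) = σ := by rw [← mul_assoc]; simp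
      have hd := hD _ i h'
      have hl := len_swap_mul' h'
      rw [e] at hd hl
      simp only [h, if_false, one_smul, x]
      rw [hd, mul_smul_comm, ← mul_assoc, hq, add_mul, smul_mul_assoc, smul_mul_assoc, one_mul, hl,
        zpow_sub_succ _ (len (simpleSwap i * σ)), smul_add, smul_smul, smul_smul, smul_smul, add_comm,
        mul_comm t, mul_comm (1 - t)]
  change T i * ∑ σ, x σ = ∑ σ, x σ
  have hs : ∑ σ, (if up σ then t else 1) • x (simpleSwap i * σ) =
      ∑ σ, (if up σ then (1 : K) else t) • x σ := by
    rw [← Equiv.sum_comp (Equiv.mulLeft (simpleSwap i))]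
    refine Finset.sum_congr rfl fun σ _ => ?_
    simp only [Equiv.coe_mulLeft, hup]
    by_cases h : up σ <;> simp [h]
  rw [Finset.mul_sum, Finset.sum_congr rfl fun σ _ => key σ, Finset.sum_add_distrib, hs,
    ← Finset.sum_add_distrib]
  refine Finset.sum_congr rfl fun σ _ => ?_
  by_cases h : up σ
  · simp [h]
  · simp only [h, if_false]
    rw [← add_smul, add_sub_cancel, one_smul]

theorem trivIdem_mul_T (hT : ∀ a b, HeckeRel T a b → a = b) (i : Fin (n - 1)) :
    trivIdem T * T i = trivIdem T := by
  obtain ⟨D, h1, -, hD, -, he⟩ := exists_T_basis hT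
  have hq := generic_quad (hT _ _ (.quad i))
  rw [he, smul_mul_assoc]
  congr 1
  let x : Equiv.Perm (Fin n) → R := fun σ => t ^ ((n.choose 2 : ℤ) - (len σ : ℤ)) • D σ
  let up : Equiv.Perm (Fin n) → Prop := fun σ => σ (lo i) < σ (hi i)
  have hup : ∀ σ, up (σ * simpleSwap i) ↔ ¬up σ := by
    intro σ
    simp only [up, Equiv.Perm.mul_apply]
    rw [Equiv.swap_apply_left, Equiv.swap_apply_right]
    rcases lt_or_gt_of_ne (fun e => lo_ne_hi i (σ.injective e)) with h | h
    · simp [h, h.le]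
    · simp [h, h.le]
  have hlen : ∀ σ, up σ → len (σ * simpleSwap i) = len σ + 1 := by
    intro σ h
    rw [← len_inv, ← len_inv σ, mul_inv_rev, Equiv.swap_inv]
    exact len_swap_mul' (σ := σ⁻¹) h
  -- The same pairing as for `T_mul_trivIdem`, now by right multiplication.
  have key : ∀ σ, x σ * T i = (if up σ then t else 1) • x (σ * simpleSwap i) +
      (if up σ then 0 else 1 - t) • x σ := by
    intro σ
    by_cases h : up σ
    · simp only [h, if_true, zero_smul, add_zero, x]
      rw [hD σ i h, smul_mul_assoc, hlen σ h, smul_smul, ← zpow_sub_succ]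
    · have h' : up (σ * simpleSwap i) := (hup σ).2 h
      have e : σ * simpleSwap i * simpleSwap i = σ := by rw [mul_assoc]; simp
      have hd := hD _ i h'
      have hl := hlen _ h'
      rw [e] at hd hl
      simp only [h, if_false, one_smul, x]
      rw [hd, smul_mul_assoc, mul_assoc, hq, mul_add, mul_smul_comm, mul_smul_comm, mul_one, hl,
        zpow_sub_succ _ (len (σ * simpleSwap i)), smul_add, smul_smul, smul_smul, smul_smul, add_comm,
        mul_comm t, mul_comm (1 - t)]
  change (∑ σ, x σ) * T i = ∑ σ, x σ
  have hs : ∑ σ, (if up σ then t else 1) • x (σ * simpleSwap i) =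
      ∑ σ, (if up σ then (1 : K) else t) • x σ := by
    rw [← Equiv.sum_comp (Equiv.mulRight (simpleSwap i))]
    refine Finset.sum_congr rfl fun σ _ => ?_
    simp only [Equiv.coe_mulRight, hup]
    by_cases h : up σ <;> simp [h]
  rw [Finset.sum_mul, Finset.sum_congr rfl fun σ _ => key σ, Finset.sum_add_distrib, hs,
    ← Finset.sum_add_distrib]
  refine Finset.sum_congr rfl fun σ _ => ?_
  by_cases h : up σ
  · simp [h]
  · simp only [h, if_false]
    rw [← add_smul, add_sub_cancel, one_smul]

end Length

end

end VVMacdonald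

/-! ### Generating functions of inversions, and the symmetrizer on invariant vectors. -/

namespace VVMacdonald

noncomputable section

open Classical TensorProduct

/-! ### Generating functions of inversion numbers -/

/-- The number of pairs that are not inverted by a permutation. -/
def nonInv {α : Type*} [Fintype α] [LinearOrder α] (σ : Equiv.Perm α) : ℕ :=
  (Finset.univ.filter fun p : α × α => p.1 < p.2 ∧ σ p.1 < σ p.2).card

theorem card_filter_lt_fin (n : ℕ) :
    (Finset.univ.filter fun p : Fin n × Fin n => p.1 < p.2).card = n.choose 2 := by
  have h : (Finset.univ.filter fun p : Fin n × Fin n => p.1 < p.2).card =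
      ∑ b : Fin n, (Finset.univ.filter fun a : Fin n => a < b).card := by
    rw [Finset.card_eq_sum_card_fiberwise (f := Prod.snd) (t := Finset.univ) (by simp)]
    refine Finset.sum_congr rfl fun b _ => ?_
    refine Finset.card_bij' (fun p _ => p.1) (fun a _ => (a, b)) ?_ ?_ ?_ ?_
    · rintro ⟨a, c⟩ hp
      simp only [Finset.mem_filter, Finset.mem_univ, true_and] at hp ⊢
      obtain ⟨h1, rfl⟩ := hp
      exact h1
    · intro a ha
      simpa using ha
    · rintro ⟨a, c⟩ hp
      simp only [Finset.mem_filter, Finset.mem_univ, true_and] at hp ⊢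
      rw [hp.2]
    · intro a ha
      rfl
  rw [h]
  have h2 : ∀ b : Fin n, (Finset.univ.filter fun a : Fin n => a < b).card = b.1 := by
    intro b
    have : (Finset.univ.filter fun a : Fin n => a < b) = Finset.Iio b := by ext; simp
    rw [this, Fin.card_Iio]
  rw [Finset.sum_congr rfl fun b _ => h2 b, Fin.sum_univ_eq_sum_range (fun i => i) n,
    Finset.sum_range_id, Nat.choose_two_right]

theorem len_add_nonInv {n : ℕ} (σ : Equiv.Perm (Fin n)) : len σ + nonInv σ = n.choose 2 := by
  rw [← card_filter_lt_fin, len, nonInv, ← Finset.card_union_of_disjoint]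
  · congr 1
    ext p
    rw [Finset.mem_union, mem_invs]
    simp only [Finset.mem_filter, Finset.mem_univ, true_and]
    constructor
    · rintro (h | h)
      exacts [h.1, h.1]
    · intro h
      rcases lt_or_gt_of_ne (fun e => h.ne (σ.injective e)) with h' | h'
      exacts [Or.inr ⟨h, h'⟩, Or.inl ⟨h, h'⟩]
  · rw [Finset.disjoint_left]
    intro p hp hp'
    rw [mem_invs] at hp
    simp only [Finset.mem_filter, Finset.mem_univ, true_and] at hp'
    exact lt_asymm hp.2 hp'.2

theorem zpow_choose_sub_len {n : ℕ} (σ : Equiv.Perm (Fin n)) :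
    t ^ ((n.choose 2 : ℤ) - (len σ : ℤ)) = t ^ nonInv σ := by
  rw [← len_add_nonInv σ, ← zpow_natCast]
  congr 1
  push_cast
  ring

theorem t_ne_one : t ≠ 1 := by
  intro h
  rw [t, ← map_one (algebraMap (MvPolynomial (Fin 2) ℚ) K)] at h
  have := IsFractionRing.injective (MvPolynomial (Fin 2) ℚ) K h
  have h2 := congrArg (MvPolynomial.eval fun _ => (0 : ℚ)) this
  simp at h2

/-- A permutation of `m + 1` letters amounts to its value at 0 and the relative order of its other
values. The value `a` at 0 contributes `m - a` non-inverted pairs, so each induction step multiplies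
by 1 + t + ⋯ + t^m. -/
theorem sum_nonInv_fin (m : ℕ) : ∑ σ : Equiv.Perm (Fin m), t ^ nonInv σ = tFactorial m := by
  induction m with
  | zero =>
    rw [Fintype.sum_unique]
    simp [tFactorial, nonInv]
  | succ m ih =>
    -- `decomposeFin.symm (0, x.2)` extends `x.2` by fixing 0; the inverse of `cycleRange` then
    -- sends 0 to `x.1` and moves the other values by `succAbove`.
    let Φ : Fin (m + 1) × Equiv.Perm (Fin m) → Equiv.Perm (Fin (m + 1)) := fun x =>
      x.1.cycleRange.symm * Equiv.Perm.decomposeFin.symm (0, x.2)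
    have h0 : ∀ x, Φ x 0 = x.1 := by
      intro x
      simp [Φ]
    have hs : ∀ x (k : Fin m), Φ x k.succ = x.1.succAbove (x.2 k) := by
      intro x k
      simp [Φ]
    have hinj : Function.Injective Φ := by
      intro x y h
      have h1 : x.1 = y.1 := by rw [← h0 x, ← h0 y, h]
      refine Prod.ext h1 (Equiv.ext fun k => ?_)
      have h2 : Φ x k.succ = Φ y k.succ := by rw [h]
      rw [hs, hs, h1] at h2
      exact Fin.succAbove_right_injective h2
    have hbij : Function.Bijective Φ := by
      rw [Fintype.bijective_iff_injective_and_card]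
      refine ⟨hinj, ?_⟩
      simp [Fintype.card_perm, Nat.factorial_succ]
    have hcount : ∀ x, nonInv (Φ x) = (m - x.1.1) + nonInv x.2 := by
      intro x
      let f : Fin m → Fin (m + 1) × Fin (m + 1) := fun l => (0, l.succ)
      let g : Fin m × Fin m → Fin (m + 1) × Fin (m + 1) := fun p => (p.1.succ, p.2.succ)
      have hf : Function.Injective f := fun a b h => Fin.succ_injective _ (congrArg Prod.snd h)
      have hg : Function.Injective g := fun a b h => Prod.ext
        (Fin.succ_injective _ (congrArg Prod.fst h)) (Fin.succ_injective _ (congrArg Prod.snd h))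
      have hsplit : (Finset.univ.filter fun p : Fin (m + 1) × Fin (m + 1) =>
          p.1 < p.2 ∧ Φ x p.1 < Φ x p.2) =
          ((Finset.univ.filter fun l : Fin m => x.1 < x.1.succAbove (x.2 l)).image f) ∪
          ((Finset.univ.filter fun p : Fin m × Fin m =>
            p.1 < p.2 ∧ x.2 p.1 < x.2 p.2).image g) := by
        ext ⟨a, b⟩
        simp only [Finset.mem_filter, Finset.mem_univ, true_and, Finset.mem_union,
          Finset.mem_image, f, g, Prod.mk.injEq, Prod.exists]
        refine Fin.cases ?_ (fun b => ?_) b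
        · simp [Fin.succ_ne_zero]
        · refine Fin.cases ?_ (fun a => ?_) a
          · rw [h0, hs]
            simp [Fin.succ_ne_zero]
          · rw [hs, hs, Fin.succ_lt_succ_iff, Fin.succAbove_lt_succAbove_iff]
            simp [(Fin.succ_ne_zero _).symm]
      rw [nonInv, hsplit, Finset.card_union_of_disjoint, Finset.card_image_of_injective _ hf,
        Finset.card_image_of_injective _ hg]
      · congr 1
        have e : (Finset.univ.filter fun l : Fin m => x.1 < x.1.succAbove (x.2 l)).card =
            (Finset.univ.filter fun l : Fin m => x.1 < x.1.succAbove l).card := by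
          refine Finset.card_bij (fun l _ => x.2 l) ?_ ?_ ?_
          · intro l hl; simpa using hl
          · intro a _ b _ h; exact x.2.injective h
          · intro b hb
            exact ⟨x.2.symm b, by simpa using hb, by simp⟩
        rw [e]
        have e2 : (Finset.univ.filter fun l : Fin m => x.1 < x.1.succAbove l).map
            (Fin.succAboveEmb x.1) = Finset.Ioi x.1 := by
          ext y
          simp only [Finset.mem_map, Finset.mem_filter, Finset.mem_univ, true_and,
            Finset.mem_Ioi]
          constructor
          · rintro ⟨l, hl, rfl⟩
            exact hl
          · intro hy
            obtain ⟨l, rfl⟩ := Fin.exists_succAbove_eq hy.ne'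
            exact ⟨l, hy, rfl⟩
        rw [← Finset.card_map (Fin.succAboveEmb x.1), e2, Fin.card_Ioi]
        omega
      · rw [Finset.disjoint_left]
        rintro ⟨a, b⟩ h1 h2
        simp only [Finset.mem_image, Finset.mem_filter, Finset.mem_univ, true_and, f, g,
          Prod.mk.injEq, Prod.exists] at h1 h2
        obtain ⟨_, _, h, _⟩ := h1
        obtain ⟨_, _, _, h', _⟩ := h2
        rw [← h] at h'
        exact Fin.succ_ne_zero _ h'
    rw [← hbij.sum_comp (fun σ => t ^ nonInv σ), Fintype.sum_prod_type]
    simp only [hcount, pow_add]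
    rw [← Finset.sum_mul_sum, ih, tFactorial, tFactorial, Finset.prod_range_succ, mul_comm]
    congr 1
    rw [Fin.sum_univ_eq_sum_range (fun i => t ^ (m - i)) (m + 1)]
    have := Finset.sum_range_reflect (fun i => t ^ i) (m + 1)
    simp only [Nat.add_sub_cancel] at this
    rw [this, geom_sum_eq t_ne_one, ← neg_sub, ← neg_sub (1 : K), neg_div_neg_eq]

theorem sum_nonInv {α : Type*} [Fintype α] [LinearOrder α] :
    ∑ σ : Equiv.Perm α, t ^ nonInv σ = tFactorial (Fintype.card α) := by
  rw [← sum_nonInv_fin]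
  let e : Fin (Fintype.card α) ≃o α := Fintype.orderIsoFinOfCardEq α rfl
  rw [← Equiv.sum_comp (Equiv.permCongr e.toEquiv)]
  refine Finset.sum_congr rfl fun σ _ => ?_
  congr 1
  rw [nonInv, nonInv]
  refine Finset.card_bij (fun p _ => (e.symm p.1, e.symm p.2)) ?_ ?_ ?_
  · intro p hp
    simpa [Equiv.permCongr_apply] using hp
  · intro p _ p' _ h
    simpa [Prod.ext_iff] using h
  · intro p hp
    exact ⟨(e p.1, e p.2), by simpa [Equiv.permCongr_apply] using hp, by simp⟩

/-- The generating function of the inversions of the permutations that preserve the fibres of a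
function. -/
theorem sum_nonInv_fibres {α γ : Type*} [Fintype α] [LinearOrder α] [Fintype γ] (β : α → γ) :
    ∑ σ : Equiv.Perm α with (∀ a, β (σ a) = β a),
        t ^ (Finset.univ.filter fun p : α × α => β p.1 = β p.2 ∧ p.1 < p.2 ∧ σ p.1 < σ p.2).card =
      ∏ c : γ, tFactorial (Fintype.card {a // β a = c}) := by
  -- A permutation that preserves the fibres is a family of permutations of the fibres, and the
  -- non-inverted pairs inside the fibres add up.
  let Φ : (∀ c : γ, Equiv.Perm {a // β a = c}) → Equiv.Perm α := fun x =>
    (Equiv.sigmaFiberEquiv β).permCongr (Equiv.Perm.sigmaCongrRight x)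
  have hΦ : ∀ x a, Φ x a = (x (β a) ⟨a, rfl⟩ : α) := fun x a => rfl
  have hΦ' : ∀ x c (a : {a // β a = c}), Φ x a.1 = (x c a : α) := by
    rintro x c ⟨a, rfl⟩
    rfl
  have hβ : ∀ x a, β (Φ x a) = β a := fun x a => (x (β a) ⟨a, rfl⟩).2
  have hcount : ∀ x, (Finset.univ.filter fun p : α × α =>
      β p.1 = β p.2 ∧ p.1 < p.2 ∧ Φ x p.1 < Φ x p.2).card = ∑ c, nonInv (x c) := by
    intro x
    rw [Finset.card_eq_sum_card_fiberwise (f := fun p => β p.1) (t := Finset.univ) (by simp)]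
    refine Finset.sum_congr rfl fun c _ => ?_
    symm
    refine Finset.card_bij (fun p _ => (p.1.1, p.2.1)) ?_ ?_ ?_
    · intro p hp
      simp only [Finset.mem_filter, Finset.mem_univ, true_and] at hp ⊢
      rw [hΦ', hΦ']
      exact ⟨⟨p.1.2.trans p.2.2.symm, hp.1, hp.2⟩, p.1.2⟩
    · intro p _ p' _ h
      simp only [Prod.mk.injEq] at h
      exact Prod.ext (Subtype.ext h.1) (Subtype.ext h.2)
    · rintro ⟨a, b⟩ hp
      simp only [Finset.mem_filter, Finset.mem_univ, true_and] at hp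
      obtain ⟨⟨h1, h2, h3⟩, h4⟩ := hp
      refine ⟨(⟨a, h4⟩, ⟨b, h1.symm.trans h4⟩), ?_, rfl⟩
      simp only [Finset.mem_filter, Finset.mem_univ, true_and]
      refine ⟨h2, ?_⟩
      have e1 := hΦ' x c ⟨a, h4⟩
      have e2 := hΦ' x c ⟨b, h1.symm.trans h4⟩
      simp only at e1 e2
      rw [e1, e2] at h3
      exact h3
  have hsum : ∑ σ : Equiv.Perm α with (∀ a, β (σ a) = β a),
        t ^ (Finset.univ.filter fun p : α × α => β p.1 = β p.2 ∧ p.1 < p.2 ∧ σ p.1 < σ p.2).card =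
      ∑ x : (∀ c : γ, Equiv.Perm {a // β a = c}), ∏ c, t ^ nonInv (x c) := by
    symm
    refine Finset.sum_bij (fun x _ => Φ x) ?_ ?_ ?_ ?_
    · intro x _
      simpa using hβ x
    · intro x _ y _ h
      funext c
      ext a
      rw [← hΦ', ← hΦ', h]
    · intro σ hσ
      simp only [Finset.mem_filter, Finset.mem_univ, true_and] at hσ
      refine ⟨fun c => σ.subtypeEquiv fun a => by rw [hσ], Finset.mem_univ _, ?_⟩
      ext a
      rfl
    · intro x _
      rw [hcount, Finset.prod_pow_eq_pow_sum]
  rw [hsum]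
  rw [Finset.prod_congr rfl fun c _ => (sum_nonInv (α := {a // β a = c})).symm,
    Finset.prod_univ_sum]
  exact Finset.sum_congr (by ext x; simp [Fintype.mem_piFinset]) fun _ _ => rfl

/-! ### The symmetrizer on modules -/

theorem one_sub_t_pow_ne_zero (k : ℕ) : 1 - t ^ (k + 1) ≠ 0 := by
  intro h
  have h' : t ^ (k + 1) = 1 := (sub_eq_zero.1 h).symm
  rw [t, ← map_pow, ← map_one (algebraMap (MvPolynomial (Fin 2) ℚ) K)] at h'
  have := IsFractionRing.injective (MvPolynomial (Fin 2) ℚ) K h'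
  have h2 := congrArg (MvPolynomial.eval fun _ => (0 : ℚ)) this
  simp at h2

theorem tFactorial_ne_zero (m : ℕ) : tFactorial m ≠ 0 :=
  Finset.prod_ne_zero_iff.2 fun i _ =>
    div_ne_zero (one_sub_t_pow_ne_zero i) (by simpa using one_sub_t_pow_ne_zero 0)

section Module

variable {R : Type*} [Ring R] [Algebra K R] {n : ℕ} {T : Fin (n - 1) → R}
  {M : Type*} [AddCommGroup M] [Module K M] [Module R M] [IsScalarTower K R M]

/-- Every T_σ fixes `p`, and the coefficients of the symmetrizer sum to [n]_t!, which the
normalization cancels. -/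
theorem trivIdem_smul_of_invariant (hT : ∀ a b, HeckeRel T a b → a = b) {p : M}
    (hp : ∀ i, T i • p = p) : trivIdem T • p = p := by
  obtain ⟨D, -, -, -, hw, he⟩ := exists_T_basis hT
  have hD : ∀ σ, D σ • p = p := by
    intro σ
    obtain ⟨w, rfl, hl⟩ := exists_word σ
    rw [← hw w hl]
    clear hl
    induction w with
    | nil => simp
    | cons i w ih => rw [List.map_cons, List.prod_cons, mul_smul, ih, hp]
  rw [he, smul_assoc, Finset.sum_smul]
  have : ∀ σ, (t ^ ((n.choose 2 : ℤ) - (len σ : ℤ)) • D σ) • p = t ^ nonInv σ • p := by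
    intro σ
    rw [smul_assoc, hD, zpow_choose_sub_len]
  rw [Finset.sum_congr rfl fun σ _ => this σ, ← Finset.sum_smul, sum_nonInv_fin, smul_smul,
    inv_mul_cancel₀ (tFactorial_ne_zero n), one_smul]

end Module

end

end VVMacdonald

/-! ### Weights of boxes and the order on periodic standard tableaux. -/

namespace VVMacdonald

noncomputable section

open Classical TensorProduct

/-! ### Monomials in `q` and `t` -/

theorem monomial_pow_eq {m m' k k' : ℕ} (h : q ^ m * t ^ k = q ^ m' * t ^ k') :
    m = m' ∧ k = k' := by
  rw [q, t, ← map_pow, ← map_pow, ← map_pow, ← map_pow, ← map_mul, ← map_mul] at h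
  have h1 := IsFractionRing.injective (MvPolynomial (Fin 2) ℚ) K h
  rw [MvPolynomial.X_pow_eq_monomial, MvPolynomial.X_pow_eq_monomial,
    MvPolynomial.X_pow_eq_monomial, MvPolynomial.X_pow_eq_monomial, MvPolynomial.monomial_mul,
    MvPolynomial.monomial_mul] at h1
  have h2 := MvPolynomial.monomial_left_injective (R := ℚ) (σ := Fin 2) (r := 1 * 1) (by simp) h1
  have h3 := DFunLike.congr_fun h2 0
  have h4 := DFunLike.congr_fun h2 1
  simp at h3 h4
  exact ⟨h3, h4⟩

theorem q_ne_zero : q ≠ 0 := by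
  unfold q
  rw [Ne, IsFractionRing.to_map_eq_zero_iff]
  exact MvPolynomial.X_ne_zero 0

theorem monomial_zpow_eq {m m' : ℕ} {k k' : ℤ} (h : q ^ m * t ^ k = q ^ m' * t ^ k') :
    m = m' ∧ k = k' := by
  have ht := t_ne_zero
  -- Both integer exponents are shifted by `|k| + |k'|`, which makes them non-negative, so that
  -- monomials in the polynomial ring can be compared.
  have h1 : q ^ m * t ^ (k + |k| + |k'|).toNat = q ^ m' * t ^ (k' + |k| + |k'|).toNat := by
    have n1 : 0 ≤ k + |k| + |k'| := by have := neg_abs_le k; have := abs_nonneg k'; linarith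
    have n2 : 0 ≤ k' + |k| + |k'| := by have := neg_abs_le k'; have := abs_nonneg k; linarith
    rw [← zpow_natCast t, ← zpow_natCast t, Int.toNat_of_nonneg n1, Int.toNat_of_nonneg n2,
      add_assoc, add_assoc, zpow_add₀ ht k, zpow_add₀ ht k', ← mul_assoc, ← mul_assoc, h]
  obtain ⟨h2, h3⟩ := monomial_pow_eq h1
  refine ⟨h2, ?_⟩
  have := neg_abs_le k; have := abs_nonneg k'
  have := neg_abs_le k'; have := abs_nonneg k
  omega

variable {μ : YoungDiagram}

theorem boxWeight_ne_zero (T : Box μ → ℕ) (a : Box μ) : boxWeight T a ≠ 0 :=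
  mul_ne_zero (pow_ne_zero _ q_ne_zero) (zpow_ne_zero _ t_ne_zero)

theorem boxWeight_eq {T T' : Box μ → ℕ} {a b : Box μ} (h : boxWeight T a = boxWeight T' b) :
    T a = T' b ∧ a.content = b.content := monomial_zpow_eq h

theorem boxWeight_eq_mul {T : Box μ → ℕ} {a b : Box μ}
    (h : boxWeight T a = t * boxWeight T b) : T a = T b ∧ a.content = b.content + 1 := by
  refine monomial_zpow_eq (h.trans ?_)
  rw [zpow_add_one₀ t_ne_zero, boxWeight]
  ring

/-! ### Relative positions of boxes -/

theorem Box.ext' {a b : Box μ} (h1 : a.row = b.row) (h2 : a.col = b.col) : a = b :=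
  Subtype.ext (Prod.ext h1 h2)

theorem exists_box {b : Box μ} {r c : ℕ} (hr : r ≤ b.row) (hc : c ≤ b.col) :
    ∃ x : Box μ, x.row = r ∧ x.col = c :=
  ⟨⟨(r, c), (μ.mem_cells _).2 (μ.up_left_mem hr hc ((μ.mem_cells _).1 b.2))⟩, rfl, rfl⟩

/-- `b` has a smaller exponent than `a`, or the same one and lies strictly to the north-east. -/
def StrongBefore (T : Box μ → ℕ) (a b : Box μ) : Prop :=
  T b < T a ∨ (T a = T b ∧ a.col < b.col ∧ b.row < a.row)

theorem StrongBefore.trans {T : Box μ → ℕ} {a b c : Box μ} (h : StrongBefore T a b)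
    (h' : StrongBefore T b c) : StrongBefore T a c := by
  unfold StrongBefore at *
  omega

theorem StrongBefore.asymm {T : Box μ → ℕ} {a b : Box μ} (h : StrongBefore T a b) :
    ¬StrongBefore T b a := by
  unfold StrongBefore at *
  omega

theorem StrongBefore.std {T : Box μ → ℕ} {a b : Box μ} (h : StrongBefore T a b) :
    StdBefore T a b := by
  unfold StrongBefore at h
  unfold StdBefore
  omega

/-- If the exponents agree, a strictly north-east position changes the content by at least 2. So the
weights are neither equal nor in ratio `t`, which keeps the denominators and numerators met below
away from zero. -/
theorem StrongBefore.weight_ne {T : Box μ → ℕ} {a b : Box μ} (h : StrongBefore T a b) :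
    boxWeight T a ≠ boxWeight T b := by
  intro e
  obtain ⟨h1, h2⟩ := boxWeight_eq e
  unfold StrongBefore at h
  unfold Box.content at h2
  omega

theorem StrongBefore.weight_ne_mul {T : Box μ → ℕ} {a b : Box μ} (h : StrongBefore T a b) :
    boxWeight T a ≠ t * boxWeight T b := by
  intro e
  obtain ⟨h1, h2⟩ := boxWeight_eq_mul e
  unfold StrongBefore at h
  unfold Box.content at h2
  omega

theorem StrongBefore.weight_ne_mul' {T : Box μ → ℕ} {a b : Box μ} (h : StrongBefore T a b) :
    boxWeight T b ≠ t * boxWeight T a := by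
  intro e
  obtain ⟨h1, h2⟩ := boxWeight_eq_mul e
  unfold StrongBefore at h
  unfold Box.content at h2
  omega

theorem stdBefore_asymm (T : Box μ → ℕ) (a b : Box μ) (h : StdBefore T a b) :
    ¬StdBefore T b a := by
  unfold StdBefore at *
  omega

theorem stdBefore_trans (T : Box μ → ℕ) (a b c : Box μ) (h : StdBefore T a b)
    (h' : StdBefore T b c) : StdBefore T a c := by
  unfold StdBefore at *
  omega

theorem stdBefore_total (T : Box μ → ℕ) (a b : Box μ) (h : a ≠ b) :
    StdBefore T a b ∨ StdBefore T b a := by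
  have : ¬(a.row = b.row ∧ a.col = b.col) := fun e => h (Box.ext' e.1 e.2)
  unfold StdBefore
  omega

/-- The order of the boxes by increasing value of `T` and, for equal values, row by row. -/
def MinBefore (T : Box μ → ℕ) (a b : Box μ) : Prop :=
  T a < T b ∨ (T a = T b ∧ (a.row < b.row ∨ (a.row = b.row ∧ a.col < b.col)))

theorem minBefore_asymm (T : Box μ → ℕ) (a b : Box μ) (h : MinBefore T a b) :
    ¬MinBefore T b a := by
  unfold MinBefore at *
  omega

theorem minBefore_trans (T : Box μ → ℕ) (a b c : Box μ) (h : MinBefore T a b)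
    (h' : MinBefore T b c) : MinBefore T a c := by
  unfold MinBefore at *
  omega

theorem minBefore_total (T : Box μ → ℕ) (a b : Box μ) (h : a ≠ b) :
    MinBefore T a b ∨ MinBefore T b a := by
  have : ¬(a.row = b.row ∧ a.col = b.col) := fun e => h (Box.ext' e.1 e.2)
  unfold MinBefore
  omega

theorem StrongBefore.minBefore {T : Box μ → ℕ} {a b : Box μ} (h : StrongBefore T a b) :
    MinBefore T b a := by
  unfold StrongBefore at h
  unfold MinBefore
  omega

namespace PSYT

/-- The box with the number `i`. -/
abbrev box (τ : PSYT μ) (i : Fin μ.card) : Box μ := τ.label.symm i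

theorem label_lt (τ : PSYT μ) {a b : Box μ} (hr : a.row ≤ b.row) (hc : a.col ≤ b.col)
    (hne : a ≠ b) : PLabelLt (τ.label a, τ.wt a) (τ.label b, τ.wt b) := by
  rcases hr.eq_or_lt with h1 | h1
  · rcases hc.eq_or_lt with h2 | h2
    · exact absurd (Box.ext' h1 h2) hne
    · exact τ.row_lt a b h1 h2
  · rcases hc.eq_or_lt with h2 | h2
    · exact τ.col_lt a b h2 h1
    · obtain ⟨x, hx1, hx2⟩ := exists_box (b := b) hr le_rfl
      have h3 := τ.row_lt a x hx1.symm (by omega)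
      have h4 := τ.col_lt x b hx2 (by omega)
      unfold PLabelLt at *
      simp only at *
      rcases h3 with h3 | ⟨h3, h3'⟩ <;> rcases h4 with h4 | ⟨h4, h4'⟩
      · left; omega
      · left; omega
      · left; omega
      · right; exact ⟨h3.trans h4, h3'.trans h4'⟩

theorem label_lt_of_wt_eq (τ : PSYT μ) {a b : Box μ} (hr : a.row ≤ b.row) (hc : a.col ≤ b.col)
    (hne : a ≠ b) (hw : τ.wt a = τ.wt b) : τ.label a < τ.label b := by
  rcases τ.label_lt hr hc hne with h | h
  · simp only at h; omega
  · exact h.2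

theorem wt_le (τ : PSYT μ) {a b : Box μ} (hr : a.row ≤ b.row) (hc : a.col ≤ b.col) :
    τ.wt b ≤ τ.wt a := by
  by_cases hne : a = b
  · rw [hne]
  · rcases τ.label_lt hr hc hne with h | h
    · exact h.le
    · exact h.1.ge

/-- Two boxes with the same exponent are next to each other in a row or a column. -/
def Adjacent (T : Box μ → ℕ) (a b : Box μ) : Prop :=
  T a = T b ∧ ((a.row = b.row ∧ b.col = a.col + 1) ∨ (a.col = b.col ∧ b.row = a.row + 1))

/-- For equal exponents, two boxes that are comparable in the diagram span a rectangle in which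
every further box would need a label strictly between `i` and `i + 1`; hence they are neighbours.
Incomparable boxes lie strictly north-east and south-west of each other. -/
theorem consecutive (τ : PSYT μ) (i : Fin (μ.card - 1)) :
    StrongBefore τ.wt (τ.box (lo i)) (τ.box (hi i)) ∨
      StrongBefore τ.wt (τ.box (hi i)) (τ.box (lo i)) ∨
      Adjacent τ.wt (τ.box (lo i)) (τ.box (hi i)) := by
  set a := τ.box (lo i) with ha
  set b := τ.box (hi i) with hb
  have hla : (τ.label a).1 = i.1 := by simp [ha, lo]
  have hlb : (τ.label b).1 = i.1 + 1 := by simp [hb, hi]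
  have hne : a ≠ b := fun e => by rw [e] at hla; omega
  rcases lt_trichotomy (τ.wt a) (τ.wt b) with h | h | h
  · right; left; left; exact h
  · by_cases h1 : b.row ≤ a.row ∧ b.col ≤ a.col
    · have := Fin.lt_def.1 (τ.label_lt_of_wt_eq h1.1 h1.2 hne.symm h.symm)
      omega
    by_cases h2 : a.row ≤ b.row ∧ a.col ≤ b.col
    · right; right
      refine ⟨h, ?_⟩
      have mid : ∀ x : Box μ, a.row ≤ x.row → a.col ≤ x.col → x.row ≤ b.row → x.col ≤ b.col →
          x = a ∨ x = b := by
        intro x x1 x2 x3 x4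
        by_contra hcon
        push Not at hcon
        have w1 := τ.wt_le x1 x2
        have w2 := τ.wt_le x3 x4
        have l1 := Fin.lt_def.1 (τ.label_lt_of_wt_eq x1 x2 hcon.1.symm (by omega))
        have l2 := Fin.lt_def.1 (τ.label_lt_of_wt_eq x3 x4 hcon.2 (by omega))
        omega
      rcases h2.1.eq_or_lt with h3 | h3
      · left
        refine ⟨h3, ?_⟩
        have h4 : a.col < b.col := lt_of_le_of_ne h2.2 fun e => hne (Box.ext' h3 e)
        obtain ⟨x, hx1, hx2⟩ := exists_box (b := b) (r := a.row) (c := a.col + 1) h2.1 h4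
        rcases mid x hx1.ge (by omega) (by omega) (by omega) with e | e
        · rw [e] at hx2; omega
        · rw [e] at hx2; exact hx2
      · obtain ⟨x, hx1, hx2⟩ := exists_box (b := b) (r := a.row + 1) (c := a.col) h3 h2.2
        rcases mid x (by omega) (by omega) (by omega) (by omega) with e | e
        · rw [e] at hx1; omega
        · rw [e] at hx1 hx2; exact Or.inr ⟨hx2.symm, hx1⟩
    · have h3 : a.row ≠ b.row := fun e => by omega
      have h4 : a.col ≠ b.col := fun e => by omega
      rcases lt_or_gt_of_ne h4 with h5 | h5
      · left; right; exact ⟨h, h5, by omega⟩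
      · right; left; right; exact ⟨h.symm, h5, by omega⟩
  · left; left; exact h

/-- The numbers `i` and `i + 1` can be exchanged. -/
def Free (τ : PSYT μ) (i : Fin (μ.card - 1)) : Prop :=
  StrongBefore τ.wt (τ.box (lo i)) (τ.box (hi i)) ∨
    StrongBefore τ.wt (τ.box (hi i)) (τ.box (lo i))

theorem swap_lt (τ : PSYT μ) {i : Fin (μ.card - 1)} (h : τ.Free i) {a b : Box μ}
    (hab : a.row = b.row ∨ a.col = b.col) (hlt : PLabelLt (τ.label a, τ.wt a) (τ.label b, τ.wt b)) :
    PLabelLt (simpleSwap i (τ.label a), τ.wt a) (simpleSwap i (τ.label b), τ.wt b) := by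
  rcases hlt with h1 | ⟨h1, h2⟩
  · exact Or.inl h1
  · refine Or.inr ⟨h1, ?_⟩
    simp only at h1 h2 ⊢
    rw [simpleSwap_lt_iff i]
    · exact h2
    · rintro ⟨ea, eb⟩
      have ea' : a = τ.box (lo i) := (Equiv.eq_symm_apply _).2 ea
      have eb' : b = τ.box (hi i) := (Equiv.eq_symm_apply _).2 eb
      unfold Free StrongBefore at h
      rw [← ea', ← eb'] at h
      omega
    · rintro ⟨ea, eb⟩
      rw [ea, eb, Fin.lt_def] at h2
      simp [lo, hi] at h2

/-- The tableau `s_i(τ)`, or `τ` if that is not a tableau. -/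
def sw (τ : PSYT μ) (i : Fin (μ.card - 1)) : PSYT μ :=
  if h : τ.Free i then
    { label := τ.label.trans (simpleSwap i)
      wt := τ.wt
      row_lt := fun a b h₁ h₂ => τ.swap_lt h (Or.inl h₁) (τ.row_lt a b h₁ h₂)
      col_lt := fun a b h₁ h₂ => τ.swap_lt h (Or.inr h₁) (τ.col_lt a b h₁ h₂) }
  else τ

@[simp] theorem sw_wt (τ : PSYT μ) (i : Fin (μ.card - 1)) : (τ.sw i).wt = τ.wt := by
  unfold sw
  split_ifs <;> rfl

theorem sw_label {τ : PSYT μ} {i : Fin (μ.card - 1)} (h : τ.Free i) :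
    (τ.sw i).label = τ.label.trans (simpleSwap i) := by
  unfold sw
  rw [dif_pos h]

theorem sw_box {τ : PSYT μ} {i : Fin (μ.card - 1)} (h : τ.Free i) (x : Fin μ.card) :
    (τ.sw i).box x = τ.box (simpleSwap i x) := by
  rw [box, sw_label h, Equiv.symm_trans_apply, Equiv.symm_swap]

theorem sw_box_lo {τ : PSYT μ} {i : Fin (μ.card - 1)} (h : τ.Free i) :
    (τ.sw i).box (lo i) = τ.box (hi i) := by
  rw [sw_box h, Equiv.swap_apply_left]

theorem sw_box_hi {τ : PSYT μ} {i : Fin (μ.card - 1)} (h : τ.Free i) :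
    (τ.sw i).box (hi i) = τ.box (lo i) := by
  rw [sw_box h, Equiv.swap_apply_right]

theorem Free.sw {τ : PSYT μ} {i : Fin (μ.card - 1)} (h : τ.Free i) : (τ.sw i).Free i := by
  unfold Free
  rw [sw_wt, sw_box_lo h, sw_box_hi h]
  exact h.symm

theorem ext_box {τ σ : PSYT μ} (h : τ.wt = σ.wt) (h' : ∀ x, τ.box x = σ.box x) : τ = σ :=
  PSYT.ext (Equiv.symm_bijective.injective (Equiv.ext h')) h

theorem sw_sw {τ : PSYT μ} {i : Fin (μ.card - 1)} (h : τ.Free i) : (τ.sw i).sw i = τ := by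
  refine ext_box (by simp) fun x => ?_
  rw [sw_box h.sw, sw_box h, Equiv.swap_apply_self]

/-- Exchanging the labels of neighbouring boxes with equal exponents would destroy standardness, so
a legal swap is a swap of boxes related by `StrongBefore`. -/
theorem isSwap_iff {τ σ : PSYT μ} {i : Fin (μ.card - 1)} :
    IsSwap i τ σ ↔ τ.Free i ∧ σ = τ.sw i := by
  constructor
  · rintro ⟨h1, h2⟩
    have hl : σ.label = τ.label.trans (simpleSwap i) := Equiv.ext h2
    have hf : τ.Free i := by
      rcases τ.consecutive i with h | h | ⟨h, h'⟩
      · exact Or.inl h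
      · exact Or.inr h
      · exfalso
        have e1 : σ.label (τ.box (lo i)) = hi i := by simp [hl]
        have e2 : σ.label (τ.box (hi i)) = lo i := by simp [hl]
        have hne : τ.box (lo i) ≠ τ.box (hi i) := fun e => lo_ne_hi i (τ.label.symm.injective e)
        have := σ.label_lt_of_wt_eq (a := τ.box (lo i)) (b := τ.box (hi i)) (by omega) (by omega)
          hne (by rw [h1, h])
        rw [e1, e2, Fin.lt_def] at this
        simp [lo, hi] at this
    exact ⟨hf, PSYT.ext (by rw [hl, sw_label hf]) (by rw [h1, sw_wt])⟩
  · rintro ⟨h, rfl⟩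
    exact ⟨sw_wt _ _, fun b => by rw [sw_label h]; rfl⟩

/-! ### The operation `Ψ` -/

theorem psi_box (τ : PSYT μ) (x : Fin μ.card) : τ.Psi.box x = τ.box (finRotate _ x) := by
  simp [Psi, box]

theorem val_finRotate {n : ℕ} (x : Fin n) :
    (finRotate n x).1 = if x.1 + 1 = n then 0 else x.1 + 1 := by
  have h := val_finRotate_symm (finRotate n x)
  rw [Equiv.symm_apply_apply] at h
  have := (finRotate n x).2
  have := x.2
  split_ifs at h ⊢ <;> omega

theorem psi_box_lt (τ : PSYT μ) {x y : Fin μ.card} (h : x.1 + 1 = y.1) : τ.Psi.box x = τ.box y := by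
  rw [psi_box]
  congr 1
  apply Fin.ext
  have := y.2
  rw [val_finRotate, if_neg (by omega), h]

theorem psi_box_last (τ : PSYT μ) {x y : Fin μ.card} (h : x.1 + 1 = μ.card) (hy : y.1 = 0) :
    τ.Psi.box x = τ.box y := by
  rw [psi_box]
  congr 1
  apply Fin.ext
  rw [val_finRotate, if_pos h, hy]

theorem psi_wt_box (τ : PSYT μ) (x : Fin μ.card) :
    τ.Psi.wt (τ.box x) = τ.wt (τ.box x) + if x.1 = 0 then 1 else 0 := by
  simp [Psi, box]

theorem psi_wt_box_of_ne (τ : PSYT μ) {x : Fin μ.card} (h : x.1 ≠ 0) :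
    τ.Psi.wt (τ.box x) = τ.wt (τ.box x) := by
  rw [psi_wt_box, if_neg h, add_zero]

theorem psi_wt_box_zero (τ : PSYT μ) {x : Fin μ.card} (h : x.1 = 0) :
    τ.Psi.wt (τ.box x) = τ.wt (τ.box x) + 1 := by
  rw [psi_wt_box, if_pos h]

theorem psi_injective : Function.Injective (Psi : PSYT μ → PSYT μ) := by
  intro τ σ h
  have h1 : ∀ x, τ.box x = σ.box x := by
    intro x
    obtain ⟨y, rfl⟩ := (finRotate _).surjective x
    rw [← psi_box, ← psi_box, h]
  refine ext_box (funext fun b => ?_) h1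
  obtain ⟨x, rfl⟩ := τ.label.symm.surjective b
  have h2 : τ.Psi.wt (τ.box x) = σ.Psi.wt (σ.box x) := by rw [h, h1]
  rw [psi_wt_box, psi_wt_box, ← h1 x] at h2
  exact Nat.add_right_cancel h2

theorem psiInv_lt {n : ℕ} {x y : Fin n × ℕ} (h : PLabelLt x y)
    (hx : x.1.1 + 1 = n → 0 < x.2) (hy : y.1.1 + 1 = n → 0 < y.2) :
    PLabelLt (finRotate n x.1, x.2 - if x.1.1 + 1 = n then 1 else 0)
      (finRotate n y.1, y.2 - if y.1.1 + 1 = n then 1 else 0) := by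
  obtain ⟨x, a⟩ := x
  obtain ⟨y, b⟩ := y
  simp only [PLabelLt, Fin.lt_def, val_finRotate] at h hx hy ⊢
  have hx := x.2
  have hy := y.2
  split_ifs <;> omega

theorem exists_psi_eq (τ : PSYT μ) {l : Fin μ.card} (hl : l.1 + 1 = μ.card)
    (h : 0 < τ.wt (τ.box l)) : ∃ σ : PSYT μ, σ.Psi = τ := by
  have hpos : ∀ b, (τ.label b).1 + 1 = μ.card → 0 < τ.wt b := by
    intro b hb
    have : b = τ.box l := (Equiv.eq_symm_apply _).2 (Fin.ext (by omega))
    rwa [this]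
  refine ⟨⟨τ.label.trans (finRotate _),
    fun b => τ.wt b - if (τ.label b).1 + 1 = μ.card then 1 else 0,
    fun a b h₁ h₂ => psiInv_lt (τ.row_lt a b h₁ h₂) (hpos a) (hpos b),
    fun a b h₁ h₂ => psiInv_lt (τ.col_lt a b h₁ h₂) (hpos a) (hpos b)⟩, ?_⟩
  refine PSYT.ext ?_ ?_
  · apply Equiv.ext
    intro b
    exact Equiv.symm_apply_apply _ _
  · funext b
    simp only [Psi, Equiv.trans_apply, val_finRotate]
    have := hpos b
    by_cases hb : (τ.label b).1 + 1 = μ.card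
    · simp only [hb, if_true]
      omega
    · simp [hb]

/-! ### The rank -/

theorem inv_eq_invs (τ : PSYT μ) : Inv τ = invs (StdBefore τ.wt) τ.label := by
  ext p
  rw [mem_invs]
  simp [Inv]

theorem inv_sw {τ : PSYT μ} {i : Fin (μ.card - 1)}
    (h : StrongBefore τ.wt (τ.box (hi i)) (τ.box (lo i))) :
    (τ.box (hi i), τ.box (lo i)) ∉ Inv (τ.sw i) ∧
      Inv τ = insert (τ.box (hi i), τ.box (lo i)) (Inv (τ.sw i)) := by
  have h2 := invs_swap (stdBefore_asymm τ.wt) (L := τ.label) (i := i) h.std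
  rw [inv_eq_invs, inv_eq_invs, sw_label (Or.inr h), sw_wt]
  convert h2

theorem card_inv_sw {τ : PSYT μ} {i : Fin (μ.card - 1)}
    (h : StrongBefore τ.wt (τ.box (hi i)) (τ.box (lo i))) :
    (Inv τ).card = (Inv (τ.sw i)).card + 1 := by
  obtain ⟨h1, h2⟩ := inv_sw h
  rw [h2, Finset.card_insert_of_notMem h1]

theorem card_inv_sw' {τ : PSYT μ} {i : Fin (μ.card - 1)}
    (h : StrongBefore τ.wt (τ.box (lo i)) (τ.box (hi i))) :
    (Inv (τ.sw i)).card = (Inv τ).card + 1 := by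
  have hf : τ.Free i := Or.inl h
  have := card_inv_sw (τ := τ.sw i) (i := i) (by rwa [sw_wt, sw_box_lo hf, sw_box_hi hf])
  rwa [sw_sw hf] at this

/-- A descent for `StdBefore` cannot sit in neighbouring boxes of a row or a column, because there
`StdBefore` agrees with the order that standardness imposes. So it is a legal swap, and one that
removes an inversion. -/
theorem exists_up {τ : PSYT μ} (h : Inv τ ≠ ∅) :
    ∃ i, StrongBefore τ.wt (τ.box (hi i)) (τ.box (lo i)) := by
  rw [inv_eq_invs] at h
  obtain ⟨i, hi'⟩ := exists_descent (stdBefore_asymm τ.wt) (stdBefore_trans τ.wt)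
    (stdBefore_total τ.wt) (Finset.nonempty_iff_ne_empty.2 h)
  refine ⟨i, ?_⟩
  rcases τ.consecutive i with h1 | h1 | h1
  · exact absurd h1.std (stdBefore_asymm _ _ _ hi')
  · exact h1
  · exfalso
    unfold Adjacent at h1
    unfold StdBefore at hi'
    simp only [box] at h1
    omega

/-- As for `exists_up`: `MinBefore` also agrees with standardness on neighbouring boxes, so a
descent is a legal swap, now downwards. -/
theorem exists_down {τ : PSYT μ} (h : invs (MinBefore τ.wt) τ.label ≠ ∅) :
    ∃ i, StrongBefore τ.wt (τ.box (lo i)) (τ.box (hi i)) := by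
  obtain ⟨i, hi'⟩ := exists_descent (minBefore_asymm τ.wt) (minBefore_trans τ.wt)
    (minBefore_total τ.wt) (Finset.nonempty_iff_ne_empty.2 h)
  refine ⟨i, ?_⟩
  rcases τ.consecutive i with h1 | h1 | h1
  · exact h1
  · exact absurd h1.minBefore (minBefore_asymm _ _ _ hi')
  · exfalso
    unfold Adjacent at h1
    unfold MinBefore at hi'
    simp only [box] at h1
    omega

/-- A rank function for the order on periodic standard tableaux. -/
def rk (τ : PSYT μ) : ℕ :=
  (∑ b, τ.wt b) * (Fintype.card (Box μ × Box μ) + 1) +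
    (Fintype.card (Box μ × Box μ) + 1 - (Inv τ).card)

theorem rk_sw_lt {τ : PSYT μ} {i : Fin (μ.card - 1)}
    (h : StrongBefore τ.wt (τ.box (lo i)) (τ.box (hi i))) : (τ.sw i).rk < τ.rk := by
  have h1 := card_inv_sw' h
  have h2 : (Inv (τ.sw i)).card ≤ Fintype.card (Box μ × Box μ) := Finset.card_le_univ _
  unfold rk
  rw [sw_wt]
  omega

theorem sum_psi_wt (τ : PSYT μ) (hn : 0 < μ.card) : ∑ b, τ.Psi.wt b = ∑ b, τ.wt b + 1 := by
  have : ∀ b, τ.Psi.wt b = τ.wt b + if b = τ.box ⟨0, hn⟩ then 1 else 0 := by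
    intro b
    simp only [Psi]
    congr 2
    rw [box, Equiv.eq_symm_apply, Fin.ext_iff]
  rw [Finset.sum_congr rfl fun b _ => this b, Finset.sum_add_distrib]
  simp

/-- The factor of the total exponent in `rk` exceeds every possible number of inversions, so one
more unit of exponent outweighs any change of `Inv`. -/
theorem rk_lt_psi (τ : PSYT μ) (hn : 0 < μ.card) : τ.rk < τ.Psi.rk := by
  have h2 : (Inv τ.Psi).card ≤ Fintype.card (Box μ × Box μ) := Finset.card_le_univ _
  unfold rk
  rw [sum_psi_wt τ hn, Nat.succ_mul]
  omega

theorem cover_sw {τ : PSYT μ} {i : Fin (μ.card - 1)}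
    (h : StrongBefore τ.wt (τ.box (hi i)) (τ.box (lo i))) : Cover τ (τ.sw i) := by
  have hs : IsSwap i τ (τ.sw i) := isSwap_iff.2 ⟨Or.inr h, rfl⟩
  rcases h with h | ⟨h, h1, h2⟩
  · exact .swap_wt i _ _ hs h
  · refine .swap_content i _ _ hs h.symm ?_
    simp only [c, Box.content]
    simp only [box] at h1 h2
    omega

theorem rk_lt_of_cover {τ σ : PSYT μ} (hn : 0 < μ.card) (h : Cover τ σ) : τ.rk < σ.rk := by
  have key : ∀ (i : Fin (μ.card - 1)) (τ σ : PSYT μ), IsSwap i τ σ →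
      StrongBefore τ.wt (τ.box (hi i)) (τ.box (lo i)) → τ.rk < σ.rk := by
    intro i τ σ hs h
    obtain ⟨hf, rfl⟩ := isSwap_iff.1 hs
    have := rk_sw_lt (τ := τ.sw i) (i := i) (by rwa [sw_wt, sw_box_lo hf, sw_box_hi hf])
    rwa [sw_sw hf] at this
  cases h with
  | psi => exact rk_lt_psi τ hn
  | swap_wt i _ _ hs hw => exact key i _ _ hs (Or.inl hw)
  | swap_content i _ _ hs hw hc =>
    obtain ⟨hf, rfl⟩ := isSwap_iff.1 hs
    refine key i _ _ hs ?_
    rcases hf with hf | hf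
    · exfalso
      unfold StrongBefore at hf
      unfold w at hw
      simp only [c, Box.content] at hc
      simp only [box] at hf
      omega
    · exact hf

theorem rk_lt_of_lt {τ σ : PSYT μ} (hn : 0 < μ.card) (h : Lt τ σ) : τ.rk < σ.rk := by
  induction h with
  | single h => exact rk_lt_of_cover hn h
  | tail _ h ih => exact ih.trans (rk_lt_of_cover hn h)

theorem rk_le_of_le {τ σ : PSYT μ} (hn : 0 < μ.card) (h : Le τ σ) : τ.rk ≤ σ.rk := by
  induction h with
  | refl => exact le_rfl
  | tail _ h ih => exact ih.trans (rk_lt_of_cover hn h).le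

theorem le_antisymm' {τ σ : PSYT μ} (hn : 0 < μ.card) (h : Le τ σ) (h' : Le σ τ) : τ = σ := by
  rcases Relation.reflTransGen_iff_eq_or_transGen.1 h with e | h1
  · exact e.symm
  · have := rk_lt_of_lt hn h1
    have := rk_le_of_le hn h'
    omega

/-- The order is generated by `Psi` as well as by swaps. The rank grows along every cover, so a swap
that lowers the rank cannot go up by some other chain. -/
theorem isSwap_lt_iff {τ σ : PSYT μ} {i : Fin (μ.card - 1)} (hn : 0 < μ.card) :
    IsSwap i τ σ ∧ Lt τ σ ↔
      StrongBefore τ.wt (τ.box (hi i)) (τ.box (lo i)) ∧ σ = τ.sw i := by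
  constructor
  · rintro ⟨h1, h2⟩
    obtain ⟨hf, rfl⟩ := isSwap_iff.1 h1
    refine ⟨?_, rfl⟩
    rcases hf with hf | hf
    · have := rk_sw_lt hf
      have := rk_lt_of_lt hn h2
      omega
    · exact hf
  · rintro ⟨h, rfl⟩
    exact ⟨isSwap_iff.2 ⟨Or.inr h, rfl⟩, .single (cover_sw h)⟩

/-! ### Least and greatest elements -/

theorem exists_le_top (τ : PSYT μ) : ∃ σ : PSYT μ, σ.wt = τ.wt ∧ Le τ σ ∧ Inv σ = ∅ := by
  obtain ⟨m, hm⟩ : ∃ m, (Inv τ).card = m := ⟨_, rfl⟩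
  induction m generalizing τ with
  | zero => exact ⟨τ, rfl, .refl, Finset.card_eq_zero.1 hm⟩
  | succ m ih =>
    obtain ⟨i, hi'⟩ := exists_up (τ := τ) (fun e => by rw [e] at hm; simp at hm)
    have := card_inv_sw hi'
    obtain ⟨σ, h1, h2, h3⟩ := ih (τ.sw i) (by omega)
    exact ⟨σ, by rw [h1, sw_wt], .head (cover_sw hi') h2, h3⟩

theorem exists_min_le (τ : PSYT μ) :
    ∃ σ : PSYT μ, σ.wt = τ.wt ∧ Le σ τ ∧ invs (MinBefore σ.wt) σ.label = ∅ := by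
  obtain ⟨m, hm⟩ : ∃ m, τ.rk = m := ⟨_, rfl⟩
  induction m using Nat.strong_induction_on generalizing τ with
  | _ m ih =>
    by_cases h : invs (MinBefore τ.wt) τ.label = ∅
    · exact ⟨τ, rfl, .refl, h⟩
    · obtain ⟨i, hi'⟩ := exists_down h
      have hf : τ.Free i := Or.inl hi'
      obtain ⟨σ, h1, h2, h3⟩ := ih _ (hm ▸ rk_sw_lt hi') (τ.sw i) rfl
      refine ⟨σ, by rw [h1, sw_wt], h2.tail ?_, h3⟩
      have := cover_sw (τ := τ.sw i) (i := i) (by rwa [sw_wt, sw_box_lo hf, sw_box_hi hf])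
      rwa [sw_sw hf] at this

theorem eq_of_inv_empty {τ σ : PSYT μ} (hw : τ.wt = σ.wt) (h : Inv τ = ∅) (h' : Inv σ = ∅) :
    τ = σ := by
  rw [inv_eq_invs] at h h'
  rw [← hw] at h'
  exact PSYT.ext (eq_of_invs_eq_empty (stdBefore_total τ.wt) h h') hw

theorem eq_of_min_empty {τ σ : PSYT μ} (hw : τ.wt = σ.wt) (h : invs (MinBefore τ.wt) τ.label = ∅)
    (h' : invs (MinBefore σ.wt) σ.label = ∅) : τ = σ := by
  rw [← hw] at h'
  exact PSYT.ext (eq_of_invs_eq_empty (minBefore_total τ.wt) h h') hw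

/-- All tableaux with the same exponents climb to the same one, since there is only one without
inversions. It is therefore greatest, and antisymmetry of the order identifies it with the choice in
`topT`. -/
theorem topT_spec (τ : PSYT μ) (hn : 0 < μ.card) :
    (topT τ.wt).wt = τ.wt ∧ Inv (topT τ.wt) = ∅ := by
  obtain ⟨σ, h1, h2, h3⟩ := τ.exists_le_top
  have hσ : σ.wt = τ.wt ∧ ∀ ρ : PSYT μ, ρ.wt = τ.wt → Le ρ σ := by
    refine ⟨h1, fun ρ hρ => ?_⟩
    obtain ⟨σ', g1, g2, g3⟩ := ρ.exists_le_top
    rwa [eq_of_inv_empty (by rw [g1, hρ, h1]) g3 h3] at g2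
  have hs : (topT τ.wt).wt = τ.wt ∧ ∀ ρ : PSYT μ, ρ.wt = τ.wt → Le ρ (topT τ.wt) :=
    Classical.epsilon_spec (p := fun σ : PSYT μ => σ.wt = τ.wt ∧ ∀ ρ : PSYT μ, ρ.wt = τ.wt → Le ρ σ)
      ⟨σ, hσ⟩
  have e := le_antisymm' hn (hσ.2 _ hs.1) (hs.2 _ hσ.1)
  exact ⟨hs.1, by rw [e, h3]⟩

/-- Dually, downward swaps end at the only tableau that follows `MinBefore`. -/
theorem minT_spec (τ : PSYT μ) (hn : 0 < μ.card) :
    (minT τ.wt).wt = τ.wt ∧ invs (MinBefore τ.wt) (minT τ.wt).label = ∅ := by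
  obtain ⟨σ, h1, h2, h3⟩ := τ.exists_min_le
  have hσ : σ.wt = τ.wt ∧ ∀ ρ : PSYT μ, ρ.wt = τ.wt → Le σ ρ := by
    refine ⟨h1, fun ρ hρ => ?_⟩
    obtain ⟨σ', g1, g2, g3⟩ := ρ.exists_min_le
    rwa [eq_of_min_empty (by rw [g1, hρ, h1]) g3 h3] at g2
  have hs : (minT τ.wt).wt = τ.wt ∧ ∀ ρ : PSYT μ, ρ.wt = τ.wt → Le (minT τ.wt) ρ :=
    Classical.epsilon_spec (p := fun σ : PSYT μ => σ.wt = τ.wt ∧ ∀ ρ : PSYT μ, ρ.wt = τ.wt → Le σ ρ)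
      ⟨σ, hσ⟩
  have e := le_antisymm' hn (hs.2 _ hσ.1) (hσ.2 _ hs.1)
  exact ⟨hs.1, by rw [e, ← h1]; exact h3⟩

theorem exists_labelling {n : ℕ} {B : Type*} [Fintype B] {R : B → B → Prop}
    (hR : ∀ a b, R a b → ¬R b a)
    (htr : ∀ a b c, R a b → R b c → R a c) (htot : ∀ a b, a ≠ b → R a b ∨ R b a)
    (L : B ≃ Fin n) : ∃ L' : B ≃ Fin n, invs R L' = ∅ := by
  obtain ⟨m, hm⟩ : ∃ m, (invs R L).card = m := ⟨_, rfl⟩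
  induction m generalizing L with
  | zero => exact ⟨L, Finset.card_eq_zero.1 hm⟩
  | succ m ih =>
    obtain ⟨i, hi'⟩ := exists_descent hR htr htot (L := L)
      (Finset.card_pos.1 (by omega))
    have := card_invs_swap hR hi'
    exact ih (L.trans (simpleSwap i)) (by omega)

theorem exists_of_isRSSYT {T : Box μ → ℕ} (hT : IsRSSYT T) : ∃ τ : PSYT μ, τ.wt = T := by
  obtain ⟨L, hL⟩ := exists_labelling (stdBefore_asymm T) (stdBefore_trans T) (stdBefore_total T)
    (Classical.arbitrary (PSYT μ)).label
  have key : ∀ a b, StdBefore T a b → L a < L b := by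
    intro a b h
    by_contra hcon
    have hne : a ≠ b := fun e => by subst e; exact stdBefore_asymm _ _ _ h h
    have : (a, b) ∈ invs (StdBefore T) L :=
      mem_invs.2 ⟨h, lt_of_le_of_ne (not_lt.1 hcon) fun e => hne (L.injective e).symm⟩
    rw [hL] at this
    simp at this
  refine ⟨⟨L, T, fun a b h₁ h₂ => ?_, fun a b h₁ h₂ => Or.inl (hT.2 a b h₁ h₂)⟩, rfl⟩
  rcases (hT.1 a b h₁ h₂).lt_or_eq with h | h
  · exact Or.inl h
  · exact Or.inr ⟨h.symm, key a b (Or.inr ⟨h.symm, Or.inl h₂⟩)⟩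

end PSYT

end

end VVMacdonald

/-! ### Swaps against Ψ, and the construction of the vectors F_τ. -/

namespace VVMacdonald

noncomputable section

open Classical TensorProduct

variable {μ : YoungDiagram}

/-! ### Swaps and `Ψ` -/

namespace PSYT

theorem rot_swap {n : ℕ} {i j : Fin (n - 1)} (h : i.1 + 1 = j.1) (x : Fin n) :
    finRotate n (simpleSwap i x) = simpleSwap j (finRotate n x) := by
  apply Fin.ext
  have := x.2
  have := j.2
  have h1 := val_simpleSwap i x
  have h2 := val_finRotate x
  have h3 := val_finRotate (simpleSwap i x)
  have h4 := val_simpleSwap j (finRotate n x)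
  generalize (simpleSwap j (finRotate n x)).1 = a4 at *
  generalize (finRotate n (simpleSwap i x)).1 = a3 at *
  generalize (finRotate n x).1 = a2 at *
  generalize (simpleSwap i x).1 = a1 at *
  split_ifs at h1 <;> split_ifs at h2 <;> split_ifs at h3 <;> split_ifs at h4 <;> omega

theorem rot_rot_swap {n : ℕ} {l z : Fin (n - 1)} (hl : l.1 + 1 = n - 1) (hz : z.1 = 0)
    (x : Fin n) :
    finRotate n (finRotate n (simpleSwap l x)) = simpleSwap z (finRotate n (finRotate n x)) := by
  apply Fin.ext
  have := x.2
  have h1 := val_simpleSwap l x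
  have h2 := val_finRotate x
  have h3 := val_finRotate (simpleSwap l x)
  have h4 := val_finRotate (finRotate n x)
  have h5 := val_finRotate (finRotate n (simpleSwap l x))
  have h6 := val_simpleSwap z (finRotate n (finRotate n x))
  rw [hz] at h6
  generalize (simpleSwap z (finRotate n (finRotate n x))).1 = a6 at *
  generalize (finRotate n (finRotate n (simpleSwap l x))).1 = a5 at *
  generalize (finRotate n (finRotate n x)).1 = a4 at *
  generalize (finRotate n (simpleSwap l x)).1 = a3 at *
  generalize (finRotate n x).1 = a2 at *
  generalize (simpleSwap l x).1 = a1 at *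
  split_ifs at h1 <;> split_ifs at h2 <;> split_ifs at h3 <;> split_ifs at h4 <;>
    split_ifs at h5 <;> split_ifs at h6 <;> omega

theorem psi_box_lo (σ : PSYT μ) {i j : Fin (μ.card - 1)} (h : i.1 + 1 = j.1) :
    σ.Psi.box (lo i) = σ.box (lo j) := σ.psi_box_lt h

theorem psi_box_hi (σ : PSYT μ) {i j : Fin (μ.card - 1)} (h : i.1 + 1 = j.1) :
    σ.Psi.box (hi i) = σ.box (hi j) := σ.psi_box_lt (by simp [hi, h])

theorem psi_wt_lo (σ : PSYT μ) {i j : Fin (μ.card - 1)} (h : i.1 + 1 = j.1) :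
    σ.Psi.wt (σ.box (lo j)) = σ.wt (σ.box (lo j)) :=
  σ.psi_wt_box_of_ne (by simp only [lo]; omega)

theorem psi_wt_hi (σ : PSYT μ) (j : Fin (μ.card - 1)) :
    σ.Psi.wt (σ.box (hi j)) = σ.wt (σ.box (hi j)) :=
  σ.psi_wt_box_of_ne (by simp only [hi]; omega)

/-- Neither label `lo j` nor `hi j` is the first one, so Ψ only lowers both by one and leaves their
exponents alone. -/
theorem psi_sw {σ : PSYT μ} {i j : Fin (μ.card - 1)} (h : i.1 + 1 = j.1) (hf : σ.Free j) :
    σ.Psi.Free i ∧ σ.Psi.sw i = (σ.sw j).Psi := by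
  have hf' : σ.Psi.Free i := by
    unfold Free StrongBefore at *
    rwa [psi_box_lo σ h, psi_box_hi σ h, psi_wt_lo σ h, psi_wt_hi σ]
  refine ⟨hf', ext_box ?_ fun x => ?_⟩
  · rw [sw_wt]
    funext b
    simp only [Psi, sw_wt, sw_label hf, Equiv.trans_apply, val_simpleSwap]
    congr 1
    split_ifs <;> omega
  · rw [sw_box hf', psi_box, psi_box, sw_box hf, rot_swap h]

theorem psi_psi_box_lo (ρ : PSYT μ) {l z : Fin (μ.card - 1)} (hl : l.1 + 1 = μ.card - 1)
    (hz : z.1 = 0) : ρ.Psi.Psi.box (lo l) = ρ.box (lo z) := by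
  rw [psi_box_lt _ (x := lo l) (y := hi l) rfl,
    psi_box_last ρ (x := hi l) (y := lo z) (by simp only [hi]; omega) hz]

theorem psi_psi_box_hi (ρ : PSYT μ) {l z : Fin (μ.card - 1)} (hl : l.1 + 1 = μ.card - 1)
    (hz : z.1 = 0) : ρ.Psi.Psi.box (hi l) = ρ.box (hi z) := by
  rw [psi_box_last _ (x := hi l) (y := lo z) (by simp only [hi]; omega) hz,
    psi_box_lt ρ (x := lo z) (y := hi z) rfl]

theorem psi_psi_wt_lo (ρ : PSYT μ) {z : Fin (μ.card - 1)}
    (hz : z.1 = 0) : ρ.Psi.Psi.wt (ρ.box (lo z)) = ρ.wt (ρ.box (lo z)) + 1 := by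
  have e : ρ.box (lo z) = ρ.Psi.box ⟨μ.card - 1, by have := z.2; omega⟩ :=
    (psi_box_last ρ (by simp only; have := z.2; omega) hz).symm
  rw [e, psi_wt_box_of_ne _ (by simp only; have := z.2; omega), ← e, psi_wt_box_zero _ hz]

theorem psi_psi_wt_hi (ρ : PSYT μ) {z : Fin (μ.card - 1)}
    (hz : z.1 = 0) : ρ.Psi.Psi.wt (ρ.box (hi z)) = ρ.wt (ρ.box (hi z)) + 1 := by
  have e : ρ.box (hi z) = ρ.Psi.box (lo z) := (psi_box_lt ρ rfl).symm
  rw [e, psi_wt_box_zero _ hz, ← e, psi_wt_hi]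

/-- The first two labels become the last two after two rotations. Both exponents have then grown by
one, so their comparison is unchanged. -/
theorem psi_psi_sw {ρ : PSYT μ} {l z : Fin (μ.card - 1)} (hl : l.1 + 1 = μ.card - 1)
    (hz : z.1 = 0) (hf : ρ.Free z) :
    ρ.Psi.Psi.Free l ∧ ρ.Psi.Psi.sw l = (ρ.sw z).Psi.Psi := by
  have hf' : ρ.Psi.Psi.Free l := by
    unfold Free StrongBefore at *
    rw [psi_psi_box_lo ρ hl hz, psi_psi_box_hi ρ hl hz, psi_psi_wt_lo ρ hz, psi_psi_wt_hi ρ hz]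
    omega
  refine ⟨hf', ext_box ?_ fun x => ?_⟩
  · rw [sw_wt]
    funext b
    simp only [Psi, sw_wt, sw_label hf, Equiv.trans_apply, val_simpleSwap, val_finRotate_symm, hz]
    have := z.2
    have := (ρ.label b).2
    split_ifs <;> omega
  · rw [sw_box hf', psi_box, psi_box, psi_box, psi_box, sw_box hf, rot_rot_swap hl hz]

/-- How a tableau arises from smaller ones. -/
theorem predecessor (τ : PSYT μ) (hn : 0 < μ.card) :
    (∀ b, τ.wt b = 0) ∨ (∃ σ : PSYT μ, σ.Psi = τ) ∨
      ∃ i : Fin (μ.card - 1), τ.wt (τ.box (hi i)) < τ.wt (τ.box (lo i)) := by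
  let l : Fin μ.card := ⟨μ.card - 1, by omega⟩
  by_cases h1 : 0 < τ.wt (τ.box l)
  · exact Or.inr (Or.inl (τ.exists_psi_eq (by simp only [l]; omega) h1))
  by_cases h2 : ∃ i : Fin (μ.card - 1), τ.wt (τ.box (hi i)) < τ.wt (τ.box (lo i))
  · exact Or.inr (Or.inr h2)
  left
  push Not at h1 h2
  -- The exponents are weakly increasing in the label and the last one is zero, so all vanish.
  have key : ∀ k (x : Fin μ.card), x.1 + k = μ.card - 1 → τ.wt (τ.box x) = 0 := by
    intro k
    induction k with
    | zero =>
      intro x hx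
      have : x = l := Fin.ext (by simpa using hx)
      rw [this]
      omega
    | succ k ih =>
      intro x hx
      have h3 := h2 ⟨x.1, by omega⟩
      have h4 := ih (hi ⟨x.1, by omega⟩) (by simp only [hi]; omega)
      rw [h4] at h3
      exact Nat.le_zero.1 h3
  intro b
  have := key (μ.card - 1 - (τ.label b).1) (τ.label b) (by have := (τ.label b).2; omega)
  simpa [box] using this

end PSYT

/-! ### Operators -/

/-- The coefficient that belongs to two weights in the intertwiners. -/
def swapCoeff (T : Box μ → ℕ) (a b : Box μ) : K :=
  (t - 1) * boxWeight T b / (boxWeight T a - boxWeight T b)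

theorem generic_coeff {k : Type*} [Field k] {a b c s : k} (h1 : c - b ≠ 0) (h2 : b - a ≠ 0)
    (h3 : c - a ≠ 0) :
    ((s - 1) * b / (c - b)) * ((s - 1) * a / (b - a)) =
      ((s - 1) * a / (c - a)) * ((s - 1) * b / (c - b) + (s - 1) * a / (b - a) + s - 1) := by
  field_simp
  ring

/-- This is the hypothesis `hxyz` of `yang_baxter` for three boxes with distinct weights. -/
theorem swapCoeff_ybe {T : Box μ → ℕ} {a b c : Box μ} (h1 : boxWeight T c ≠ boxWeight T b)
    (h2 : boxWeight T b ≠ boxWeight T a) (h3 : boxWeight T c ≠ boxWeight T a) :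
    swapCoeff T c b * swapCoeff T b a =
      swapCoeff T c a * (swapCoeff T c b + swapCoeff T b a + t - 1) :=
  generic_coeff (sub_ne_zero.2 h1) (sub_ne_zero.2 h2) (sub_ne_zero.2 h3)

theorem swapCoeff_congr {T T' : Box μ → ℕ} {a b : Box μ} (h1 : T a = T' a) (h2 : T b = T' b) :
    swapCoeff T a b = swapCoeff T' a b := by
  simp only [swapCoeff, boxWeight, h1, h2]

theorem swapCoeff_shift {T T' : Box μ → ℕ} {a b : Box μ} (h1 : T a = T' a + 1)
    (h2 : T b = T' b + 1) : swapCoeff T a b = swapCoeff T' a b := by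
  have e1 : boxWeight T a = q * boxWeight T' a := by simp only [boxWeight, h1, pow_succ]; ring
  have e2 : boxWeight T b = q * boxWeight T' b := by simp only [boxWeight, h2, pow_succ]; ring
  rw [swapCoeff, swapCoeff, e1, e2, ← mul_sub, mul_left_comm, mul_div_mul_left _ _ q_ne_zero]

section Family

set_option linter.unusedSectionVars false

variable {R : Type*} [Ring R] [Algebra K R] {T : Fin (μ.card - 1) → R} {θ X : Fin μ.card → R}
  {M : Type*} [AddCommGroup M] [Module K M] [Module R M] [IsScalarTower K R M]

variable (T) in
/-- The operator `t T_i⁻¹ + x`. -/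
def opB (i : Fin (μ.card - 1)) (x : K) : R := opA T i + x • (1 : R)

theorem opB_smul (i : Fin (μ.card - 1)) (x : K) (m : M) :
    opB T i x • m = opA T i • m + x • m := by
  rw [opB, add_smul, smul_assoc, one_smul]

theorem opB_comm (hT : ∀ a b, HeckeRel T a b → a = b) {i j : Fin (μ.card - 1)}
    (h : i.1 + 1 < j.1 ∨ j.1 + 1 < i.1) (x y : K) : opB T i x * opB T j y = opB T j y * opB T i x := by
  have hc : Commute (opA T i) (opA T j) := by
    rcases h with h | h
    · exact opA_comm hT h
    · exact (opA_comm hT h).symm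
  have := (hc.add_right ((Commute.one_right (opA T i)).smul_right y)).add_left
    (((Commute.one_left (opA T j + y • (1 : R)))).smul_left x)
  exact this

theorem opB_mul_opY (h : ∀ a b, DoubleRel T θ X a b → a = b) (hn : 0 < μ.card)
    {i j : Fin (μ.card - 1)} (hij : i.1 + 1 = j.1) (x : K) :
    opB T i x * opY T X hn = opY T X hn * opB T j x := by
  simp only [opB, opA_eq, add_mul, mul_add, smul_mul_assoc, mul_smul_comm, one_mul, mul_one,
    T_mul_opY h hn hij]

theorem opB_mul_opY_sq (h : ∀ a b, DoubleRel T θ X a b → a = b) (hn : 0 < μ.card)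
    {l z : Fin (μ.card - 1)} (hl : l.1 + 1 = μ.card - 1) (hz : z.1 = 0) (x : K) :
    opB T l x * (opY T X hn * opY T X hn) = opY T X hn * opY T X hn * opB T z x := by
  simp only [opB, opA_eq, add_mul, mul_add, smul_mul_assoc, mul_smul_comm, one_mul, mul_one,
    T_last_mul_opY_sq h hn hl hz]

variable (T X) in
/-- A family of vectors that is related by the intertwiners. -/
structure IsFamily (hn : 0 < μ.card) (F : PSYT μ → M) : Prop where
  up : ∀ (τ : PSYT μ) (i : Fin (μ.card - 1)),
    StrongBefore τ.wt (τ.box (hi i)) (τ.box (lo i)) →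
    F (τ.sw i) = opB T i (swapCoeff τ.wt (τ.box (lo i)) (τ.box (hi i))) • F τ
  psi : ∀ τ : PSYT μ, F τ.Psi = (t ^ τ.c ⟨0, hn⟩)⁻¹ • (opY T X hn • F τ)

/-- The up relation, seen from above. -/
theorem IsFamily.down {hn : 0 < μ.card} {F : PSYT μ → M} (hF : IsFamily T X hn F) {τ : PSYT μ}
    {i : Fin (μ.card - 1)} (h : StrongBefore τ.wt (τ.box (lo i)) (τ.box (hi i))) :
    F τ = opB T i (swapCoeff τ.wt (τ.box (hi i)) (τ.box (lo i))) • F (τ.sw i) := by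
  have hf : τ.Free i := Or.inl h
  have := hF.up (τ.sw i) i
  rw [PSYT.sw_wt, PSYT.sw_box_lo hf, PSYT.sw_box_hi hf, PSYT.sw_sw hf] at this
  exact this h

/-- By `exists_family` it suffices to compare two last steps that lead to the same tableau. Two
distant swaps commute, and two neighbouring ones satisfy the Yang–Baxter equation. A swap and a Ψ
are exchanged through Y, or through Y² when the swap involves the two largest labels. Two Ψ steps
coincide because Ψ is injective, and a Ψ step never ends in a standard tableau. On standard tableaux
the swaps are consistent by `hv`. -/
theorem exists_isFamily (h : ∀ a b, DoubleRel T θ X a b → a = b) (hn : 0 < μ.card)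
    (v : SYT μ → M)
    (hv : ∀ (τ σ : SYT μ) (i : Fin (μ.card - 1)),
      StrongBefore τ.1.wt (τ.1.box (hi i)) (τ.1.box (lo i)) → σ.1 = τ.1.sw i →
      v σ = opB T i (swapCoeff τ.1.wt (τ.1.box (lo i)) (τ.1.box (hi i))) • v τ) :
    ∃ F : PSYT μ → M, IsFamily T X hn F ∧ ∀ τ : SYT μ, F τ.1 = v τ := by
  have hT := DoubleRel.toHecke h
  let E : PSYT μ → ((PSYT μ → M) → M) → Prop := fun τ f =>
    (∃ h : ∀ b, τ.wt b = 0, f = fun _ => v ⟨τ, h⟩) ∨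
    (∃ i : Fin (μ.card - 1), StrongBefore τ.wt (τ.box (lo i)) (τ.box (hi i)) ∧
      f = fun F => opB T i (swapCoeff τ.wt (τ.box (hi i)) (τ.box (lo i))) • F (τ.sw i)) ∨
    (∃ σ : PSYT μ, σ.Psi = τ ∧ f = fun F => (t ^ σ.c ⟨0, hn⟩)⁻¹ • (opY T X hn • F σ))
  suffices hex : ∃ F : PSYT μ → M, ∀ τ f, E τ f → F τ = f F by
    obtain ⟨F, hF⟩ := hex
    refine ⟨F, ⟨fun τ i hi' => ?_, fun τ => hF _ _ (Or.inr (Or.inr ⟨τ, rfl, rfl⟩))⟩,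
      fun τ => hF _ _ (Or.inl ⟨τ.2, rfl⟩)⟩
    have hf : τ.Free i := Or.inr hi'
    have := hF (τ.sw i) _ (Or.inr (Or.inl ⟨i, by rwa [PSYT.sw_wt, PSYT.sw_box_lo hf,
      PSYT.sw_box_hi hf], rfl⟩))
    simp only [PSYT.sw_wt, PSYT.sw_box_lo hf, PSYT.sw_box_hi hf, PSYT.sw_sw hf] at this
    exact this
  refine exists_family PSYT.rk E ?_ ?_
  · rintro τ f (⟨_, rfl⟩ | ⟨i, hi', rfl⟩ | ⟨σ, rfl, rfl⟩) F G hFG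
    · rfl
    · simp only
      rw [hFG _ (PSYT.rk_sw_lt hi')]
    · simp only
      rw [hFG _ (PSYT.rk_lt_psi σ hn)]
  · intro τ F hF
    have stepB : ∀ (ρ : PSYT μ) (i : Fin (μ.card - 1)), ρ.rk < τ.rk →
        StrongBefore ρ.wt (ρ.box (lo i)) (ρ.box (hi i)) →
        F ρ = opB T i (swapCoeff ρ.wt (ρ.box (hi i)) (ρ.box (lo i))) • F (ρ.sw i) :=
      fun ρ i h1 h2 => hF ρ _ h1 (Or.inr (Or.inl ⟨i, h2, rfl⟩))
    have stepP : ∀ ρ : PSYT μ, ρ.Psi.rk < τ.rk →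
        F ρ.Psi = (t ^ ρ.c ⟨0, hn⟩)⁻¹ • (opY T X hn • F ρ) :=
      fun ρ h1 => hF _ _ h1 (Or.inr (Or.inr ⟨ρ, rfl, rfl⟩))
    have pairBB : ∀ i j : Fin (μ.card - 1), i.1 < j.1 →
        StrongBefore τ.wt (τ.box (lo i)) (τ.box (hi i)) →
        StrongBefore τ.wt (τ.box (lo j)) (τ.box (hi j)) →
        opB T i (swapCoeff τ.wt (τ.box (hi i)) (τ.box (lo i))) • F (τ.sw i) =
        opB T j (swapCoeff τ.wt (τ.box (hi j)) (τ.box (lo j))) • F (τ.sw j) := by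
      intro i j hij h1 h2
      have fi : τ.Free i := Or.inl h1
      have fj : τ.Free j := Or.inl h2
      have r1 := PSYT.rk_sw_lt h1
      have r2 := PSYT.rk_sw_lt h2
      rcases Nat.lt_or_ge (i.1 + 1) j.1 with hd | hd
      · have f1 : simpleSwap i (hi j) = hi j :=
          simpleSwap_of_ne (by simp [hi]; omega) (by simp [hi]; omega)
        have f2 : simpleSwap i (lo j) = lo j :=
          simpleSwap_of_ne (by simp [lo]; omega) (by simp [lo]; omega)
        have f3 : simpleSwap j (hi i) = hi i :=
          simpleSwap_of_ne (by simp [hi]; omega) (by simp [hi]; omega)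
        have f4 : simpleSwap j (lo i) = lo i :=
          simpleSwap_of_ne (by simp [lo]; omega) (by simp [lo]; omega)
        have b1 : (τ.sw i).box (lo j) = τ.box (lo j) := by rw [PSYT.sw_box fi, f2]
        have b2 : (τ.sw i).box (hi j) = τ.box (hi j) := by rw [PSYT.sw_box fi, f1]
        have b3 : (τ.sw j).box (lo i) = τ.box (lo i) := by rw [PSYT.sw_box fj, f4]
        have b4 : (τ.sw j).box (hi i) = τ.box (hi i) := by rw [PSYT.sw_box fj, f3]
        have g1 : StrongBefore (τ.sw i).wt ((τ.sw i).box (lo j)) ((τ.sw i).box (hi j)) := by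
          rwa [PSYT.sw_wt, b1, b2]
        have g2 : StrongBefore (τ.sw j).wt ((τ.sw j).box (lo i)) ((τ.sw j).box (hi i)) := by
          rwa [PSYT.sw_wt, b3, b4]
        have e : (τ.sw i).sw j = (τ.sw j).sw i := by
          refine PSYT.ext_box (by simp) fun x => ?_
          rw [PSYT.sw_box (Or.inl g1), PSYT.sw_box (Or.inl g2), PSYT.sw_box fi, PSYT.sw_box fj]
          congr 1
          exact Equiv.congr_fun (simpleSwap_comm hd) x
        rw [stepB _ j r1 g1, stepB _ i r2 g2, e, b1, b2, b3, b4, PSYT.sw_wt, PSYT.sw_wt, ← mul_smul,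
          ← mul_smul, opB_comm hT (Or.inl hd)]
      · have hij' : i.1 + 1 = j.1 := by omega
        have elo : lo j = hi i := Fin.ext (by simp [lo, hi, hij'])
        have f1 : simpleSwap i (hi j) = hi j :=
          simpleSwap_of_ne (by simp [hi]; omega) (by simp [hi]; omega)
        have f2 : simpleSwap j (lo i) = lo i :=
          simpleSwap_of_ne (by simp [lo]; omega) (by simp [lo]; omega)
        have g1 : simpleSwap i (hi i) = lo i := Equiv.swap_apply_right _ _
        have g2 : simpleSwap i (lo i) = hi i := Equiv.swap_apply_left _ _
        have g3 : simpleSwap j (hi i) = hi j := by rw [← elo]; exact Equiv.swap_apply_left _ _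
        have g4 : simpleSwap j (hi j) = hi i := by rw [← elo]; exact Equiv.swap_apply_right _ _
        rw [elo] at h2 ⊢
        have h12 := h1.trans h2
        have k1 : StrongBefore (τ.sw i).wt ((τ.sw i).box (lo j)) ((τ.sw i).box (hi j)) := by
          simpa only [PSYT.sw_wt, PSYT.sw_box fi, elo, g1, f1] using h12
        have fk1 : (τ.sw i).Free j := Or.inl k1
        have k2 : StrongBefore ((τ.sw i).sw j).wt (((τ.sw i).sw j).box (lo i))
            (((τ.sw i).sw j).box (hi i)) := by
          simpa only [PSYT.sw_wt, PSYT.sw_box fk1, PSYT.sw_box fi, f2, g2, g3, f1] using h2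
        have fk2 : ((τ.sw i).sw j).Free i := Or.inl k2
        have m1 : StrongBefore (τ.sw j).wt ((τ.sw j).box (lo i)) ((τ.sw j).box (hi i)) := by
          simpa only [PSYT.sw_wt, PSYT.sw_box fj, f2, g3] using h12
        have fm1 : (τ.sw j).Free i := Or.inl m1
        have m2 : StrongBefore ((τ.sw j).sw i).wt (((τ.sw j).sw i).box (lo j))
            (((τ.sw j).sw i).box (hi j)) := by
          simpa only [PSYT.sw_wt, PSYT.sw_box fm1, PSYT.sw_box fj, elo, f1, g1, g4, f2] using h1
        have fm2 : ((τ.sw j).sw i).Free j := Or.inl m2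
        have e : ((τ.sw i).sw j).sw i = ((τ.sw j).sw i).sw j := by
          refine PSYT.ext_box (by simp) fun x => ?_
          rw [PSYT.sw_box fk2, PSYT.sw_box fk1, PSYT.sw_box fi, PSYT.sw_box fm2, PSYT.sw_box fm1,
            PSYT.sw_box fj]
          congr 1
          exact Equiv.congr_fun (simpleSwap_braid hij') x
        have q1 := PSYT.rk_sw_lt k1
        have q2 := PSYT.rk_sw_lt m1
        rw [stepB _ j r1 k1, stepB _ i (by omega) k2, stepB _ i r2 m1, stepB _ j (by omega) m2, e]
        simp only [PSYT.sw_wt, PSYT.sw_box fk1, PSYT.sw_box fi, PSYT.sw_box fm1, PSYT.sw_box fj,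
          elo, f1, f2, g1, g2, g3, g4, ← mul_smul, ← mul_assoc]
        congr 1
        exact yang_baxter hT hij' (swapCoeff_ybe h2.weight_ne.symm h1.weight_ne.symm
          h12.weight_ne.symm)
    have pairBP : ∀ (i : Fin (μ.card - 1)) (σ : PSYT μ), σ.Psi = τ →
        StrongBefore τ.wt (τ.box (lo i)) (τ.box (hi i)) →
        opB T i (swapCoeff τ.wt (τ.box (hi i)) (τ.box (lo i))) • F (τ.sw i) =
          (t ^ σ.c ⟨0, hn⟩)⁻¹ • (opY T X hn • F σ) := by
      rintro i σ rfl h1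
      have r0 := PSYT.rk_lt_psi σ hn
      have r1 := PSYT.rk_sw_lt h1
      rcases Nat.lt_or_ge (i.1 + 1) (μ.card - 1) with hd | hd
      · let j : Fin (μ.card - 1) := ⟨i.1 + 1, hd⟩
        have hij : i.1 + 1 = j.1 := rfl
        have h2 : StrongBefore σ.wt (σ.box (lo j)) (σ.box (hi j)) := by
          unfold StrongBefore at *
          rwa [σ.psi_box_lo hij, σ.psi_box_hi hij, σ.psi_wt_lo hij, σ.psi_wt_hi] at h1
        obtain ⟨-, e⟩ := PSYT.psi_sw hij (Or.inl h2)
        have ec : (σ.sw j).c ⟨0, hn⟩ = σ.c ⟨0, hn⟩ := by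
          change ((σ.sw j).box _).content = (σ.box _).content
          rw [PSYT.sw_box (Or.inl h2), simpleSwap_of_ne (by simp [j]) (by simp)]
        rw [e] at r1 ⊢
        rw [stepP _ r1, ec, stepB σ j r0 h2, smul_comm, ← mul_smul, ← mul_smul,
          opB_mul_opY h hn hij, σ.psi_box_lo hij, σ.psi_box_hi hij,
          swapCoeff_congr (σ.psi_wt_hi j) (σ.psi_wt_lo hij)]
      · have hl : i.1 + 1 = μ.card - 1 := by omega
        let z : Fin (μ.card - 1) := ⟨0, by omega⟩
        have hz : z.1 = 0 := rfl
        -- Under Ψ the box with the largest label of `σ` becomes that of `lo i`, and the box of the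
        -- first label becomes that of `hi i`, with exponent at least 1. By `h1` the former has at
        -- least this exponent, so `σ` lies in the image of Ψ too.
        obtain ⟨ρ, rfl⟩ : ∃ ρ : PSYT μ, ρ.Psi = σ := by
          refine σ.exists_psi_eq (l := hi i) (by simp only [hi]; omega) ?_
          have b1 : σ.Psi.box (lo i) = σ.box (hi i) := σ.psi_box_lt rfl
          have b2 : σ.Psi.box (hi i) = σ.box (lo z) :=
            σ.psi_box_last (by simp only [hi]; omega) rfl
          rw [b1, b2] at h1
          have e1 := σ.psi_wt_hi i
          have e2 := σ.psi_wt_box_zero (x := lo z) rfl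
          unfold StrongBefore at h1
          omega
        have h2 : StrongBefore ρ.wt (ρ.box (lo z)) (ρ.box (hi z)) := by
          unfold StrongBefore at *
          rw [ρ.psi_psi_box_lo hl hz, ρ.psi_psi_box_hi hl hz, ρ.psi_psi_wt_lo hz,
            ρ.psi_psi_wt_hi hz] at h1
          omega
        obtain ⟨-, e⟩ := PSYT.psi_psi_sw hl hz (Or.inl h2)
        have s0 := PSYT.rk_lt_psi ρ hn
        have s1 := PSYT.rk_lt_psi (ρ.sw z).Psi hn
        have c1 : (ρ.sw z).Psi.c ⟨0, hn⟩ = ρ.c ⟨0, hn⟩ := by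
          change ((ρ.sw z).Psi.box _).content = (ρ.box (lo z)).content
          rw [PSYT.psi_box_lt _ (y := hi z) rfl, PSYT.sw_box_hi (Or.inl h2)]
        have c2 : (ρ.sw z).c ⟨0, hn⟩ = ρ.Psi.c ⟨0, hn⟩ := by
          change ((ρ.sw z).box (lo z)).content = (ρ.Psi.box _).content
          rw [PSYT.psi_box_lt _ (y := hi z) rfl, PSYT.sw_box_lo (Or.inl h2)]
        rw [e] at r1 ⊢
        rw [stepP _ r1, stepP (ρ.sw z) (by omega), stepP ρ r0, stepB ρ z (by omega) h2, c1, c2,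
          ρ.psi_psi_box_lo hl hz, ρ.psi_psi_box_hi hl hz,
          swapCoeff_shift (ρ.psi_psi_wt_hi hz) (ρ.psi_psi_wt_lo hz)]
        simp only [smul_comm (opY T X hn) (_ : K), smul_comm (opB T i _) (_ : K), smul_smul,
          ← mul_assoc]
        rw [mul_assoc (opB T i _), opB_mul_opY_sq h hn hl hz, mul_comm (t ^ _)⁻¹]
    rintro f g (⟨h1, rfl⟩ | ⟨i, h1, rfl⟩ | ⟨σ, h1, rfl⟩) (⟨h2, rfl⟩ | ⟨j, h2, rfl⟩ | ⟨ρ, h2, rfl⟩)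
    · rfl
    · have hs : ∀ b, (τ.sw j).wt b = 0 := fun b => by rw [PSYT.sw_wt, h1]
      have hf : τ.Free j := Or.inl h2
      have e := hF (τ.sw j) _ (PSYT.rk_sw_lt h2) (Or.inl ⟨hs, rfl⟩)
      have e2 := hv ⟨τ.sw j, hs⟩ ⟨τ, h1⟩ j
        (by rwa [PSYT.sw_wt, PSYT.sw_box_lo hf, PSYT.sw_box_hi hf]) (PSYT.sw_sw hf).symm
      simp only [PSYT.sw_wt, PSYT.sw_box_lo hf, PSYT.sw_box_hi hf] at e2
      simp only
      rw [e, ← e2]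
    · exfalso
      have := ρ.psi_wt_box_zero (x := ⟨0, hn⟩) rfl
      rw [h2, h1] at this
      omega
    · have hs : ∀ b, (τ.sw i).wt b = 0 := fun b => by rw [PSYT.sw_wt, h2]
      have hf : τ.Free i := Or.inl h1
      have e := hF (τ.sw i) _ (PSYT.rk_sw_lt h1) (Or.inl ⟨hs, rfl⟩)
      have e2 := hv ⟨τ.sw i, hs⟩ ⟨τ, h2⟩ i
        (by rwa [PSYT.sw_wt, PSYT.sw_box_lo hf, PSYT.sw_box_hi hf]) (PSYT.sw_sw hf).symm
      simp only [PSYT.sw_wt, PSYT.sw_box_lo hf, PSYT.sw_box_hi hf] at e2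
      simp only
      rw [e, ← e2]
    · rcases lt_trichotomy i.1 j.1 with h3 | h3 | h3
      · exact pairBB i j h3 h1 h2
      · rw [Fin.ext h3]
      · exact (pairBB j i h3 h2 h1).symm
    · exact pairBP i ρ h2 h1
    · exfalso
      have := σ.psi_wt_box_zero (x := ⟨0, hn⟩) rfl
      rw [h1, h2] at this
      omega
    · exact (pairBP j σ h1 h2).symm
    · rw [PSYT.psi_injective (h1.trans h2.symm)]

/-- The vectors of a family are joint eigenvectors if those of the standard tableaux are. -/
theorem IsFamily.weight (h : ∀ a b, DoubleRel T θ X a b → a = b) {hn : 0 < μ.card}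
    {F : PSYT μ → M} (hF : IsFamily T X hn F)
    (h0 : ∀ (τ : SYT μ) (i : Fin μ.card), θ i • F τ.1 = boxWeight τ.1.wt (τ.1.box i) • F τ.1)
    (τ : PSYT μ) (i : Fin μ.card) : θ i • F τ = boxWeight τ.wt (τ.box i) • F τ := by
  have hA := DoubleRel.toAffine h
  obtain ⟨m, hm⟩ : ∃ m, τ.rk = m := ⟨_, rfl⟩
  induction m using Nat.strong_induction_on generalizing τ i with
  | _ m ih =>
    subst hm
    rcases τ.predecessor hn with h1 | ⟨σ, rfl⟩ | ⟨j, hj⟩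
    · exact h0 ⟨τ, h1⟩ i
    · have ih' := fun i => ih _ (PSYT.rk_lt_psi σ hn) σ i rfl
      rw [hF.psi, smul_comm, ← mul_smul]
      -- For the last index Y turns θ_n into q θ_1, matching the exponent that Ψ raises by one; all
      -- other indices are merely shifted.
      by_cases hi' : i.1 + 1 = μ.card
      · have e : i = ⟨μ.card - 1, by omega⟩ := Fin.ext (by simp only; omega)
        have eb := σ.psi_box_last (x := i) (y := ⟨0, hn⟩) hi' rfl
        rw [eb, boxWeight, σ.psi_wt_box_zero rfl, e, theta_last_mul_opY h hn, smul_assoc, mul_smul,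
          ih']
        simp only [smul_comm (opY T X hn) (_ : K), smul_smul, boxWeight]
        congr 1
        ring
      · let j : Fin (μ.card - 1) := ⟨i.1, by omega⟩
        have e : i = lo j := rfl
        have eb : σ.Psi.box i = σ.box (hi j) := σ.psi_box_lt rfl
        rw [eb, boxWeight, σ.psi_wt_hi, e, theta_mul_opY h hn j, mul_smul, ih']
        simp only [smul_comm (opY T X hn) (_ : K), smul_smul, boxWeight]
        congr 1
        ring
    · have hs : StrongBefore τ.wt (τ.box (lo j)) (τ.box (hi j)) := Or.inl hj
      have hf : τ.Free j := Or.inl hs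
      have ih' := fun i => ih _ (PSYT.rk_sw_lt hs) (τ.sw j) i rfl
      have hne := sub_ne_zero.2 hs.weight_ne.symm
      rw [hF.down hs, opB_smul, smul_add, smul_comm (θ i) (_ : K), ih', ← mul_smul]
      -- The coefficient is chosen so that the term `(t - 1) • θ (hi j)` from the commutation of
      -- `opA` with `θ` is absorbed.
      have hx : swapCoeff τ.wt (τ.box (hi j)) (τ.box (lo j)) *
          (boxWeight τ.wt (τ.box (hi j)) - boxWeight τ.wt (τ.box (lo j))) =
          (t - 1) * boxWeight τ.wt (τ.box (lo j)) := div_mul_cancel₀ _ hne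
      by_cases h1 : i = lo j
      · rw [h1, opA_mul_theta_hi hA, sub_smul, mul_smul, ih', smul_assoc, ih', PSYT.sw_wt,
          PSYT.sw_box_lo hf, PSYT.sw_box_hi hf, smul_comm (opA T j) (_ : K), smul_add, smul_smul,
          smul_smul, smul_smul, sub_add, ← sub_smul, sub_eq_add_neg, ← neg_smul]
        congr 2
        rw [← hx]
        ring
      by_cases h2 : i = hi j
      · rw [h2, opA_mul_theta_lo hA, add_smul, mul_smul, ih', smul_assoc, ih', PSYT.sw_wt,
          PSYT.sw_box_lo hf, PSYT.sw_box_hi hf, smul_comm (opA T j) (_ : K), smul_add, smul_smul,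
          smul_smul, smul_smul, add_assoc, ← add_smul]
        congr 2
        rw [← hx]
        ring
      · rw [opA_comm_theta hA j i h1 h2, mul_smul, ih', PSYT.sw_wt, PSYT.sw_box hf,
          Equiv.swap_apply_of_ne_of_ne h1 h2, smul_comm (opA T j) (_ : K), smul_add, smul_smul,
          smul_smul, mul_comm (swapCoeff _ _ _)]

theorem PSYT.Adjacent.weight_ne {T : Box μ → ℕ} {a b : Box μ} (h : PSYT.Adjacent T a b) :
    boxWeight T a ≠ boxWeight T b := by
  intro e
  obtain ⟨h1, h2⟩ := boxWeight_eq e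
  obtain ⟨h3, h4⟩ := h
  unfold Box.content at h2
  omega

/-- The intertwiners kill the vectors of a family when the numbers cannot be exchanged. -/
theorem IsFamily.adjacent (h : ∀ a b, DoubleRel T θ X a b → a = b) {hn : 0 < μ.card}
    {F : PSYT μ → M} (hF : IsFamily T X hn F)
    (h0 : ∀ (τ : SYT μ) (i : Fin (μ.card - 1)),
      PSYT.Adjacent τ.1.wt (τ.1.box (lo i)) (τ.1.box (hi i)) →
      opB T i (swapCoeff τ.1.wt (τ.1.box (lo i)) (τ.1.box (hi i))) • F τ.1 = 0)
    (τ : PSYT μ) (i : Fin (μ.card - 1))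
    (hadj : PSYT.Adjacent τ.wt (τ.box (lo i)) (τ.box (hi i))) :
    opB T i (swapCoeff τ.wt (τ.box (lo i)) (τ.box (hi i))) • F τ = 0 := by
  have hT := DoubleRel.toHecke h
  obtain ⟨m, hm⟩ : ∃ m, τ.rk = m := ⟨_, rfl⟩
  induction m using Nat.strong_induction_on generalizing τ i with
  | _ m ih =>
    subst hm
    rcases τ.predecessor hn with h1 | ⟨σ, rfl⟩ | ⟨j, hj⟩
    · exact h0 ⟨τ, h1⟩ i hadj
    · rw [hF.psi, smul_comm, ← mul_smul]
      rcases Nat.lt_or_ge (i.1 + 1) (μ.card - 1) with hd | hd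
      · let j : Fin (μ.card - 1) := ⟨i.1 + 1, hd⟩
        have hij : i.1 + 1 = j.1 := rfl
        rw [σ.psi_box_lo hij, σ.psi_box_hi hij, PSYT.Adjacent, σ.psi_wt_lo hij, σ.psi_wt_hi] at hadj
        rw [σ.psi_box_lo hij, σ.psi_box_hi hij, opB_mul_opY h hn hij, mul_smul,
          swapCoeff_congr (σ.psi_wt_lo hij) (σ.psi_wt_hi j),
          ih _ (PSYT.rk_lt_psi σ hn) σ j hadj rfl, smul_zero, smul_zero]
      · have hl : i.1 + 1 = μ.card - 1 := by omega
        let z : Fin (μ.card - 1) := ⟨0, by omega⟩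
        have hz : z.1 = 0 := rfl
        obtain ⟨ρ, rfl⟩ : ∃ ρ : PSYT μ, ρ.Psi = σ := by
          refine σ.exists_psi_eq (l := hi i) (by simp only [hi]; omega) ?_
          have b1 : σ.Psi.box (lo i) = σ.box (hi i) := σ.psi_box_lt rfl
          have b2 : σ.Psi.box (hi i) = σ.box (lo z) :=
            σ.psi_box_last (by simp only [hi]; omega) rfl
          rw [b1, b2] at hadj
          have e1 := σ.psi_wt_hi i
          have e2 := σ.psi_wt_box_zero (x := lo z) rfl
          have := hadj.1
          omega
        rw [ρ.psi_psi_box_lo hl hz, ρ.psi_psi_box_hi hl hz, PSYT.Adjacent, ρ.psi_psi_wt_lo hz,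
          ρ.psi_psi_wt_hi hz, Nat.add_right_cancel_iff] at hadj
        rw [ρ.psi_psi_box_lo hl hz, ρ.psi_psi_box_hi hl hz,
          swapCoeff_shift (ρ.psi_psi_wt_lo hz) (ρ.psi_psi_wt_hi hz), hF.psi,
          smul_comm _ (_ : K), ← mul_smul (_ * _ : R), mul_assoc, opB_mul_opY_sq h hn hl hz,
          mul_smul, ih _ ((PSYT.rk_lt_psi ρ hn).trans (PSYT.rk_lt_psi _ hn)) ρ z hadj rfl,
          smul_zero, smul_zero, smul_zero]
    · have hs : StrongBefore τ.wt (τ.box (lo j)) (τ.box (hi j)) := Or.inl hj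
      have hf : τ.Free j := Or.inl hs
      have r1 := PSYT.rk_sw_lt hs
      have hij : i.1 ≠ j.1 := fun e => by
        obtain rfl : i = j := Fin.ext e
        have := hadj.1
        omega
      by_cases hd : i.1 + 1 < j.1 ∨ j.1 + 1 < i.1
      · have f1 : simpleSwap j (hi i) = hi i :=
          simpleSwap_of_ne (by simp [hi]; omega) (by simp [hi]; omega)
        have f2 : simpleSwap j (lo i) = lo i :=
          simpleSwap_of_ne (by simp [lo]; omega) (by simp [lo]; omega)
        have := ih _ r1 (τ.sw j) i (by rwa [PSYT.sw_wt, PSYT.sw_box hf, PSYT.sw_box hf, f1, f2]) rfl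
        rw [PSYT.sw_wt, PSYT.sw_box hf, PSYT.sw_box hf, f1, f2] at this
        rw [hF.down hs, ← mul_smul, opB_comm hT hd, mul_smul, this, smul_zero]
      -- For overlapping indices the Yang–Baxter equation moves the intertwiner of the neighbouring
      -- boxes past two swaps, to a tableau of smaller rank where the induction applies. The drop of
      -- exponent in `hj` is strict, so it carries over to the second of the two neighbours, which
      -- has the same exponent as the first.
      by_cases hd' : i.1 + 1 = j.1
      · have elo : lo j = hi i := Fin.ext (by simp [lo, hi, hd'])
        have f1 : simpleSwap i (hi j) = hi j :=
          simpleSwap_of_ne (by simp [hi]; omega) (by simp [hi]; omega)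
        have f2 : simpleSwap j (lo i) = lo i :=
          simpleSwap_of_ne (by simp [lo]; omega) (by simp [lo]; omega)
        have g1 : simpleSwap i (hi i) = lo i := Equiv.swap_apply_right _ _
        have g2 : simpleSwap i (lo i) = hi i := Equiv.swap_apply_left _ _
        have g3 : simpleSwap j (hi i) = hi j := by rw [← elo]; exact Equiv.swap_apply_left _ _
        have g4 : simpleSwap j (hi j) = hi i := by rw [← elo]; exact Equiv.swap_apply_right _ _
        rw [elo] at hj
        have hac : StrongBefore τ.wt (τ.box (lo i)) (τ.box (hi j)) := by
          left
          have := hadj.1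
          omega
        have k1 : StrongBefore (τ.sw j).wt ((τ.sw j).box (lo i)) ((τ.sw j).box (hi i)) := by
          simpa only [PSYT.sw_wt, PSYT.sw_box hf, f2, g3] using hac
        have fk1 : (τ.sw j).Free i := Or.inl k1
        have r2 := PSYT.rk_sw_lt k1
        have a0 := ih _ (r2.trans r1) ((τ.sw j).sw i) j
        simp only [PSYT.sw_wt, PSYT.sw_box fk1, PSYT.sw_box hf, elo, f1, f2, g1, g4] at a0
        have a1 := a0 hadj trivial
        rw [hF.down hs, hF.down k1, ← mul_smul, ← mul_smul]
        simp only [PSYT.sw_wt, PSYT.sw_box hf, f2, g3, elo]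
        rw [opB, opB, opB, yang_baxter hT hd' (swapCoeff_ybe hac.weight_ne.symm hadj.weight_ne
          (by rw [elo] at hs; exact hs.weight_ne.symm)), mul_smul]
        rw [opB] at a1
        rw [a1, smul_zero]
      · have hd'' : j.1 + 1 = i.1 := by omega
        have elo : lo i = hi j := Fin.ext (by simp [lo, hi, hd''])
        have f1 : simpleSwap j (hi i) = hi i :=
          simpleSwap_of_ne (by simp [hi]; omega) (by simp [hi]; omega)
        have f2 : simpleSwap i (lo j) = lo j :=
          simpleSwap_of_ne (by simp [lo]; omega) (by simp [lo]; omega)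
        have g1 : simpleSwap j (hi j) = lo j := Equiv.swap_apply_right _ _
        have g2 : simpleSwap j (lo j) = hi j := Equiv.swap_apply_left _ _
        have g3 : simpleSwap i (hi j) = hi i := by rw [← elo]; exact Equiv.swap_apply_left _ _
        have g4 : simpleSwap i (hi i) = hi j := by rw [← elo]; exact Equiv.swap_apply_right _ _
        rw [elo] at hadj ⊢
        have hac : StrongBefore τ.wt (τ.box (lo j)) (τ.box (hi i)) := by
          left
          have := hadj.1
          omega
        have k1 : StrongBefore (τ.sw j).wt ((τ.sw j).box (lo i)) ((τ.sw j).box (hi i)) := by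
          simpa only [PSYT.sw_wt, PSYT.sw_box hf, elo, g1, f1] using hac
        have fk1 : (τ.sw j).Free i := Or.inl k1
        have r2 := PSYT.rk_sw_lt k1
        have a0 := ih _ (r2.trans r1) ((τ.sw j).sw i) j
        simp only [PSYT.sw_wt, PSYT.sw_box fk1, PSYT.sw_box hf, f1, f2, g2, g3] at a0
        have a1 := a0 hadj trivial
        rw [hF.down hs, hF.down k1, ← mul_smul, ← mul_smul]
        simp only [PSYT.sw_wt, PSYT.sw_box hf, f1, g1, elo]
        rw [opB, opB, opB, ← yang_baxter hT hd'' (swapCoeff_ybe hadj.weight_ne hac.weight_ne.symm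
          hs.weight_ne.symm), mul_smul]
        rw [opB] at a1
        rw [a1, smul_zero]

end Family

end

end VVMacdonald

/-! ### The action of the T_i on the F_τ and the invariant vectors. -/

namespace VVMacdonald

noncomputable section

open Classical TensorProduct

variable {μ : YoungDiagram}

/-! ### Coefficients of the intertwiners -/

theorem swapCoeff_add {S : Box μ → ℕ} {a b : Box μ} (h : boxWeight S a ≠ boxWeight S b) :
    swapCoeff S a b + swapCoeff S b a = 1 - t := by
  have h1 := sub_ne_zero.2 h
  have h2 := sub_ne_zero.2 h.symm
  unfold swapCoeff
  field_simp
  ring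

theorem add_swapCoeff {S : Box μ → ℕ} {a b : Box μ} (h : boxWeight S a ≠ boxWeight S b) :
    t + swapCoeff S a b =
      (boxWeight S b - boxWeight S a * t) / (boxWeight S b - boxWeight S a) := by
  have h1 := sub_ne_zero.2 h
  have h2 := sub_ne_zero.2 h.symm
  unfold swapCoeff
  field_simp
  ring

theorem one_sub_swapCoeff {S : Box μ → ℕ} {a b : Box μ} (h : boxWeight S a ≠ boxWeight S b) :
    1 - swapCoeff S a b =
      (boxWeight S b * t - boxWeight S a) / (boxWeight S b - boxWeight S a) := by
  have h1 := sub_ne_zero.2 h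
  have h2 := sub_ne_zero.2 h.symm
  unfold swapCoeff
  field_simp
  ring

theorem StrongBefore.add_swapCoeff_ne_zero {S : Box μ → ℕ} {a b : Box μ}
    (h : StrongBefore S b a) : t + swapCoeff S a b ≠ 0 := by
  rw [add_swapCoeff h.weight_ne.symm]
  refine div_ne_zero (sub_ne_zero.2 ?_) (sub_ne_zero.2 h.weight_ne)
  rw [mul_comm]
  exact h.weight_ne_mul

theorem StrongBefore.one_sub_swapCoeff_ne_zero {S : Box μ → ℕ} {a b : Box μ}
    (h : StrongBefore S b a) : 1 - swapCoeff S a b ≠ 0 := by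
  rw [one_sub_swapCoeff h.weight_ne.symm]
  refine div_ne_zero (sub_ne_zero.2 ?_) (sub_ne_zero.2 h.weight_ne)
  rw [mul_comm]
  exact h.weight_ne_mul'.symm

/-- Moving one box to the right multiplies the weight by `t`. The value is the eigenvalue of T_i on
such a vector; `swapCoeff_col` gives the eigenvalue -t in the same way. -/
theorem swapCoeff_row {S : Box μ → ℕ} {a b : Box μ} (h : S a = S b) (hr : a.row = b.row)
    (hc : b.col = a.col + 1) : swapCoeff S b a = 1 := by
  have e : boxWeight S b = t * boxWeight S a := by
    have : b.content = a.content + 1 := by unfold Box.content; omega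
    rw [boxWeight, boxWeight, this, h, zpow_add_one₀ t_ne_zero]
    ring
  have h1 := boxWeight_ne_zero S a
  have h2 : t - 1 ≠ 0 := sub_ne_zero.2 t_ne_one
  rw [swapCoeff, e, show t * boxWeight S a - boxWeight S a = (t - 1) * boxWeight S a by ring,
    div_self (mul_ne_zero h2 h1)]

theorem swapCoeff_col {S : Box μ → ℕ} {a b : Box μ} (h : S a = S b) (hc : a.col = b.col)
    (hr : b.row = a.row + 1) : swapCoeff S b a = -t := by
  have e : boxWeight S a = t * boxWeight S b := by
    have : a.content = b.content + 1 := by unfold Box.content; omega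
    rw [boxWeight, boxWeight, this, h, zpow_add_one₀ t_ne_zero]
    ring
  have h1 := boxWeight_ne_zero S b
  have h2 : 1 - t ≠ 0 := sub_ne_zero.2 t_ne_one.symm
  rw [swapCoeff, e, show boxWeight S b - t * boxWeight S b = (1 - t) * boxWeight S b by ring]
  field_simp
  ring

/-- The coefficients of the symmetric Macdonald polynomials. -/
def symCoeff (τ : PSYT μ) : K :=
  ∏ p ∈ Inv τ, (boxWeight τ.wt p.1 * t - boxWeight τ.wt p.2) /
    (boxWeight τ.wt p.1 - boxWeight τ.wt p.2)

/-- An upward swap removes exactly one inversion, and the factor belongs to that pair. -/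
theorem symCoeff_eq {τ : PSYT μ} {i : Fin (μ.card - 1)}
    (h : StrongBefore τ.wt (τ.box (hi i)) (τ.box (lo i))) :
    symCoeff τ = (1 - swapCoeff τ.wt (τ.box (lo i)) (τ.box (hi i))) * symCoeff (τ.sw i) := by
  obtain ⟨h1, h2⟩ := PSYT.inv_sw h
  rw [symCoeff, h2, Finset.prod_insert h1, one_sub_swapCoeff h.weight_ne.symm, symCoeff,
    PSYT.sw_wt]

/-- The coefficient of `F_{s_i(τ)}` in `T_i F_τ`. -/
def swapMult (τ : PSYT μ) (i : Fin (μ.card - 1)) : K :=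
  if StrongBefore τ.wt (τ.box (hi i)) (τ.box (lo i)) then 1
  else if StrongBefore τ.wt (τ.box (lo i)) (τ.box (hi i)) then
    (t + swapCoeff τ.wt (τ.box (hi i)) (τ.box (lo i))) *
      (1 - swapCoeff τ.wt (τ.box (hi i)) (τ.box (lo i)))
  else 0

theorem swapMult_ne_zero {τ : PSYT μ} {i : Fin (μ.card - 1)} (h : τ.Free i) :
    swapMult τ i ≠ 0 := by
  unfold swapMult
  split_ifs with h1 h2
  · exact one_ne_zero
  · exact mul_ne_zero h2.add_swapCoeff_ne_zero h2.one_sub_swapCoeff_ne_zero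
  · exact absurd h (by unfold PSYT.Free; tauto)

theorem PSYT.sw_of_not_free {τ : PSYT μ} {i : Fin (μ.card - 1)} (h : ¬τ.Free i) :
    τ.sw i = τ := by
  unfold sw
  rw [dif_neg h]

theorem PSYT.sw_sw' (τ : PSYT μ) (i : Fin (μ.card - 1)) : (τ.sw i).sw i = τ := by
  by_cases h : τ.Free i
  · exact sw_sw h
  · rw [sw_of_not_free h, sw_of_not_free h]

/-- The exchange of two neighbours on the tableaux with given exponents. -/
def swOf {S : Box μ → ℕ} (i : Fin (μ.card - 1)) : Equiv.Perm (PSYTOf S) where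
  toFun τ := ⟨τ.1.sw i, by rw [PSYT.sw_wt, τ.2]⟩
  invFun τ := ⟨τ.1.sw i, by rw [PSYT.sw_wt, τ.2]⟩
  left_inv τ := Subtype.ext (τ.1.sw_sw' i)
  right_inv τ := Subtype.ext (τ.1.sw_sw' i)

section Symmetric

set_option linter.unusedSectionVars false

variable {R : Type*} [Ring R] [Algebra K R] {T : Fin (μ.card - 1) → R} {θ : Fin μ.card → R}
  {M : Type*} [AddCommGroup M] [Module K M] [Module R M] [IsScalarTower K R M]
  {F : PSYT μ → M} {S : Box μ → ℕ}

variable (T θ) in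
/-- A family of joint eigenvectors that is related by the intertwiners of the `T_i`. -/
structure IsEigenFamily (F : PSYT μ → M) : Prop where
  up : ∀ (τ : PSYT μ) (i : Fin (μ.card - 1)),
    StrongBefore τ.wt (τ.box (hi i)) (τ.box (lo i)) →
    F (τ.sw i) = opB T i (swapCoeff τ.wt (τ.box (lo i)) (τ.box (hi i))) • F τ
  weight : ∀ (τ : PSYT μ) (i : Fin μ.card), θ i • F τ = boxWeight τ.wt (τ.box i) • F τ
  adjacent : ∀ (τ : PSYT μ) (i : Fin (μ.card - 1)),
    PSYT.Adjacent τ.wt (τ.box (lo i)) (τ.box (hi i)) →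
    opB T i (swapCoeff τ.wt (τ.box (lo i)) (τ.box (hi i))) • F τ = 0

theorem opB_smul' (i : Fin (μ.card - 1)) (x : K) (m : M) :
    opB T i x • m = T i • m + (t - 1 + x) • m := by
  rw [opB_smul, opA_eq, add_smul, smul_assoc, one_smul, add_assoc, ← add_smul]

/-- It computes T_i on the upper vector of a swap, written as an intertwiner applied to the lower
vector `m`. -/
theorem generic_hecke_smul {k R M : Type*} [CommRing k] [Ring R] [Algebra k R] [AddCommGroup M]
    [Module k M] [Module R M] [IsScalarTower k R M] {s y : k} {a : R}
    (h : a * a = (1 - s) • a + s • (1 : R)) (m : M) :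
    a • (a • m + (s - 1 + y) • m) =
      y • (a • m + (s - 1 + y) • m) + ((s + y) * (1 - y)) • m := by
  have e : a • (s - 1 + y) • m = (s - 1 + y) • a • m := by
    rw [← smul_one_smul R (s - 1 + y) m, ← smul_one_smul R (s - 1 + y) (a • m), ← mul_smul,
      ← mul_smul, mul_smul_one, smul_one_mul]
  rw [smul_add, ← mul_smul, h, add_smul, smul_assoc, smul_assoc, one_smul, e]
  generalize a • m = x
  module

/-- The action of the `T_i`. -/
theorem IsEigenFamily.T_smul (hF : IsEigenFamily T θ F) (hT : ∀ a b, HeckeRel T a b → a = b)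
    (τ : PSYT μ) (i : Fin (μ.card - 1)) :
    T i • F τ = swapCoeff τ.wt (τ.box (hi i)) (τ.box (lo i)) • F τ +
      swapMult τ i • F (τ.sw i) := by
  rcases τ.consecutive i with h | h | h
  · have hf : τ.Free i := Or.inl h
    have e := hF.up (τ.sw i) i
    rw [PSYT.sw_wt, PSYT.sw_box_lo hf, PSYT.sw_box_hi hf, PSYT.sw_sw hf] at e
    rw [swapMult, if_neg h.asymm, if_pos h, e h, opB_smul',
      generic_hecke_smul (generic_quad (hT _ _ (HeckeRel.quad i)))]
  · have e : t - 1 + swapCoeff τ.wt (τ.box (lo i)) (τ.box (hi i)) =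
        -swapCoeff τ.wt (τ.box (hi i)) (τ.box (lo i)) := by
      have := swapCoeff_add h.weight_ne
      linear_combination this
    rw [swapMult, if_pos h, hF.up τ i h, opB_smul', one_smul, e, neg_smul]
    abel
  · have e : t - 1 + swapCoeff τ.wt (τ.box (lo i)) (τ.box (hi i)) =
        -swapCoeff τ.wt (τ.box (hi i)) (τ.box (lo i)) := by
      have := swapCoeff_add h.weight_ne
      linear_combination this
    have h1 : swapMult τ i = 0 := by
      obtain ⟨h1, h2⟩ := h
      unfold swapMult StrongBefore
      rw [if_neg (by omega), if_neg (by omega)]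
    have h2 := hF.adjacent τ i h
    rw [opB_smul', e, neg_smul, ← sub_eq_add_neg, sub_eq_zero] at h2
    rw [h1, zero_smul, add_zero, h2]

theorem isRSSYT_row {τ : PSYT μ} (hS : IsRSSYT τ.wt) {a b : Box μ} (h : PSYT.Adjacent τ.wt a b) :
    a.row = b.row ∧ b.col = a.col + 1 := by
  obtain ⟨h1, h2 | h2⟩ := h
  · exact h2
  · have := hS.2 a b h2.1 (by omega)
    omega

theorem IsRSSYT.swapCoeff_eq_one {τ : PSYT μ} (hS : IsRSSYT τ.wt) {i : Fin (μ.card - 1)}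
    (h : ¬τ.Free i) : swapCoeff τ.wt (τ.box (hi i)) (τ.box (lo i)) = 1 := by
  have h1 : PSYT.Adjacent τ.wt (τ.box (lo i)) (τ.box (hi i)) := by
    rcases τ.consecutive i with h1 | h1 | h1
    · exact absurd (Or.inl h1) h
    · exact absurd (Or.inr h1) h
    · exact h1
  obtain ⟨h2, h3⟩ := isRSSYT_row hS h1
  exact swapCoeff_row h1.1 h2 h3

/-- The vector `∑ κ_τ F_τ`. -/
def symVec (F : PSYT μ → M) (S : Box μ → ℕ) : M := ∑ τ : PSYTOf S, symCoeff τ.1 • F τ.1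

/-- The relation between the coefficients of an invariant vector. -/
theorem symCoeff_rel (hS : IsRSSYT S) (τ : PSYTOf S) (i : Fin (μ.card - 1)) :
    symCoeff τ.1 * swapCoeff τ.1.wt (τ.1.box (hi i)) (τ.1.box (lo i)) +
      symCoeff (τ.1.sw i) * swapMult (τ.1.sw i) i = symCoeff τ.1 := by
  obtain ⟨τ, rfl⟩ := τ
  simp only
  rcases τ.consecutive i with h | h | h
  · have hf : τ.Free i := Or.inl h
    have h' : StrongBefore (τ.sw i).wt ((τ.sw i).box (hi i)) ((τ.sw i).box (lo i)) := by
      rwa [PSYT.sw_wt, PSYT.sw_box_lo hf, PSYT.sw_box_hi hf]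
    rw [symCoeff_eq h', swapMult, if_pos h', PSYT.sw_wt, PSYT.sw_box_lo hf, PSYT.sw_box_hi hf,
      PSYT.sw_sw hf]
    ring
  · have hf : τ.Free i := Or.inr h
    have h' : StrongBefore (τ.sw i).wt ((τ.sw i).box (lo i)) ((τ.sw i).box (hi i)) := by
      rwa [PSYT.sw_wt, PSYT.sw_box_lo hf, PSYT.sw_box_hi hf]
    rw [symCoeff_eq h, swapMult, if_neg h'.asymm, if_pos h', PSYT.sw_wt, PSYT.sw_box_lo hf,
      PSYT.sw_box_hi hf]
    have := swapCoeff_add h.weight_ne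
    linear_combination (1 - swapCoeff τ.wt (τ.box (lo i)) (τ.box (hi i))) * symCoeff (τ.sw i) * this
  -- Strictness in columns leaves only neighbours in a row, where T_i acts by 1.
  · have hf : ¬τ.Free i := by
      obtain ⟨h1, h2⟩ := h
      unfold PSYT.Free StrongBefore
      omega
    have : swapMult τ i = 0 := by
      unfold PSYT.Free at hf
      push Not at hf
      rw [swapMult, if_neg hf.2, if_neg hf.1]
    rw [PSYT.sw_of_not_free hf, hS.swapCoeff_eq_one hf, this]
    ring

/-- The action of the `T_i` on linear combinations. -/
theorem IsEigenFamily.T_smul_sum (hF : IsEigenFamily T θ F)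
    (hT : ∀ a b, HeckeRel T a b → a = b) (c : PSYTOf S → K) (i : Fin (μ.card - 1)) :
    T i • ∑ τ : PSYTOf S, c τ • F τ.1 = ∑ τ : PSYTOf S,
      (c τ * swapCoeff τ.1.wt (τ.1.box (hi i)) (τ.1.box (lo i)) +
        c (swOf i τ) * swapMult (τ.1.sw i) i) • F τ.1 := by
  have e : ∑ τ : PSYTOf S, (c (swOf i τ) * swapMult (τ.1.sw i) i) • F τ.1 =
      ∑ τ : PSYTOf S, (c τ * swapMult τ.1 i) • F (τ.1.sw i) := by
    symm
    rw [← Equiv.sum_comp (swOf i)]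
    refine Finset.sum_congr rfl fun τ _ => ?_
    change (c (swOf i τ) * swapMult (τ.1.sw i) i) • F ((τ.1.sw i).sw i) = _
    rw [PSYT.sw_sw']
  simp only [add_smul, Finset.sum_add_distrib, Finset.smul_sum]
  rw [e, ← Finset.sum_add_distrib]
  refine Finset.sum_congr rfl fun τ _ => ?_
  rw [smul_comm (T i) (_ : K), hF.T_smul hT, smul_add, smul_smul, smul_smul]

theorem IsEigenFamily.T_smul_symVec (hF : IsEigenFamily T θ F)
    (hT : ∀ a b, HeckeRel T a b → a = b) (hS : IsRSSYT S) (i : Fin (μ.card - 1)) :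
    T i • symVec F S = symVec F S := by
  rw [symVec, hF.T_smul_sum hT]
  refine Finset.sum_congr rfl fun τ _ => ?_
  exact congrArg (· • F τ.1) (symCoeff_rel hS τ i)

/-- Two boxes on the same diagonal lie strictly north-west and south-east of each other, and a path
along a row and then down a column shows that the exponent strictly drops between them. -/
theorem IsRSSYT.box_eq (hS : IsRSSYT S) {a b : Box μ} (h : boxWeight S a = boxWeight S b) :
    a = b := by
  obtain ⟨h1, h2⟩ := boxWeight_eq h
  have key : ∀ a b : Box μ, a.row < b.row → a.col < b.col → S b < S a := by
    intro a b hr hc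
    obtain ⟨x, hx1, hx2⟩ := exists_box (b := b) (r := a.row) (c := b.col) hr.le le_rfl
    have e1 := hS.2 x b hx2 (by omega)
    have e2 := hS.1 a x hx1.symm (by omega)
    omega
  unfold Box.content at h2
  rcases lt_trichotomy a.row b.row with h3 | h3 | h3
  · have := key a b h3 (by omega)
    omega
  · exact Box.ext' h3 (by omega)
  · have := key b a h3 (by omega)
    omega

/-- The vectors of a family with the same exponents are independent unless one vanishes. -/
theorem IsEigenFamily.independent (hF : IsEigenFamily T θ F) (hS : IsRSSYT S)
    (h0 : ∀ τ : PSYTOf S, F τ.1 ≠ 0) (s : Finset (PSYTOf S)) (g : PSYTOf S → K)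
    (hg : ∑ τ ∈ s, g τ • F τ.1 = 0) : ∀ τ ∈ s, g τ = 0 := by
  induction s using Finset.induction_on generalizing g with
  | empty => simp
  | insert a s ha ih =>
    have hb : ∀ b ∈ s, g b = 0 := by
      intro b hb
      -- The weights determine the boxes, so two different tableaux with exponents `S` are separated
      -- by some θ_i.
      obtain ⟨i, hi'⟩ : ∃ i, boxWeight S (b.1.box i) ≠ boxWeight S (a.1.box i) := by
        by_contra hcon
        push Not at hcon
        have : b = a := Subtype.ext (PSYT.ext_box (b.2.trans a.2.symm)
          fun i => hS.box_eq (hcon i))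
        exact ha (this ▸ hb)
      have h1 : ∑ τ ∈ s, (g τ * (boxWeight S (τ.1.box i) - boxWeight S (a.1.box i))) • F τ.1 = 0 := by
        have e1 : θ i • ∑ τ ∈ insert a s, g τ • F τ.1 -
            boxWeight S (a.1.box i) • ∑ τ ∈ insert a s, g τ • F τ.1 = 0 := by
          rw [hg, smul_zero, smul_zero, sub_zero]
        rw [Finset.smul_sum, Finset.smul_sum, ← Finset.sum_sub_distrib,
          Finset.sum_insert ha] at e1
        have e2 : ∀ τ : PSYTOf S, θ i • g τ • F τ.1 - boxWeight S (a.1.box i) • g τ • F τ.1 =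
            (g τ * (boxWeight S (τ.1.box i) - boxWeight S (a.1.box i))) • F τ.1 := by
          intro τ
          rw [smul_comm (θ i) (_ : K), hF.weight, τ.2, smul_smul, smul_smul, ← sub_smul]
          congr 1
          ring
        simp only [e2] at e1
        rwa [sub_self, mul_zero, zero_smul, zero_add] at e1
      have h2 := ih _ h1 b hb
      exact (mul_eq_zero.1 h2).resolve_right (sub_ne_zero.2 hi')
    rw [Finset.sum_insert ha, Finset.sum_eq_zero (fun b hb' => by rw [hb b hb', zero_smul]),
      add_zero] at hg
    intro τ hτ
    rcases Finset.mem_insert.1 hτ with rfl | hτ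
    · exact (smul_eq_zero.1 hg).resolve_right (h0 _)
    · exact hb τ hτ

theorem IsEigenFamily.eq_zero_sw (hF : IsEigenFamily T θ F) (hT : ∀ a b, HeckeRel T a b → a = b)
    {τ : PSYT μ} {i : Fin (μ.card - 1)} (h : τ.Free i) (h0 : F τ = 0) : F (τ.sw i) = 0 := by
  have := hF.T_smul hT τ i
  rw [h0, smul_zero, smul_zero, zero_add] at this
  exact (smul_eq_zero.1 this.symm).resolve_left (swapMult_ne_zero h)

/-- The multiplicities of legal swaps are non-zero, so vanishing spreads along swaps in both
directions. This replaces a proof that the F_τ are non-zero. -/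
theorem IsEigenFamily.eq_zero_top (hF : IsEigenFamily T θ F)
    (hT : ∀ a b, HeckeRel T a b → a = b) (hn : 0 < μ.card) (τ : PSYT μ) :
    F τ = 0 ↔ F (PSYT.topT τ.wt) = 0 := by
  obtain ⟨m, hm⟩ : ∃ m, (Inv τ).card = m := ⟨_, rfl⟩
  induction m generalizing τ with
  | zero =>
    obtain ⟨h1, h2⟩ := PSYT.topT_spec τ hn
    rw [← PSYT.eq_of_inv_empty h1.symm (Finset.card_eq_zero.1 hm) h2]
  | succ m ih =>
    obtain ⟨i, h⟩ := PSYT.exists_up (τ := τ) (fun e => by rw [e] at hm; simp at hm)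
    have hf : τ.Free i := Or.inr h
    have := ih (τ.sw i) (by have := PSYT.card_inv_sw h; omega)
    rw [PSYT.sw_wt] at this
    rw [← this]
    refine ⟨hF.eq_zero_sw hT hf, fun h0 => ?_⟩
    have := hF.eq_zero_sw hT hf.sw h0
    rwa [PSYT.sw_sw hf] at this

theorem symCoeff_top {τ : PSYT μ} (h : Inv τ = ∅) : symCoeff τ = 1 := by
  rw [symCoeff, h, Finset.prod_empty]

theorem topT_mem (hn : 0 < μ.card) (hS : IsRSSYT S) :
    (PSYT.topT S).wt = S ∧ Inv (PSYT.topT S) = ∅ := by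
  obtain ⟨τ, rfl⟩ := PSYT.exists_of_isRSSYT hS
  exact τ.topT_spec hn

/-- The invariants in the span of the `F_τ` are the multiples of `∑ κ_τ F_τ`. -/
theorem IsEigenFamily.invariant_eq (hF : IsEigenFamily T θ F)
    (hT : ∀ a b, HeckeRel T a b → a = b) (hn : 0 < μ.card) (hS : IsRSSYT S) (c : PSYTOf S → K)
    (hc : ∀ i, T i • ∑ τ : PSYTOf S, c τ • F τ.1 = ∑ τ : PSYTOf S, c τ • F τ.1) :
    ∑ τ : PSYTOf S, c τ • F τ.1 = c ⟨PSYT.topT S, (topT_mem hn hS).1⟩ • symVec F S := by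
  by_cases h0 : F (PSYT.topT S) = 0
  · have h1 : ∀ τ : PSYTOf S, F τ.1 = 0 := fun τ => by rw [hF.eq_zero_top hT hn, τ.2, h0]
    simp [symVec, h1]
  have h1 : ∀ τ : PSYTOf S, F τ.1 ≠ 0 := fun τ => by rwa [Ne, hF.eq_zero_top hT hn, τ.2]
  have h2 : ∀ (i) (τ : PSYTOf S), c τ * swapCoeff τ.1.wt (τ.1.box (hi i)) (τ.1.box (lo i)) +
      c (swOf i τ) * swapMult (τ.1.sw i) i = c τ := by
    intro i τ
    have e := hc i
    rw [hF.T_smul_sum hT, ← sub_eq_zero, ← Finset.sum_sub_distrib] at e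
    simp only [← sub_smul] at e
    exact sub_eq_zero.1 (hF.independent hS h1 _ _ e τ (Finset.mem_univ _))
  -- The relations `h2` are a recursion along upward swaps, so the value at the greatest tableau
  -- determines all coefficients; `symCoeff` satisfies the same recursion with value 1 there.
  have h3 : ∀ m (τ : PSYTOf S), (Inv τ.1).card = m →
      c τ = c ⟨PSYT.topT S, (topT_mem hn hS).1⟩ * symCoeff τ.1 := by
    intro m
    induction m with
    | zero =>
      intro τ hm
      have h3 := Finset.card_eq_zero.1 hm
      have e : τ = ⟨PSYT.topT S, (topT_mem hn hS).1⟩ := Subtype.ext (PSYT.eq_of_inv_empty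
        (τ.2.trans (topT_mem hn hS).1.symm) h3 (topT_mem hn hS).2)
      rw [symCoeff_top h3, mul_one, ← e]
    | succ m ih =>
      intro τ hm
      obtain ⟨i, h⟩ := PSYT.exists_up (τ := τ.1) (fun e => by rw [e] at hm; simp at hm)
      have hf : τ.1.Free i := Or.inr h
      have h' : StrongBefore (τ.1.sw i).wt ((τ.1.sw i).box (lo i)) ((τ.1.sw i).box (hi i)) := by
        rwa [PSYT.sw_wt, PSYT.sw_box_lo hf, PSYT.sw_box_hi hf]
      have e1 := ih (swOf i τ) (by
        have := PSYT.card_inv_sw h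
        change (Inv (τ.1.sw i)).card = m
        omega)
      have e2 := h2 i τ
      have e3 := symCoeff_rel hS τ i
      have e4 : (1 - swapCoeff τ.1.wt (τ.1.box (hi i)) (τ.1.box (lo i))) ≠ 0 := by
        have := swapCoeff_add h.weight_ne
        have h5 := h.add_swapCoeff_ne_zero
        intro h6
        apply h5
        linear_combination this + h6
      change c (swOf i τ) = _ * symCoeff (τ.1.sw i) at e1
      rw [e1] at e2
      apply mul_right_cancel₀ e4
      linear_combination (-1 : K) * e2 + c ⟨PSYT.topT S, (topT_mem hn hS).1⟩ * e3
  rw [symVec, Finset.smul_sum]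
  refine Finset.sum_congr rfl fun τ _ => ?_
  rw [h3 _ τ rfl, mul_smul]

end Symmetric

end

end VVMacdonald

/-! ### Young subgroups, their cosets and the reversal of blocks. -/

namespace VVMacdonald

noncomputable section

open Classical TensorProduct

/-! ### Young subgroups -/

section Young

set_option linter.unusedSectionVars false

variable {n : ℕ} {L : Type*} [LinearOrder L]

/-- The subgroup generated by the simple transpositions inside the blocks of `β`. -/
def blockSubgroup (β : Fin n → L) : Subgroup (Equiv.Perm (Fin n)) :=
  Subgroup.closure {g | ∃ i : Fin (n - 1), g = simpleSwap i ∧ β (lo i) = β (hi i)}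

theorem simpleSwap_mem {β : Fin n → L} {i : Fin (n - 1)} (h : β (lo i) = β (hi i)) :
    simpleSwap i ∈ blockSubgroup β := Subgroup.subset_closure ⟨i, rfl, h⟩

theorem apply_of_mem_blockSubgroup {β : Fin n → L} {v : Equiv.Perm (Fin n)}
    (hv : v ∈ blockSubgroup β) (k : Fin n) : β (v k) = β k := by
  induction hv using Subgroup.closure_induction generalizing k with
  | mem x hx =>
    obtain ⟨i, rfl, h⟩ := hx
    by_cases h1 : k = lo i
    · rw [h1, Equiv.swap_apply_left, h]
    by_cases h2 : k = hi i
    · rw [h2, Equiv.swap_apply_right, h]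
    rw [Equiv.swap_apply_of_ne_of_ne h1 h2]
  | one => rfl
  | mul x y _ _ hx hy => rw [Equiv.Perm.mul_apply, hx, hy]
  | inv x _ hx => exact (hx (x⁻¹ k)).symm.trans (congrArg β (x.apply_symm_apply k))

/-- A relation that holds for neighbours in the same block holds for all pairs in a block. -/
theorem block_induction {β : Fin n → L} (hβ : Monotone β) {P : Fin n → Fin n → Prop}
    (htr : ∀ a b c, P a b → P b c → P a c)
    (h : ∀ i : Fin (n - 1), β (lo i) = β (hi i) → P (lo i) (hi i)) {k l : Fin n} (hkl : k < l)
    (he : β k = β l) : P k l := by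
  obtain ⟨d, hd⟩ : ∃ d, l.1 = k.1 + d + 1 := ⟨l.1 - k.1 - 1, by omega⟩
  induction d generalizing l with
  | zero =>
    have hk : k.1 < n - 1 := by omega
    obtain rfl : l = hi ⟨k.1, hk⟩ := Fin.ext (by simpa [hi] using hd)
    exact h ⟨k.1, hk⟩ he
  | succ d ih =>
    let j : Fin (n - 1) := ⟨l.1 - 1, by omega⟩
    have e2 : l = hi j := Fin.ext (by simp only [hi, j]; omega)
    have h1 : k < lo j := by simp only [Fin.lt_def, lo, j]; omega
    have h2 : lo j ≤ l := by simp only [Fin.le_def, lo, j]; omega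
    have h3 : β k = β (lo j) := le_antisymm (hβ h1.le) (he ▸ hβ h2)
    refine htr _ _ _ (ih h1 h3 (by simp only [lo, j]; omega)) ?_
    rw [e2] at he ⊢
    exact h _ (h3.symm.trans he)

theorem exists_mem_blockSubgroup_apply {β : Fin n → L} (hβ : Monotone β) {k l : Fin n}
    (he : β k = β l) : ∃ v ∈ blockSubgroup β, v k = l := by
  have key : ∀ {k l : Fin n}, k < l → β k = β l → ∃ v ∈ blockSubgroup β, v k = l := by
    intro k l hkl he
    refine block_induction (P := fun k l => ∃ v ∈ blockSubgroup β, v k = l) hβ ?_ ?_ hkl he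
    · rintro a b c ⟨v, hv, rfl⟩ ⟨w, hw, rfl⟩
      exact ⟨w * v, mul_mem hw hv, rfl⟩
    · exact fun i hi' => ⟨_, simpleSwap_mem hi', Equiv.swap_apply_left _ _⟩
  rcases lt_trichotomy k l with h | h | h
  · exact key h he
  · exact ⟨1, one_mem _, h⟩
  · obtain ⟨v, hv, hvl⟩ := key h he.symm
    exact ⟨v⁻¹, inv_mem hv, by rw [← hvl]; exact v.symm_apply_apply l⟩

theorem len_mul_swap {σ : Equiv.Perm (Fin n)} {i : Fin (n - 1)} (h : σ (hi i) < σ (lo i)) :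
    len σ = len (σ * simpleSwap i) + 1 := by
  have := len_swap_mul (σ := σ⁻¹) (i := i) h
  rw [len_inv] at this
  rw [this, ← len_inv (σ * simpleSwap i), mul_inv_rev, Equiv.swap_inv]

/-- Every coset of a Young subgroup has an element that is increasing on the blocks. -/
theorem exists_increasing {β : Fin n → L} (hβ : Monotone β) (σ : Equiv.Perm (Fin n)) :
    ∃ v ∈ blockSubgroup β, ∀ k l, k < l → β k = β l → (σ * v) k < (σ * v) l := by
  obtain ⟨m, hm⟩ : ∃ m, len σ = m := ⟨_, rfl⟩
  induction m using Nat.strong_induction_on generalizing σ with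
  | _ m ih =>
    -- Each descent inside a block can be removed by a generator of the subgroup, which shortens
    -- `σ`.
    by_cases h : ∃ i : Fin (n - 1), β (lo i) = β (hi i) ∧ σ (hi i) < σ (lo i)
    · obtain ⟨i, h1, h2⟩ := h
      have h3 := len_mul_swap h2
      obtain ⟨v, hv, hv'⟩ := ih _ (by omega) (σ * simpleSwap i) rfl
      refine ⟨simpleSwap i * v, mul_mem (simpleSwap_mem h1) hv, ?_⟩
      rwa [← mul_assoc]
    · push Not at h
      refine ⟨1, one_mem _, fun k l hkl he => ?_⟩
      rw [mul_one]
      refine block_induction (P := fun k l => σ k < σ l) hβ (fun _ _ _ => lt_trans)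
        (fun i hi' => lt_of_le_of_ne (h i hi') fun e => lo_ne_hi i (σ.injective e)) hkl he

theorem lt_of_block_lt {β : Fin n → L} (hβ : Monotone β) {v : Equiv.Perm (Fin n)}
    (hv : ∀ k, β (v k) = β k) {k l : Fin n} (hkl : k < l) (hne : β k ≠ β l) : v k < v l := by
  by_contra hcon
  have := hβ (not_lt.1 hcon)
  rw [hv, hv] at this
  exact hne (le_antisymm (hβ hkl.le) this)

/-- A permutation preserving the blocks can be made increasing on each block by an element of the
subgroup. It then preserves the order of all pairs and is the identity. -/
theorem mem_blockSubgroup_iff {β : Fin n → L} (hβ : Monotone β) {v : Equiv.Perm (Fin n)} :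
    v ∈ blockSubgroup β ↔ ∀ k, β (v k) = β k := by
  refine ⟨apply_of_mem_blockSubgroup, fun hv => ?_⟩
  obtain ⟨w, hw, hinc⟩ := exists_increasing hβ v
  have h1 : ∀ k, β ((v * w) k) = β k := fun k => by
    rw [Equiv.Perm.mul_apply, hv, apply_of_mem_blockSubgroup hw]
  have h2 : (1 : Equiv.Perm (Fin n)) = v * w := by
    refine equiv_eq_of_lt_imp (L := (1 : Equiv.Perm (Fin n))) (L' := v * w) fun a b hab => ?_
    by_cases he : β a = β b
    · exact hinc a b hab he
    · exact lt_of_block_lt hβ h1 hab he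
  rw [eq_inv_of_mul_eq_one_left h2.symm]
  exact inv_mem hw

/-- `g` is increasing on blocks and reverses the order of the blocks. -/
structure IsBlockReversal (β : Fin n → L) (g : Equiv.Perm (Fin n)) : Prop where
  same : ∀ k l, k < l → β k = β l → g k < g l
  cross : ∀ k l, k < l → β k ≠ β l → g l < g k

/-- A permutation that is increasing on blocks can only invert pairs from different blocks, and `g`
inverts all of these. Hence `g` is the unique longest one. -/
theorem IsBlockReversal.eq_or_len_lt {β : Fin n → L} {g σ : Equiv.Perm (Fin n)}
    (hg : IsBlockReversal β g) (hσ : ∀ k l, k < l → β k = β l → σ k < σ l) :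
    σ = g ∨ len σ < len g := by
  have hsub : invs (· < ·) σ ⊆ invs (· < ·) g := by
    intro p hp
    rw [mem_invs] at hp ⊢
    refine ⟨hp.1, hg.cross _ _ hp.1 fun e => ?_⟩
    exact lt_asymm (hσ _ _ hp.1 e) hp.2
  rcases (Finset.card_le_card hsub).lt_or_eq with h | h
  · exact Or.inr h
  · left
    have he := Finset.eq_of_subset_of_card_le hsub h.ge
    refine equiv_eq_of_lt_imp (L := σ) (L' := g) fun a b hab => ?_
    rcases lt_trichotomy a b with h1 | h1 | h1
    · have h2 : (a, b) ∉ invs (· < ·) g := by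
        rw [← he, mem_invs]
        exact fun h3 => lt_asymm h3.2 hab
      rw [mem_invs] at h2
      push Not at h2
      exact lt_of_le_of_ne (h2 h1) fun e => h1.ne (g.injective e)
    · exact absurd hab (by rw [h1]; exact lt_irrefl _)
    · have h2 : (b, a) ∈ invs (· < ·) g := by
        rw [← he, mem_invs]
        exact ⟨h1, hab⟩
      exact (mem_invs.1 h2).2

/-- All pairs from different blocks are inverted by `g * v`, and inside a block `g` preserves the
order, so only the pairs not inverted by `v` remain. -/
theorem IsBlockReversal.nonInv_mul {β : Fin n → L} (hβ : Monotone β) {g v : Equiv.Perm (Fin n)}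
    (hg : IsBlockReversal β g) (hv : ∀ k, β (v k) = β k) :
    nonInv (g * v) = (Finset.univ.filter fun p : Fin n × Fin n =>
      β p.1 = β p.2 ∧ p.1 < p.2 ∧ v p.1 < v p.2).card := by
  unfold nonInv
  congr 1
  ext ⟨k, l⟩
  rw [Finset.mem_filter, Finset.mem_filter]
  simp only [Finset.mem_univ, true_and, Equiv.Perm.mul_apply]
  constructor
  · rintro ⟨h1, h2⟩
    have he : β k = β l := by
      by_contra hne
      exact lt_asymm h2 (hg.cross _ _ (lt_of_block_lt hβ hv h1 hne) (by rwa [hv, hv]))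
    refine ⟨he, h1, ?_⟩
    by_contra hcon
    have h3 : v l < v k := lt_of_le_of_ne (not_lt.1 hcon) fun e => h1.ne' (v.injective e)
    exact lt_asymm h2 (hg.same _ _ h3 (by rw [hv, hv, he]))
  · rintro ⟨h1, h2, h3⟩
    exact ⟨h2, hg.same _ _ h3 (by rw [hv, hv, h1])⟩

/-- The blocks are the orbits of the subgroup, and each contributes the generating function of its
own permutations. This is the source of `muFactorial` in `KT`. -/
theorem IsBlockReversal.sum_eq {β : Fin n → L} (hβ : Monotone β) {g : Equiv.Perm (Fin n)}
    (hg : IsBlockReversal β g) :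
    ∑ σ : Equiv.Perm (Fin n) with g⁻¹ * σ ∈ blockSubgroup β, t ^ nonInv σ =
      ∏ ω : MulAction.orbitRel.Quotient (blockSubgroup β) (Fin n),
        tFactorial (Nat.card ω.orbit) := by
  let γ : Fin n → MulAction.orbitRel.Quotient (blockSubgroup β) (Fin n) := Quotient.mk''
  have hγ : ∀ k l, γ k = γ l ↔ β k = β l := by
    intro k l
    rw [Quotient.eq'', MulAction.orbitRel_apply]
    constructor
    · rintro ⟨v, rfl⟩
      exact apply_of_mem_blockSubgroup v.2 l
    · intro h
      obtain ⟨v, hv, hvl⟩ := exists_mem_blockSubgroup_apply hβ h.symm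
      exact ⟨⟨v, hv⟩, hvl⟩
  have e1 : ∑ σ : Equiv.Perm (Fin n) with g⁻¹ * σ ∈ blockSubgroup β, t ^ nonInv σ =
      ∑ v : Equiv.Perm (Fin n) with (∀ a, γ (v a) = γ a), t ^ (Finset.univ.filter
        fun p : Fin n × Fin n => γ p.1 = γ p.2 ∧ p.1 < p.2 ∧ v p.1 < v p.2).card := by
    refine Finset.sum_bij (fun σ _ => g⁻¹ * σ) ?_ ?_ ?_ ?_
    · intro σ hσ
      simp only [Finset.mem_filter, Finset.mem_univ, true_and, hγ] at hσ ⊢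
      exact apply_of_mem_blockSubgroup hσ
    · intro σ _ τ _ h
      exact mul_left_cancel h
    · intro v hv
      refine ⟨g * v, ?_, by simp⟩
      simp only [Finset.mem_filter, Finset.mem_univ, true_and, hγ] at hv ⊢
      rw [inv_mul_cancel_left]
      exact (mem_blockSubgroup_iff hβ).2 hv
    · intro σ hσ
      simp only [Finset.mem_filter, Finset.mem_univ, true_and] at hσ
      have := hg.nonInv_mul hβ (apply_of_mem_blockSubgroup hσ)
      rw [mul_inv_cancel_left] at this
      rw [this]
      simp only [hγ]
  have e2 := sum_nonInv_fibres γ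
  rw [e1]
  trans ∏ ω, tFactorial (Fintype.card {a // γ a = ω})
  · convert e2
  refine Finset.prod_congr rfl fun ω _ => ?_
  rw [Nat.card_eq_fintype_card]
  congr 1
  refine Fintype.card_congr (Equiv.subtypeEquivRight fun a => ?_)
  exact MulAction.orbitRel.Quotient.mem_orbit.symm

end Young

end

end VVMacdonald

/-! ### Symmetrization of the vectors F_τ. -/

namespace VVMacdonald

noncomputable section

open Classical TensorProduct

variable {μ : YoungDiagram} {S : Box μ → ℕ}

/-! ### The least and the greatest tableau -/

theorem minT_mem (hn : 0 < μ.card) (hS : IsRSSYT S) :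
    (PSYT.minT S).wt = S ∧ invs (MinBefore S) (PSYT.minT S).label = ∅ := by
  obtain ⟨τ, rfl⟩ := PSYT.exists_of_isRSSYT hS
  exact τ.minT_spec hn

theorem lt_iff_of_invs_eq_empty {n : ℕ} {B : Type*} [Fintype B] {R : B → B → Prop}
    (htot : ∀ a b, a ≠ b → R a b ∨ R b a)
    {L : B ≃ Fin n} (h : invs R L = ∅) (hR : ∀ a b, R a b → ¬R b a) (a b : B) :
    L a < L b ↔ R a b := by
  have key : ∀ a b, R a b → L a < L b := by
    intro a b hab
    have h1 : (a, b) ∉ invs R L := by rw [h]; exact Finset.notMem_empty _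
    rw [mem_invs] at h1
    push Not at h1
    exact lt_of_le_of_ne (h1 hab) fun e => by
      rw [L.injective e] at hab
      exact hR _ _ hab hab
  refine ⟨fun hab => ?_, key a b⟩
  have hne : a ≠ b := fun e => by rw [e] at hab; exact lt_irrefl _ hab
  rcases htot a b hne with h1 | h1
  · exact h1
  · exact absurd (key _ _ h1) hab.asymm

theorem min_label_lt_iff (hn : 0 < μ.card) (hS : IsRSSYT S) (a b : Box μ) :
    (PSYT.minT S).label a < (PSYT.minT S).label b ↔ MinBefore S a b :=
  lt_iff_of_invs_eq_empty (minBefore_total S) (minT_mem hn hS).2 (minBefore_asymm S) a b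

theorem top_label_lt_iff (hn : 0 < μ.card) (hS : IsRSSYT S) (a b : Box μ) :
    (PSYT.topT S).label a < (PSYT.topT S).label b ↔ StdBefore S a b := by
  have h := topT_mem hn hS
  rw [PSYT.inv_eq_invs, h.1] at h
  exact lt_iff_of_invs_eq_empty (stdBefore_total S) h.2 (stdBefore_asymm S) a b

variable (S) in
/-- The exponent and the row of the box of `Min(S)` with a given number. -/
def minBlock (k : Fin μ.card) : ℕ ×ₗ ℕ :=
  toLex (S ((PSYT.minT S).box k), ((PSYT.minT S).box k).row)

theorem minBlock_eq_iff {k l : Fin μ.card} : minBlock S k = minBlock S l ↔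
    S ((PSYT.minT S).box k) = S ((PSYT.minT S).box l) ∧
      ((PSYT.minT S).box k).row = ((PSYT.minT S).box l).row := by
  rw [minBlock, minBlock, toLex_inj, Prod.mk.injEq]

theorem minBefore_box (hn : 0 < μ.card) (hS : IsRSSYT S) {k l : Fin μ.card} (h : k < l) :
    MinBefore S ((PSYT.minT S).box k) ((PSYT.minT S).box l) := by
  rw [← min_label_lt_iff hn hS]
  simpa using h

theorem minBlock_monotone (hn : 0 < μ.card) (hS : IsRSSYT S) : Monotone (minBlock S) := by
  intro k l hkl
  rcases hkl.eq_or_lt with rfl | hkl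
  · exact le_rfl
  have := minBefore_box hn hS hkl
  rw [minBlock, minBlock, Prod.Lex.toLex_le_toLex]
  unfold MinBefore at this
  omega

theorem youngSubgroup_eq (hn : 0 < μ.card) (hS : IsRSSYT S) :
    youngSubgroup S = blockSubgroup (minBlock S) := by
  unfold youngSubgroup blockSubgroup
  congr 1
  ext g
  refine exists_congr fun i => and_congr_right fun _ => ?_
  rw [minBlock_eq_iff, and_comm, PSYT.w, PSYT.w, (minT_mem hn hS).1]

/-- Boxes with the same exponent form a horizontal strip: a box further down and weakly to the right
has a strictly smaller exponent. -/
theorem IsRSSYT.col_lt (hS : IsRSSYT S) {a b : Box μ} (h : S a = S b) (hr : a.row < b.row) :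
    b.col < a.col := by
  by_contra hcon
  push Not at hcon
  obtain ⟨x, hx1, hx2⟩ := exists_box (b := b) (r := a.row) (c := b.col) hr.le le_rfl
  have e1 := hS.2 x b hx2 (by omega)
  have e2 : S x ≤ S a := by
    rcases hcon.eq_or_lt with h1 | h1
    · rw [Box.ext' hx1 (hx2.trans h1.symm)]
    · exact hS.1 a x hx1.symm (by omega)
  omega

variable (S) in
/-- The permutation that turns `Min(S)` into `Top(S)`. -/
def minTop : Equiv.Perm (Fin μ.card) := (PSYT.minT S).label.symm.trans (PSYT.topT S).label

/-- Min reads the exponents upwards and each strip row by row; Top reads the exponents downwards and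
each strip column by column. In a horizontal strip lower rows lie further left, so the order of the
rows is reversed while each row keeps its own order. -/
theorem minTop_isBlockReversal (hn : 0 < μ.card) (hS : IsRSSYT S) :
    IsBlockReversal (minBlock S) (minTop S) := by
  constructor
  · intro k l hkl he
    have h1 := minBefore_box hn hS hkl
    rw [minBlock_eq_iff] at he
    refine (top_label_lt_iff hn hS _ _).2 ?_
    change StdBefore S ((PSYT.minT S).box k) ((PSYT.minT S).box l)
    unfold MinBefore at h1
    unfold StdBefore
    omega
  · intro k l hkl he
    have h1 := minBefore_box hn hS hkl
    rw [Ne, minBlock_eq_iff] at he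
    refine (top_label_lt_iff hn hS _ _).2 ?_
    change StdBefore S ((PSYT.minT S).box l) ((PSYT.minT S).box k)
    have h2 := hS.col_lt (a := (PSYT.minT S).box k) (b := (PSYT.minT S).box l)
    unfold MinBefore at h1
    unfold StdBefore
    omega

/-- This ensures that words shorter than `minTop S` cannot lead from Min(S) to Top(S), see
`IsEigenFamily.basis_smul_mem`. -/
theorem len_minTop_le (hn : 0 < μ.card) (hS : IsRSSYT S) :
    len (minTop S) ≤ (Inv (PSYT.minT S)).card := by
  refine Finset.card_le_card_of_injOn
    (fun p => ((PSYT.minT S).box p.2, (PSYT.minT S).box p.1)) ?_ ?_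
  · intro p hp
    obtain ⟨h1, h2⟩ := mem_invs.1 (Finset.mem_coe.1 hp)
    refine Finset.mem_coe.2 (Finset.mem_filter.2 ⟨Finset.mem_univ _, ?_, ?_⟩)
    · rw [(minT_mem hn hS).1]
      exact (top_label_lt_iff hn hS _ _).1 h2
    · simpa using h1
  · intro p _ p' _ h
    obtain ⟨h1, h2⟩ := Prod.mk.inj h
    exact Prod.ext ((PSYT.minT S).label.symm.injective h2)
      ((PSYT.minT S).label.symm.injective h1)

section Module

set_option linter.unusedSectionVars false

variable {R : Type*} [Ring R] [Algebra K R] {T : Fin (μ.card - 1) → R} {θ : Fin μ.card → R}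
  {M : Type*} [AddCommGroup M] [Module K M] [Module R M] [IsScalarTower K R M]
  {F : PSYT μ → M}

variable (S F) in
/-- The span of the vectors that belong to tableaux with at least `k` inversions. -/
def invSpan (k : ℕ) : Submodule K M :=
  Submodule.span K {x | ∃ τ : PSYT μ, τ.wt = S ∧ k ≤ (Inv τ).card ∧ F τ = x}

theorem mem_invSpan {τ : PSYT μ} {k : ℕ} (h : τ.wt = S) (hk : k ≤ (Inv τ).card) :
    F τ ∈ invSpan S F k := Submodule.subset_span ⟨τ, h, hk, rfl⟩

theorem card_inv_le_sw (τ : PSYT μ) (i : Fin (μ.card - 1)) :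
    (Inv τ).card ≤ (Inv (τ.sw i)).card + 1 := by
  by_cases h : τ.Free i
  · rcases h with h | h
    · rw [PSYT.card_inv_sw' h]
      omega
    · exact (PSYT.card_inv_sw h).le
  · rw [PSYT.sw_of_not_free h]
    omega

theorem IsEigenFamily.T_smul_mem (hF : IsEigenFamily T θ F)
    (hT : ∀ a b, HeckeRel T a b → a = b) (i : Fin (μ.card - 1)) {k : ℕ} {x : M}
    (hx : x ∈ invSpan S F (k + 1)) : T i • x ∈ invSpan S F k := by
  induction hx using Submodule.span_induction with
  | mem x hx =>
    obtain ⟨τ, h1, h2, rfl⟩ := hx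
    rw [hF.T_smul hT]
    have := card_inv_le_sw τ i
    exact add_mem (Submodule.smul_mem _ _ (mem_invSpan h1 (by omega)))
      (Submodule.smul_mem _ _ (mem_invSpan (by rw [PSYT.sw_wt, h1]) (by omega)))
  | zero => rw [smul_zero]; exact zero_mem _
  | add x y _ _ hx hy => rw [smul_add]; exact add_mem hx hy
  | smul c x _ hx => rw [smul_comm]; exact Submodule.smul_mem _ _ hx

variable {D : Equiv.Perm (Fin μ.card) → R}

/-- Each T_i lowers the number of inversions by at most one, so a word of length `len σ` leaves at
least the remaining number. -/
theorem IsEigenFamily.basis_smul_mem (hF : IsEigenFamily T θ F)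
    (hT : ∀ a b, HeckeRel T a b → a = b) (hn : 0 < μ.card) (hS : IsRSSYT S) (h1 : D 1 = 1)
    (hD : ∀ σ i, σ.symm (lo i) < σ.symm (hi i) → D (simpleSwap i * σ) = T i * D σ)
    (σ : Equiv.Perm (Fin μ.card)) (k : ℕ) (hk : k + len σ ≤ (Inv (PSYT.minT S)).card) :
    D σ • F (PSYT.minT S) ∈ invSpan S F k := by
  obtain ⟨m, hm⟩ : ∃ m, len σ = m := ⟨_, rfl⟩
  induction m generalizing σ k with
  | zero =>
    rw [eq_one_of_len hm, h1, one_smul]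
    exact mem_invSpan (minT_mem hn hS).1 (by omega)
  | succ m ih =>
    obtain ⟨i, hi'⟩ := exists_descent_of_ne_one (σ := σ)
      (fun e => by rw [e, len_one] at hm; omega)
    have h2 := len_swap_mul hi'
    have h3 := hD (simpleSwap i * σ) i (by
      rw [symm_swap_mul, symm_swap_mul, Equiv.swap_apply_left, Equiv.swap_apply_right]
      exact hi')
    rw [← mul_assoc, Equiv.swap_mul_self, one_mul] at h3
    rw [h3, mul_smul]
    exact hF.T_smul_mem hT i (ih (simpleSwap i * σ) (k + 1) (by omega) (by omega))

/-- The path from Min(S) to `τ` consists of upward swaps, in which T_i F has the new vector with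
coefficient 1; all other terms have more inversions. -/
theorem IsEigenFamily.basis_smul_sub_mem (hF : IsEigenFamily T θ F)
    (hT : ∀ a b, HeckeRel T a b → a = b) (hn : 0 < μ.card) (hS : IsRSSYT S) (h1 : D 1 = 1)
    (hD : ∀ σ i, σ.symm (lo i) < σ.symm (hi i) → D (simpleSwap i * σ) = T i * D σ)
    (τ : PSYT μ) (hτ : τ.wt = S) :
    D ((PSYT.minT S).label.symm.trans τ.label) • F (PSYT.minT S) - F τ ∈
      invSpan S F ((Inv τ).card + 1) := by
  obtain ⟨m, hm⟩ : ∃ m, τ.rk = m := ⟨_, rfl⟩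
  induction m using Nat.strong_induction_on generalizing τ with
  | _ m ih =>
    by_cases h : invs (MinBefore τ.wt) τ.label = ∅
    · have e : τ = PSYT.minT S := PSYT.eq_of_min_empty (hτ.trans (minT_mem hn hS).1.symm) h
        (by rw [(minT_mem hn hS).1]; exact (minT_mem hn hS).2)
      have e2 : (PSYT.minT S).label.symm.trans (PSYT.minT S).label = 1 :=
        Equiv.symm_trans_self _
      rw [e, e2, h1, one_smul, sub_self]
      exact zero_mem _
    · obtain ⟨i, hi'⟩ := PSYT.exists_down h
      have hf : τ.Free i := Or.inl hi'
      have hwt : (τ.sw i).wt = S := by rw [PSYT.sw_wt, hτ]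
      have h2 := ih _ (by rw [← hm]; exact PSYT.rk_sw_lt hi') (τ.sw i) hwt rfl
      set σ := (PSYT.minT S).label.symm.trans (τ.sw i).label with hσ
      have h3 : (PSYT.minT S).label.symm.trans τ.label = simpleSwap i * σ := by
        ext x
        rw [hσ, PSYT.sw_label hf]
        simp
      have h4 : D (simpleSwap i * σ) = T i * D σ := by
        apply hD
        change (PSYT.minT S).label ((τ.sw i).box (lo i)) <
          (PSYT.minT S).label ((τ.sw i).box (hi i))
        rw [min_label_lt_iff hn hS, PSYT.sw_box_lo hf, PSYT.sw_box_hi hf, ← hτ]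
        exact hi'.minBefore
      have h5 := hF.T_smul hT (τ.sw i) i
      have h6 : StrongBefore (τ.sw i).wt ((τ.sw i).box (hi i)) ((τ.sw i).box (lo i)) := by
        rwa [PSYT.sw_wt, PSYT.sw_box_lo hf, PSYT.sw_box_hi hf]
      rw [swapMult, if_pos h6, one_smul, PSYT.sw_sw hf] at h5
      have h7 := PSYT.card_inv_sw' hi'
      have h8 : D (simpleSwap i * σ) • F (PSYT.minT S) - F τ =
          T i • (D σ • F (PSYT.minT S) - F (τ.sw i)) +
            swapCoeff (τ.sw i).wt ((τ.sw i).box (hi i)) ((τ.sw i).box (lo i)) • F (τ.sw i) := by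
        rw [smul_sub, h5, h4, mul_smul]
        abel
      rw [h3, h8]
      refine add_mem ?_ (Submodule.smul_mem _ _ (mem_invSpan hwt h7.ge))
      have := hF.T_smul_mem hT i h2
      rwa [h7] at this

/-- The generators of the Young subgroup exchange labels of one row of Min(S) with the same
exponent, and there T_i acts by 1. -/
theorem IsEigenFamily.basis_mul_smul (hF : IsEigenFamily T θ F)
    (hT : ∀ a b, HeckeRel T a b → a = b) (hn : 0 < μ.card) (hS : IsRSSYT S)
    (hD : ∀ σ i, σ (lo i) < σ (hi i) → D (σ * simpleSwap i) = D σ * T i)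
    {v : Equiv.Perm (Fin μ.card)} (hv : v ∈ blockSubgroup (minBlock S))
    (σ : Equiv.Perm (Fin μ.card)) :
    D (σ * v) • F (PSYT.minT S) = D σ • F (PSYT.minT S) := by
  induction hv using Subgroup.closure_induction generalizing σ with
  | mem x hx =>
    obtain ⟨i, rfl, h⟩ := hx
    have h1 : T i • F (PSYT.minT S) = F (PSYT.minT S) := by
      have hw := (minT_mem hn hS).1
      have hf : ¬(PSYT.minT S).Free i := by
        have h2 := minBefore_box hn hS (k := lo i) (l := hi i) (by simp [lo, hi, Fin.lt_def])
        rw [minBlock_eq_iff] at h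
        unfold PSYT.Free StrongBefore
        rw [hw]
        omega
      have h2 := hF.T_smul hT (PSYT.minT S) i
      have h3 : swapMult (PSYT.minT S) i = 0 := by
        unfold PSYT.Free at hf
        push Not at hf
        rw [swapMult, if_neg hf.2, if_neg hf.1]
      rw [h2, h3, zero_smul, add_zero, IsRSSYT.swapCoeff_eq_one (by rwa [hw]) hf, one_smul]
    rcases lt_or_gt_of_ne (fun e => lo_ne_hi i (σ.injective e)) with h2 | h2
    · rw [hD σ i h2, mul_smul, h1]
    · have h3 := hD (σ * simpleSwap i) i (by
        rw [Equiv.Perm.mul_apply, Equiv.Perm.mul_apply, Equiv.swap_apply_left,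
          Equiv.swap_apply_right]
        exact h2)
      rw [mul_assoc, Equiv.swap_mul_self, mul_one] at h3
      rw [h3, mul_smul, h1]
  | one => rw [mul_one]
  | mul x y _ _ hx hy => rw [← mul_assoc, hy, hx]
  | inv x _ hx => rw [← hx (σ * x⁻¹), inv_mul_cancel_right]

theorem exists_coeff (hn : 0 < μ.card) (hS : IsRSSYT S) {x : M} (hx : x ∈ invSpan S F 1) :
    ∃ c : PSYTOf S → K, c ⟨PSYT.topT S, (topT_mem hn hS).1⟩ = 0 ∧
      x = ∑ τ : PSYTOf S, c τ • F τ.1 := by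
  induction hx using Submodule.span_induction with
  | mem x hx =>
    obtain ⟨τ, h1, h2, rfl⟩ := hx
    refine ⟨Pi.single ⟨τ, h1⟩ 1, ?_, ?_⟩
    · rw [Pi.single_apply, if_neg]
      intro e
      obtain rfl : PSYT.topT S = τ := congrArg Subtype.val e
      rw [(topT_mem hn hS).2] at h2
      simp at h2
    · simp [Pi.single_apply, ite_smul]
  | zero => exact ⟨0, rfl, by simp⟩
  | add x y _ _ hx hy =>
    obtain ⟨c, hc, rfl⟩ := hx
    obtain ⟨d, hd, rfl⟩ := hy
    exact ⟨c + d, by simp [hc, hd], by simp [add_smul, Finset.sum_add_distrib]⟩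
  | smul a x _ hx =>
    obtain ⟨c, hc, rfl⟩ := hx
    exact ⟨a • c, by simp [hc], by simp [Finset.smul_sum, mul_smul]⟩

/-- The symmetrization of the vector that belongs to `Min(S)`. -/
theorem IsEigenFamily.trivIdem_smul_min (hF : IsEigenFamily T θ F)
    (hT : ∀ a b, HeckeRel T a b → a = b) (hn : 0 < μ.card) (hS : IsRSSYT S) :
    trivIdem T • F (PSYT.minT S) = (muFactorial S / tFactorial μ.card) • symVec F S := by
  obtain ⟨D, h1, hl, hr, -, hε⟩ := exists_T_basis hT
  have hβ := minBlock_monotone hn hS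
  have hg := minTop_isBlockReversal hn hS
  have htop := topT_mem hn hS
  -- Modulo vectors with at least one inversion, T_σ F_{Min(S)} is F_{Top(S)} if `σ` lies in the
  -- coset of `minTop S`, and zero otherwise.
  have hδ : ∀ σ : Equiv.Perm (Fin μ.card), D σ • F (PSYT.minT S) -
      (if (minTop S)⁻¹ * σ ∈ blockSubgroup (minBlock S) then (1 : K) else 0) • F (PSYT.topT S) ∈
        invSpan S F 1 := by
    intro σ
    split_ifs with h
    · have e := hF.basis_mul_smul hT hn hS hr h (minTop S)
      rw [mul_inv_cancel_left] at e
      have := hF.basis_smul_sub_mem hT hn hS h1 hl (PSYT.topT S) htop.1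
      rw [htop.2] at this
      rw [e, one_smul]
      exact this
    · rw [zero_smul, sub_zero]
      -- Outside that coset, the representative that is increasing on blocks is strictly shorter
      -- than `minTop S`, so Top(S) is out of reach.
      obtain ⟨v, hv, hinc⟩ := exists_increasing hβ σ
      rw [← hF.basis_mul_smul hT hn hS hr hv]
      rcases hg.eq_or_len_lt hinc with h2 | h2
      · exfalso
        apply h
        rw [← h2, mul_inv_rev, inv_mul_cancel_right]
        exact inv_mem hv
      · apply hF.basis_smul_mem hT hn hS h1 hl
        have := len_minTop_le hn hS
        omega
  have hsum : trivIdem T • F (PSYT.minT S) -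
      (muFactorial S / tFactorial μ.card) • F (PSYT.topT S) ∈ invSpan S F 1 := by
    have e1 : muFactorial S = ∑ σ : Equiv.Perm (Fin μ.card), t ^ nonInv σ *
        (if (minTop S)⁻¹ * σ ∈ blockSubgroup (minBlock S) then (1 : K) else 0) := by
      have e2 := hg.sum_eq hβ
      rw [← youngSubgroup_eq hn hS] at e2 ⊢
      simp only [mul_ite, mul_one, mul_zero, ← Finset.sum_filter]
      rw [e2]
      rfl
    have e3 : trivIdem T • F (PSYT.minT S) -
        (muFactorial S / tFactorial μ.card) • F (PSYT.topT S) = (tFactorial μ.card)⁻¹ •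
        ∑ σ : Equiv.Perm (Fin μ.card), t ^ nonInv σ • (D σ • F (PSYT.minT S) -
      (if (minTop S)⁻¹ * σ ∈ blockSubgroup (minBlock S) then (1 : K) else 0) •
        F (PSYT.topT S)) := by
      simp only [smul_sub, Finset.sum_sub_distrib, smul_smul]
      rw [← Finset.sum_smul, ← e1, hε, smul_assoc, Finset.sum_smul, smul_smul, mul_comm (_⁻¹),
        ← div_eq_mul_inv]
      congr 2
      refine Finset.sum_congr rfl fun σ _ => ?_
      rw [zpow_choose_sub_len, smul_assoc]
    rw [e3]
    exact Submodule.smul_mem _ _ (Submodule.sum_mem _ fun σ _ => Submodule.smul_mem _ _ (hδ σ))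
  obtain ⟨c, hc, hx⟩ := exists_coeff hn hS hsum
  let a : PSYTOf S := ⟨PSYT.topT S, htop.1⟩
  let c' : PSYTOf S → K := c + Pi.single a (muFactorial S / tFactorial μ.card)
  have e : trivIdem T • F (PSYT.minT S) = ∑ τ : PSYTOf S, c' τ • F τ.1 := by
    rw [sub_eq_iff_eq_add] at hx
    rw [hx]
    simp [c', add_smul, Finset.sum_add_distrib, Pi.single_apply, ite_smul, a]
  have e2 : c' a = muFactorial S / tFactorial μ.card := by
    simp only [c', Pi.add_apply, Pi.single_eq_same]
    rw [hc, zero_add]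
  rw [← e2, e]
  -- The symmetrized vector is invariant, hence determined by its coefficient `c' a` at Top(S).
  refine hF.invariant_eq hT hn hS c' fun i => ?_
  rw [← e, ← mul_smul, T_mul_trivIdem hT]

/-- How symmetrization interacts with the intertwiners. -/
theorem IsEigenFamily.trivIdem_smul_sw (hF : IsEigenFamily T θ F)
    (hT : ∀ a b, HeckeRel T a b → a = b) {τ : PSYT μ} {i : Fin (μ.card - 1)}
    (h : StrongBefore τ.wt (τ.box (hi i)) (τ.box (lo i))) :
    trivIdem T • F (τ.sw i) =
      (t + swapCoeff τ.wt (τ.box (lo i)) (τ.box (hi i))) • (trivIdem T • F τ) := by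
  rw [hF.up τ i h, opB_smul', smul_add, ← mul_smul, trivIdem_mul_T hT, smul_comm (trivIdem T) (_ : K)]
  nth_rw 1 [← one_smul K (trivIdem T • F τ)]
  rw [← add_smul]
  congr 1
  ring

/-- Climbing to the top removes the inversions one at a time, and each upward swap multiplies the
symmetrization by the non-zero factor of the removed pair. The first identity serves for Min(S), the
second for arbitrary `τ`. -/
theorem IsEigenFamily.trivIdem_smul_top (hF : IsEigenFamily T θ F)
    (hT : ∀ a b, HeckeRel T a b → a = b) (hn : 0 < μ.card) (τ : PSYT μ) :
    trivIdem T • F (PSYT.topT τ.wt) = (∏ p ∈ Inv τ,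
      (boxWeight τ.wt p.1 - boxWeight τ.wt p.2 * t) / (boxWeight τ.wt p.1 - boxWeight τ.wt p.2)) •
        (trivIdem T • F τ) ∧
    trivIdem T • F τ = (∏ p ∈ Inv τ,
      (boxWeight τ.wt p.1 - boxWeight τ.wt p.2) / (boxWeight τ.wt p.1 - boxWeight τ.wt p.2 * t)) •
        (trivIdem T • F (PSYT.topT τ.wt)) := by
  obtain ⟨m, hm⟩ : ∃ m, (Inv τ).card = m := ⟨_, rfl⟩
  induction m generalizing τ with
  | zero =>
    obtain ⟨h1, h2⟩ := PSYT.topT_spec τ hn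
    have h3 := Finset.card_eq_zero.1 hm
    rw [← PSYT.eq_of_inv_empty h1.symm h3 h2, h3]
    simp
  | succ m ih =>
    obtain ⟨i, h⟩ := PSYT.exists_up (τ := τ) (fun e => by rw [e] at hm; simp at hm)
    obtain ⟨h1, h2⟩ := PSYT.inv_sw h
    obtain ⟨ih1, ih2⟩ := ih (τ.sw i) (by have := PSYT.card_inv_sw h; omega)
    rw [PSYT.sw_wt] at ih1 ih2
    have h3 := h.add_swapCoeff_ne_zero
    rw [hF.trivIdem_smul_sw hT h] at ih1 ih2
    rw [add_swapCoeff h.weight_ne.symm] at ih1 ih2 h3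
    rw [h2, Finset.prod_insert h1, Finset.prod_insert h1]
    constructor
    · rw [ih1, smul_smul, mul_comm]
    · rw [mul_smul, ← ih2, smul_smul, ← inv_div, inv_mul_cancel₀ h3, one_smul]

/-- The symmetrization of the vectors `F_τ`. -/
theorem IsEigenFamily.trivIdem_smul (hF : IsEigenFamily T θ F)
    (hT : ∀ a b, HeckeRel T a b → a = b) (hn : 0 < μ.card) {τ : PSYT μ} (hS : IsRSSYT τ.wt) :
    trivIdem T • F τ = (KT τ.wt * ∏ p ∈ Inv τ,
      (boxWeight τ.wt p.1 - boxWeight τ.wt p.2) /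
        (boxWeight τ.wt p.1 - boxWeight τ.wt p.2 * t)) • symVec F τ.wt := by
  have h1 := (hF.trivIdem_smul_top hT hn (PSYT.minT τ.wt)).1
  rw [(minT_mem hn hS).1, hF.trivIdem_smul_min hT hn hS, smul_smul, mul_comm] at h1
  rw [(hF.trivIdem_smul_top hT hn τ).2, h1, smul_smul, mul_comm]
  rfl

/-- The symmetrization vanishes if the exponents are not strictly decreasing in the columns. -/
theorem IsEigenFamily.trivIdem_smul_eq_zero (hF : IsEigenFamily T θ F)
    (hT : ∀ a b, HeckeRel T a b → a = b) (hn : 0 < μ.card) {τ : PSYT μ} (hS : ¬IsRSSYT τ.wt) :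
    trivIdem T • F τ = 0 := by
  rw [(hF.trivIdem_smul_top hT hn τ).2]
  obtain ⟨hw, hinv⟩ := PSYT.topT_spec τ hn
  set ρ := PSYT.topT τ.wt
  rw [← hw] at hS
  suffices h : trivIdem T • F ρ = 0 by rw [h, smul_zero]
  -- Exponents of a tableau always decrease weakly, so the failure must be an equality in a column,
  -- and it occurs between vertical neighbours.
  obtain ⟨a, b, hc, hr, hab⟩ : ∃ a b : Box μ, a.col = b.col ∧ b.row = a.row + 1 ∧
      ρ.wt a = ρ.wt b := by
    by_contra hcon
    push Not at hcon
    refine hS ⟨fun a b h1 h2 => ρ.wt_le h1.le h2.le, fun a b h1 h2 => ?_⟩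
    obtain ⟨x, hx1, hx2⟩ := exists_box (b := b) (r := a.row + 1) (c := b.col) h2 le_rfl
    have h3 := hcon a x (by omega) hx1
    have h4 := ρ.wt_le (a := a) (b := x) (by omega) (by omega)
    have h5 := ρ.wt_le (a := x) (b := b) (by omega) (by omega)
    omega
  have hlt : ∀ x y, ρ.label x < ρ.label y ↔ StdBefore ρ.wt x y := by
    rw [PSYT.inv_eq_invs] at hinv
    exact lt_iff_of_invs_eq_empty (stdBefore_total _) hinv (stdBefore_asymm _)
  have h1 : ρ.label a < ρ.label b := (hlt a b).2 (Or.inr ⟨hab, Or.inr ⟨hc, by omega⟩⟩)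
  -- Top numbers boxes of equal exponent column by column, so nothing comes between two vertical
  -- neighbours.
  have h2 : (ρ.label b).1 = (ρ.label a).1 + 1 := by
    by_contra hne
    have hk : (ρ.label a).1 + 1 < μ.card := by
      have := (ρ.label b).2
      rw [Fin.lt_def] at h1
      omega
    let x := ρ.box ⟨(ρ.label a).1 + 1, hk⟩
    have hx : ρ.label x = ⟨(ρ.label a).1 + 1, hk⟩ := Equiv.apply_symm_apply _ _
    have h3 : StdBefore ρ.wt a x := by
      rw [← hlt, hx, Fin.lt_def]
      simp
    have h4 : StdBefore ρ.wt x b := by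
      rw [← hlt, hx, Fin.lt_def]
      simp only
      rw [Fin.lt_def] at h1
      omega
    unfold StdBefore at h3 h4
    omega
  let i : Fin (μ.card - 1) := ⟨(ρ.label a).1, by have := (ρ.label b).2; omega⟩
  have ha : ρ.box (lo i) = a := by
    have : lo i = ρ.label a := rfl
    rw [this]
    exact Equiv.symm_apply_apply _ _
  have hb : ρ.box (hi i) = b := by
    have : hi i = ρ.label b := Fin.ext (by simp [hi, i, h2])
    rw [this]
    exact Equiv.symm_apply_apply _ _
  have h3 := hF.T_smul hT ρ i
  have h4 : swapMult ρ i = 0 := by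
    unfold swapMult StrongBefore
    rw [ha, hb, if_neg (by omega), if_neg (by omega)]
  rw [h4, zero_smul, add_zero, ha, hb, swapCoeff_col hab hc hr] at h3
  -- T_i acts on `F ρ` by -t and is absorbed by the symmetrizer, so the symmetrization is killed by
  -- 1 + t, a divisor of 1 - t².
  have h5 : trivIdem T • F ρ = (-t) • (trivIdem T • F ρ) := by
    rw [smul_comm, ← h3, ← mul_smul, trivIdem_mul_T hT]
  have h6 : (1 + t) • (trivIdem T • F ρ) = 0 := by
    rw [add_smul, one_smul]
    nth_rw 1 [h5]
    rw [neg_smul, neg_add_cancel]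
  refine (smul_eq_zero.1 h6).resolve_left fun h7 => ?_
  apply one_sub_t_pow_ne_zero 1
  linear_combination (1 - t) * h7

end Module

end

end VVMacdonald

/-! ### The induced module and the existence of the non-symmetric Macdonald polynomials. -/

namespace VVMacdonald

noncomputable section

open Classical TensorProduct

variable {μ : YoungDiagram}

/-! ### The algebra `D_n` -/

theorem map_piElt {R R' : Type*} [Ring R] [Algebra K R] [Ring R'] [Algebra K R'] {n : ℕ}
    (f : R →ₐ[K] R') (T : Fin (n - 1) → R) (θ : Fin n → R) :
    f (piElt T θ) = piElt (fun i => f (T i)) fun i => f (θ i) := by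
  unfold piElt
  split_ifs with h
  · simp [map_list_prod, List.map_ofFn, Function.comp_def, map_hInv]
  · exact map_one f

theorem DoubleAlg.rel {n : ℕ} (a b : DoubleAlg n)
    (h : DoubleRel (n := n) DoubleAlg.T DoubleAlg.theta DoubleAlg.X a b) : a = b := by
  cases h with
  | affine _ _ h =>
    cases h with
    | hecke _ _ h =>
      cases h with
      | quad i =>
        simpa [DoubleAlg.T] using DoubleAlg.mk_rel (.affine _ _ (.hecke _ _ (.quad i)))
      | braid i j h =>
        simpa [DoubleAlg.T] using DoubleAlg.mk_rel (.affine _ _ (.hecke _ _ (.braid i j h)))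
      | comm i j h =>
        simpa [DoubleAlg.T] using DoubleAlg.mk_rel (.affine _ _ (.hecke _ _ (.comm i j h)))
    | theta_comm i j =>
      simpa [DoubleAlg.theta] using DoubleAlg.mk_rel (.affine _ _ (.theta_comm i j))
    | theta_succ i =>
      simpa [DoubleAlg.theta, DoubleAlg.T, map_hInv] using
        DoubleAlg.mk_rel (.affine _ _ (.theta_succ i))
    | T_theta i j h₁ h₂ =>
      simpa [DoubleAlg.theta, DoubleAlg.T] using
        DoubleAlg.mk_rel (.affine _ _ (.T_theta i j h₁ h₂))
  | X_comm i j => simpa [DoubleAlg.X] using DoubleAlg.mk_rel (.X_comm i j)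
  | X_succ i => simpa [DoubleAlg.X, DoubleAlg.T, map_hInv] using DoubleAlg.mk_rel (.X_succ i)
  | T_X i j h₁ h₂ => simpa [DoubleAlg.X, DoubleAlg.T] using DoubleAlg.mk_rel (.T_X i j h₁ h₂)
  | pi_X i =>
    have := DoubleAlg.mk_rel (.pi_X i)
    rw [map_mul, map_mul, map_piElt] at this
    exact this
  | pi_X_last i j hlast hfirst =>
    have := DoubleAlg.mk_rel (.pi_X_last i j hlast hfirst)
    rw [map_mul, map_smul, map_mul, map_piElt] at this
    exact this

theorem DoubleAlg.heckeRel {n : ℕ} (a b : DoubleAlg n) (h : HeckeRel (n := n) DoubleAlg.T a b) :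
    a = b := DoubleRel.toHecke DoubleAlg.rel a b h

/-! ### The induced module -/

theorem V.incl_smul_one (a : AffineAlg μ.card) (v : Specht μ) :
    incl μ.card a • V.one v = V.one (rho μ.card a • v) := by
  rw [V.one, V.one, ← Submodule.Quotient.mk_smul, TensorProduct.smul_tmul', smul_eq_mul, mul_one,
    Submodule.Quotient.eq]
  exact Submodule.subset_span ⟨1, a, v, by rw [one_mul]⟩

theorem V.one_add (v w : Specht μ) : V.one (v + w) = V.one v + V.one w := by
  rw [V.one, V.one, V.one, TensorProduct.tmul_add, Submodule.Quotient.mk_add]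

theorem V.one_smul' (c : K) (v : Specht μ) : V.one (c • v) = c • V.one v := by
  rw [V.one, V.one, TensorProduct.tmul_smul, Submodule.Quotient.mk_smul]

theorem exists_affine {n : ℕ} (g : AffineGen n) :
    ∃ a, incl n a = inclGen n g ∧ rho n a = rhoGen n g :=
  ⟨RingQuot.mkAlgHom K _ (FreeAlgebra.ι K g),
    (RingQuot.liftAlgHom_mkAlgHom_apply K _ _ _).trans (FreeAlgebra.lift_ι_apply _ _),
    (RingQuot.liftAlgHom_mkAlgHom_apply K _ _ _).trans (FreeAlgebra.lift_ι_apply _ _)⟩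

/-- The generators `T_i` act on `1 ⊗ v` through `H_n`. -/
theorem V.T_smul_one (i : Fin (μ.card - 1)) (v : Specht μ) :
    DoubleAlg.T i • V.one v = V.one (HeckeAlg.T i • v) := by
  obtain ⟨a, h1, h2⟩ := exists_affine (AffineGen.T i)
  have := V.incl_smul_one a v
  rwa [h1, h2] at this

theorem V.theta_smul_one (i : Fin μ.card) (v : Specht μ) :
    DoubleAlg.theta i • V.one v = V.one (thetaBar HeckeAlg.T i • v) := by
  obtain ⟨a, h1, h2⟩ := exists_affine (AffineGen.theta i)
  have := V.incl_smul_one a v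
  rwa [h1, h2] at this

theorem V.opA_smul_one (i : Fin (μ.card - 1)) (v : Specht μ) :
    opA DoubleAlg.T i • V.one v = V.one (opA HeckeAlg.T i • v) := by
  rw [opA_eq, opA_eq, add_smul, add_smul, V.one_add, V.T_smul_one, smul_assoc, smul_assoc,
    one_smul, one_smul, V.one_smul']

theorem Specht.eq_zero_of_rel {x : SYT μ →₀ HeckeAlg μ.card} (h : SpechtRel μ x) :
    (Submodule.Quotient.mk x : Specht μ) = 0 :=
  (Submodule.Quotient.mk_eq_zero _).2 (Submodule.subset_span h)

theorem Specht.theta_smul_vec (τ : SYT μ) (i : Fin μ.card) :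
    thetaBar HeckeAlg.T i • Specht.vec τ = t ^ τ.1.c i • Specht.vec τ := by
  have := Specht.eq_zero_of_rel (.theta τ i)
  rwa [Submodule.Quotient.mk_sub, sub_eq_zero, Submodule.Quotient.mk_smul,
    Submodule.Quotient.mk_smul] at this

theorem Specht.phi_smul_vec {τ σ : SYT μ} {i : Fin (μ.card - 1)} (h : PSYT.IsSwap i τ.1 σ.1)
    (hlt : PSYT.Lt τ.1 σ.1) : phiBar HeckeAlg.T i • Specht.vec τ =
      (t ^ τ.1.c (lo i) - t ^ τ.1.c (hi i)) • Specht.vec σ := by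
  have := Specht.eq_zero_of_rel (.phi τ σ i h hlt)
  rwa [Submodule.Quotient.mk_sub, sub_eq_zero, Submodule.Quotient.mk_smul,
    Submodule.Quotient.mk_smul] at this

theorem Specht.row_smul_vec (τ : SYT μ) (i : Fin (μ.card - 1))
    (h : (τ.1.box (lo i)).row = (τ.1.box (hi i)).row) :
    HeckeAlg.T i • Specht.vec τ = Specht.vec τ := by
  have := Specht.eq_zero_of_rel (.row τ i h)
  rwa [Submodule.Quotient.mk_sub, sub_eq_zero, Submodule.Quotient.mk_smul] at this

theorem Specht.col_smul_vec (τ : SYT μ) (i : Fin (μ.card - 1))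
    (h : (τ.1.box (lo i)).col = (τ.1.box (hi i)).col) :
    HeckeAlg.T i • Specht.vec τ = -(t • Specht.vec τ) := by
  have := Specht.eq_zero_of_rel (.col τ i h)
  rwa [Submodule.Quotient.mk_add, add_eq_zero_iff_eq_neg, Submodule.Quotient.mk_smul,
    Submodule.Quotient.mk_smul] at this

theorem boxWeight_syt (τ : SYT μ) (b : Box μ) : boxWeight τ.1.wt b = t ^ b.content := by
  rw [boxWeight, τ.2, pow_zero, one_mul]

theorem V.theta_smul_vec (τ : SYT μ) (i : Fin μ.card) :
    DoubleAlg.theta i • V.one (Specht.vec τ) =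
      boxWeight τ.1.wt (τ.1.box i) • V.one (Specht.vec τ) := by
  rw [V.theta_smul_one, Specht.theta_smul_vec, V.one_smul', boxWeight_syt]
  rfl

/-- The element φ̄_i acts as the commutator of t T_i⁻¹ and θ_i. On a joint eigenvector this
commutator is the difference of two weights times the intertwiner, and dividing by that difference
gives the formula. -/
theorem V.up_vec (hn : 0 < μ.card) (τ σ : SYT μ) (i : Fin (μ.card - 1))
    (h : StrongBefore τ.1.wt (τ.1.box (hi i)) (τ.1.box (lo i))) (hσ : σ.1 = τ.1.sw i) :
    V.one (Specht.vec σ) = opB DoubleAlg.T i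
      (swapCoeff τ.1.wt (τ.1.box (lo i)) (τ.1.box (hi i))) • V.one (Specht.vec τ) := by
  obtain ⟨h1, h2⟩ := (PSYT.isSwap_lt_iff hn).2 ⟨h, hσ⟩
  have e := congrArg V.one (Specht.phi_smul_vec h1 h2)
  have e1 : V.one (phiBar HeckeAlg.T i • Specht.vec τ) =
      (opA DoubleAlg.T i * DoubleAlg.theta (lo i) - DoubleAlg.theta (lo i) * opA DoubleAlg.T i) •
        V.one (Specht.vec τ) := by
    have e2 : phiBar HeckeAlg.T i • Specht.vec τ + thetaBar HeckeAlg.T (lo i) •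
        opA HeckeAlg.T i • Specht.vec τ = opA HeckeAlg.T i • thetaBar HeckeAlg.T (lo i) •
          Specht.vec τ := by
      rw [phiBar, sub_smul, mul_smul, mul_smul]
      exact sub_add_cancel _ _
    rw [sub_smul, mul_smul, mul_smul, eq_sub_iff_add_eq, V.theta_smul_one, V.opA_smul_one,
      V.opA_smul_one, V.theta_smul_one, ← V.one_add, e2]
  rw [e1, V.one_smul', opA_mul_theta_hi (DoubleRel.toAffine DoubleAlg.rel)] at e
  have hw : ∀ j, t ^ τ.1.c j = boxWeight τ.1.wt (τ.1.box j) := fun j => (boxWeight_syt τ _).symm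
  rw [hw, hw, sub_smul, sub_smul, mul_smul, mul_smul, smul_assoc, V.theta_smul_vec,
    V.theta_smul_vec, smul_comm (opA _ i) (_ : K), smul_comm (opA _ i) (_ : K), smul_smul,
    ← sub_add, ← sub_smul] at e
  have hne := sub_ne_zero.2 h.weight_ne.symm
  rw [opB_smul, swapCoeff]
  have e3 := congrArg (fun x => (boxWeight τ.1.wt (τ.1.box (lo i)) -
    boxWeight τ.1.wt (τ.1.box (hi i)))⁻¹ • x) e
  simp only [smul_add, smul_smul, inv_mul_cancel₀ hne, one_smul] at e3
  rw [← e3, div_eq_inv_mul]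

theorem V.adjacent_vec (τ : SYT μ) (i : Fin (μ.card - 1))
    (h : PSYT.Adjacent τ.1.wt (τ.1.box (lo i)) (τ.1.box (hi i))) :
    opB DoubleAlg.T i (swapCoeff τ.1.wt (τ.1.box (lo i)) (τ.1.box (hi i))) •
      V.one (Specht.vec τ) = 0 := by
  have h1 := swapCoeff_add h.weight_ne
  rw [opB_smul', V.T_smul_one]
  obtain ⟨h0, ⟨hr, hc⟩ | ⟨hc, hr⟩⟩ := h
  · rw [swapCoeff_row h0 hr hc] at h1
    rw [Specht.row_smul_vec τ i hr, eq_sub_of_add_eq h1]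
    nth_rw 1 [← one_smul K (V.one _)]
    rw [← add_smul]
    convert zero_smul K _
    ring
  · rw [swapCoeff_col h0 hc hr] at h1
    rw [Specht.col_smul_vec τ i hc, eq_sub_of_add_eq h1, ← neg_smul, V.one_smul', ← add_smul]
    convert zero_smul K _
    ring

/-- A family with all the properties of the non-symmetric Macdonald polynomials. -/
theorem exists_macdonald (hn : 0 < μ.card) : ∃ F : PSYT μ → V μ,
    IsFamily DoubleAlg.T DoubleAlg.X hn F ∧ IsEigenFamily DoubleAlg.T DoubleAlg.theta F ∧
      ∀ τ : SYT μ, F τ.1 = V.one (Specht.vec τ) := by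
  obtain ⟨F, h1, h2⟩ := exists_isFamily (M := V μ) DoubleAlg.rel hn
    (fun τ => V.one (Specht.vec τ)) (V.up_vec hn)
  refine ⟨F, h1, ⟨h1.up, h1.weight DoubleAlg.rel fun τ i => ?_,
    h1.adjacent DoubleAlg.rel fun τ i h => ?_⟩, h2⟩
  · rw [h2, V.theta_smul_vec]
  · rw [h2, V.adjacent_vec τ i h]

theorem IsFamily.opY_smul {hn : 0 < μ.card} {F : PSYT μ → V μ}
    (hY : IsFamily DoubleAlg.T DoubleAlg.X hn F) (τ : PSYT μ) :
    opY DoubleAlg.T DoubleAlg.X hn • F τ = t ^ τ.c ⟨0, hn⟩ • F τ.Psi := by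
  rw [hY.psi, smul_inv_smul₀ (zpow_ne_zero _ t_ne_zero)]

section Span

variable {F : PSYT μ → V μ}

/-- This and the following lemmas show that the F_τ span the whole induced module: their span is
stable under all generators of D_n and contains the vectors `V.one v`. This is used to prove that
π_n is injective. -/
theorem span_T_stable (hF : IsEigenFamily DoubleAlg.T DoubleAlg.theta F) (i : Fin (μ.card - 1))
    {x : V μ} (hx : x ∈ Submodule.span K (Set.range F)) :
    DoubleAlg.T i • x ∈ Submodule.span K (Set.range F) := by
  induction hx using Submodule.span_induction with
  | mem x hx =>
    obtain ⟨τ, rfl⟩ := hx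
    rw [hF.T_smul DoubleAlg.heckeRel]
    exact add_mem (Submodule.smul_mem _ _ (Submodule.subset_span ⟨_, rfl⟩))
      (Submodule.smul_mem _ _ (Submodule.subset_span ⟨_, rfl⟩))
  | zero => rw [smul_zero]; exact zero_mem _
  | add x y _ _ hx hy => rw [smul_add]; exact add_mem hx hy
  | smul c x _ hx => rw [smul_comm]; exact Submodule.smul_mem _ _ hx

theorem span_theta_stable (hF : IsEigenFamily DoubleAlg.T DoubleAlg.theta F) (i : Fin μ.card)
    {x : V μ} (hx : x ∈ Submodule.span K (Set.range F)) :
    DoubleAlg.theta i • x ∈ Submodule.span K (Set.range F) := by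
  induction hx using Submodule.span_induction with
  | mem x hx =>
    obtain ⟨τ, rfl⟩ := hx
    rw [hF.weight]
    exact Submodule.smul_mem _ _ (Submodule.subset_span ⟨_, rfl⟩)
  | zero => rw [smul_zero]; exact zero_mem _
  | add x y _ _ hx hy => rw [smul_add]; exact add_mem hx hy
  | smul c x _ hx => rw [smul_comm]; exact Submodule.smul_mem _ _ hx

theorem span_opY_stable {hn : 0 < μ.card} (hY : IsFamily DoubleAlg.T DoubleAlg.X hn F)
    {x : V μ} (hx : x ∈ Submodule.span K (Set.range F)) :
    opY DoubleAlg.T DoubleAlg.X hn • x ∈ Submodule.span K (Set.range F) := by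
  induction hx using Submodule.span_induction with
  | mem x hx =>
    obtain ⟨τ, rfl⟩ := hx
    rw [hY.opY_smul]
    exact Submodule.smul_mem _ _ (Submodule.subset_span ⟨_, rfl⟩)
  | zero => rw [smul_zero]; exact zero_mem _
  | add x y _ _ hx hy => rw [smul_add]; exact add_mem hx hy
  | smul c x _ hx => rw [smul_comm]; exact Submodule.smul_mem _ _ hx

theorem span_list_stable {W : Submodule K (V μ)} {l : List (DoubleAlg μ.card)}
    (hl : ∀ a ∈ l, ∀ x ∈ W, a • x ∈ W) {x : V μ} (hx : x ∈ W) : l.prod • x ∈ W := by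
  induction l with
  | nil => rwa [List.prod_nil, one_smul]
  | cons a l ih =>
    rw [List.prod_cons, mul_smul]
    exact hl a (by simp) _ (ih fun b hb => hl b (by simp [hb]))

theorem span_X_stable {hn : 0 < μ.card} (hY : IsFamily DoubleAlg.T DoubleAlg.X hn F)
    (hF : IsEigenFamily DoubleAlg.T DoubleAlg.theta F) (i : Fin μ.card)
    {x : V μ} (hx : x ∈ Submodule.span K (Set.range F)) :
    DoubleAlg.X i • x ∈ Submodule.span K (Set.range F) := by
  obtain ⟨d, hd⟩ : ∃ d, i.1 + d = μ.card - 1 := ⟨μ.card - 1 - i.1, by omega⟩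
  induction d generalizing i x with
  | zero =>
    have e1 : i = ⟨μ.card - 1, by omega⟩ := Fin.ext (by simpa using hd)
    -- X_n is recovered from Y and the inverses of the T_i; the other X_i follow downwards from X_i
    -- = t⁻¹ T_i X_{i+1} T_i.
    have e2 : DoubleAlg.X i = t ^ (μ.card - 1) • (opY DoubleAlg.T DoubleAlg.X hn *
        descInv (n := μ.card) DoubleAlg.T) := by
      rw [opY, smul_mul_assoc, smul_smul, mul_inv_cancel₀ (pow_ne_zero _ t_ne_zero), one_smul,
        mul_assoc, mul_descInv DoubleAlg.heckeRel, mul_one, e1]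
    rw [e2, smul_assoc, mul_smul]
    refine Submodule.smul_mem _ _ (span_opY_stable hY (span_list_stable ?_ hx))
    intro a ha y hy
    obtain ⟨j, rfl⟩ := List.mem_ofFn.1 ha
    rw [hInv, smul_assoc, add_smul, smul_assoc, one_smul]
    exact Submodule.smul_mem _ _ (add_mem (span_T_stable hF j hy) (Submodule.smul_mem _ _ hy))
  | succ d ih =>
    let j : Fin (μ.card - 1) := ⟨i.1, by omega⟩
    have q := DoubleAlg.heckeRel _ _ (HeckeRel.quad j)
    have e1 : DoubleAlg.X i = t⁻¹ • (DoubleAlg.T j * DoubleAlg.X (hi j) * DoubleAlg.T j) := by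
      rw [DoubleAlg.rel _ _ (DoubleRel.X_succ j), mul_smul_comm, smul_mul_assoc, smul_smul,
        inv_mul_cancel₀ t_ne_zero, one_smul, mul_assoc, mul_assoc, hInv_mul q, mul_one, ← mul_assoc,
        mul_hInv q, one_mul]
      rfl
    rw [e1, smul_assoc, mul_smul, mul_smul]
    refine Submodule.smul_mem _ _ (span_T_stable hF j (ih (hi j) (span_T_stable hF j hx) ?_))
    simp only [hi, j]
    omega

theorem span_stable {hn : 0 < μ.card} (hY : IsFamily DoubleAlg.T DoubleAlg.X hn F)
    (hF : IsEigenFamily DoubleAlg.T DoubleAlg.theta F) (d : DoubleAlg μ.card)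
    {x : V μ} (hx : x ∈ Submodule.span K (Set.range F)) :
    d • x ∈ Submodule.span K (Set.range F) := by
  obtain ⟨f, rfl⟩ : ∃ f, DoubleAlg.mk μ.card f = d := RingQuot.mkAlgHom_surjective K _ d
  induction f using FreeAlgebra.induction generalizing x with
  | grade0 c =>
    rw [AlgHom.commutes, Algebra.algebraMap_eq_smul_one, smul_assoc, one_smul]
    exact Submodule.smul_mem _ _ hx
  | grade1 g =>
    cases g with
    | T i => exact span_T_stable hF i hx
    | theta i => exact span_theta_stable hF i hx
    | X i => exact span_X_stable hY hF i hx
  | mul a b ha hb => rw [map_mul, mul_smul]; exact ha (hb hx)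
  | add a b ha hb => rw [map_add, add_smul]; exact add_mem (ha hx) (hb hx)

theorem one_mem_span (hF : IsEigenFamily DoubleAlg.T DoubleAlg.theta F)
    (h0 : ∀ τ : SYT μ, F τ.1 = V.one (Specht.vec τ)) (v : Specht μ) :
    V.one v ∈ Submodule.span K (Set.range F) := by
  have key : ∀ (h : HeckeAlg μ.card) (v : Specht μ), V.one v ∈ Submodule.span K (Set.range F) →
      V.one (h • v) ∈ Submodule.span K (Set.range F) := by
    intro h v hv
    obtain ⟨f, rfl⟩ : ∃ f, HeckeAlg.mk μ.card f = h := RingQuot.mkAlgHom_surjective K _ h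
    induction f using FreeAlgebra.induction generalizing v with
    | grade0 c =>
      rw [AlgHom.commutes, Algebra.algebraMap_eq_smul_one, smul_assoc, one_smul, V.one_smul']
      exact Submodule.smul_mem _ _ hv
    | grade1 i =>
      have := V.T_smul_one i v
      rw [HeckeAlg.T] at this
      rw [← this]
      exact span_T_stable hF i hv
    | mul a b ha hb => rw [map_mul, mul_smul]; exact ha _ (hb _ hv)
    | add a b ha hb => rw [map_add, add_smul, V.one_add]; exact add_mem (ha _ hv) (hb _ hv)
  obtain ⟨x, rfl⟩ := Submodule.Quotient.mk_surjective _ v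
  induction x using Finsupp.induction_linear with
  | zero =>
    have : V.one (0 : Specht μ) = 0 := by
      have := V.one_smul' (0 : K) (0 : Specht μ)
      rwa [zero_smul, zero_smul] at this
    rw [Submodule.Quotient.mk_zero, this]
    exact zero_mem _
  | add f g hf hg => rw [Submodule.Quotient.mk_add, V.one_add]; exact add_mem hf hg
  | single τ h =>
    have : (Finsupp.single τ h : SYT μ →₀ HeckeAlg μ.card) = h • gen τ := by
      rw [gen, Finsupp.smul_single, smul_eq_mul, mul_one]
    rw [this, Submodule.Quotient.mk_smul]
    refine key h (Specht.vec τ) ?_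
    rw [← h0]
    exact Submodule.subset_span ⟨_, rfl⟩

theorem span_eq_top {hn : 0 < μ.card} (hY : IsFamily DoubleAlg.T DoubleAlg.X hn F)
    (hF : IsEigenFamily DoubleAlg.T DoubleAlg.theta F)
    (h0 : ∀ τ : SYT μ, F τ.1 = V.one (Specht.vec τ)) (x : V μ) :
    x ∈ Submodule.span K (Set.range F) := by
  obtain ⟨y, rfl⟩ := Submodule.Quotient.mk_surjective _ x
  induction y using TensorProduct.induction_on with
  | zero => rw [Submodule.Quotient.mk_zero]; exact zero_mem _
  | add a b ha hb => rw [Submodule.Quotient.mk_add]; exact add_mem ha hb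
  | tmul d v =>
    have : d ⊗ₜ[K] v = d • ((1 : DoubleAlg μ.card) ⊗ₜ[K] v) := by
      rw [TensorProduct.smul_tmul', smul_eq_mul, mul_one]
    rw [this, Submodule.Quotient.mk_smul]
    exact span_stable hY hF d (one_mem_span hF h0 v)

end Span

/-- An operator that is diagonal with non-zero eigenvalues is injective. -/
theorem injective_of_eigenvectors {k M ι : Type*} [Field k] [AddCommGroup M] [Module k M]
    (f : M →ₗ[k] M) (v : ι → M) (w : ι → k) (hw : ∀ i, w i ≠ 0) (hv : ∀ i, f (v i) = w i • v i)
    {x : M} (hx : x ∈ Submodule.span k (Set.range v)) (h0 : f x = 0) : x = 0 := by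
  -- Every vector of the span is annihilated by a polynomial in `f` with non-zero constant term. If
  -- `f x = 0`, only that constant term acts on `x`.
  have key : ∃ p : Polynomial k, p.coeff 0 ≠ 0 ∧ Polynomial.aeval f p x = 0 := by
    clear h0
    induction hx using Submodule.span_induction with
    | mem x hx =>
      obtain ⟨i, rfl⟩ := hx
      refine ⟨Polynomial.X - Polynomial.C (w i), by simp [hw], ?_⟩
      simp [hv]
    | zero => exact ⟨1, by simp, by simp⟩
    | add x y _ _ hx hy =>
      obtain ⟨p, hp, hpx⟩ := hx
      obtain ⟨r, hr, hry⟩ := hy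
      refine ⟨p * r, by rw [Polynomial.mul_coeff_zero]; exact mul_ne_zero hp hr, ?_⟩
      rw [map_add]
      nth_rw 1 [mul_comm p r]
      rw [map_mul, map_mul, Module.End.mul_apply, Module.End.mul_apply, hpx, hry]
      simp
    | smul c x _ hx =>
      obtain ⟨p, hp, hpx⟩ := hx
      exact ⟨p, hp, by rw [map_smul, hpx, smul_zero]⟩
  obtain ⟨p, hp, hpx⟩ := key
  rw [← p.divX_mul_X_add, map_add, map_mul, Polynomial.aeval_X, Polynomial.aeval_C,
    LinearMap.add_apply, Module.End.mul_apply, h0, map_zero, zero_add,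
    Module.algebraMap_end_apply] at hpx
  exact (smul_eq_zero.1 hpx).resolve_left hp

/-- The element `π_n` acts injectively. -/
theorem piElt_injective (hn : 0 < μ.card) {x y : V μ}
    (h : piElt (n := μ.card) DoubleAlg.T DoubleAlg.theta • x =
      piElt (n := μ.card) DoubleAlg.T DoubleAlg.theta • y) : x = y := by
  obtain ⟨F, hY, hF, h0⟩ := exists_macdonald (μ := μ) hn
  rw [← sub_eq_zero, ← smul_sub, piElt_eq hn, smul_assoc, mul_smul] at h
  have h1 := (smul_eq_zero.1 h).resolve_left (pow_ne_zero _ t_ne_zero)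
  -- Apart from a scalar and invertible T_i, π_n is θ_1, which is diagonal on the F_τ with non-zero
  -- eigenvalues.
  let f : V μ →ₗ[K] V μ :=
    { toFun := fun x => DoubleAlg.theta (⟨0, hn⟩ : Fin μ.card) • x
      map_add' := smul_add _
      map_smul' := fun c x => smul_comm _ c x }
  have h2 := injective_of_eigenvectors f F (fun τ => boxWeight τ.wt (τ.box ⟨0, hn⟩))
    (fun τ => boxWeight_ne_zero _ _) (fun τ => hF.weight τ _) (span_eq_top hY hF h0 _) h1
  have h3 := congrArg (fun z => descProd (n := μ.card) DoubleAlg.T (μ.card - 1) • z) h2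
  simp only [smul_zero] at h3
  rw [← mul_smul, mul_descInv DoubleAlg.heckeRel, one_smul] at h3
  exact sub_eq_zero.1 h3

/-- The vector `π_n⁻¹ F`, for a joint eigenvector `F`. -/
theorem piElt_smul_descProd (hn : 0 < μ.card) {x : V μ} {a : K} (ha : a ≠ 0)
    (h : DoubleAlg.theta (⟨0, hn⟩ : Fin μ.card) • x = a • x) :
    piElt (n := μ.card) DoubleAlg.T DoubleAlg.theta •
      ((t ^ (μ.card - 1) * a)⁻¹ • (descProd (n := μ.card) DoubleAlg.T (μ.card - 1) • x)) = x := by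
  rw [smul_comm, ← mul_smul, piElt_mul_descProd DoubleAlg.heckeRel hn, smul_assoc, h, smul_smul,
    smul_smul, mul_assoc, inv_mul_cancel₀ (mul_ne_zero (pow_ne_zero _ t_ne_zero) ha), one_smul]

theorem nonsym_spec (hn : 0 < μ.card) : IsNonsymmetric (nonsym (μ := μ)) := by
  apply Classical.epsilon_spec
  obtain ⟨F, hY, hF, h0⟩ := exists_macdonald (μ := μ) hn
  refine ⟨F, hF.weight, h0, fun i τ σ h1 h2 => ?_, fun τ first last hf hl => ?_⟩
  · obtain ⟨h3, rfl⟩ := (PSYT.isSwap_lt_iff hn).1 ⟨h1, h2⟩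
    rw [hF.up τ i h3, opB_smul]
    rfl
  · obtain rfl : first = ⟨0, hn⟩ := Fin.ext hf
    have el : last = ⟨μ.card - 1, by omega⟩ := Fin.ext (by simp only; omega)
    rw [el]
    refine ⟨_, piElt_smul_descProd hn (boxWeight_ne_zero _ _) (hF.weight τ _), ?_⟩
    rw [hY.psi, opY, smul_assoc, mul_smul, smul_comm (DoubleAlg.X _) (_ : K),
      smul_smul (q ^ _), smul_smul (_⁻¹ : K)]
    congr 1
    have := pow_ne_zero (τ.w ⟨0, hn⟩) q_ne_zero
    have := zpow_ne_zero (τ.c ⟨0, hn⟩) t_ne_zero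
    have := pow_ne_zero (μ.card - 1) t_ne_zero
    change _ = q ^ τ.w ⟨0, hn⟩ * (t ^ (μ.card - 1) * (q ^ τ.w ⟨0, hn⟩ * t ^ τ.c ⟨0, hn⟩))⁻¹
    field_simp

/-- The definition provides π_n⁻¹ F_τ only as some preimage; injectivity of π_n identifies it with
the explicit one, which turns the Ψ relation into one for Y. -/
theorem nonsym_isFamily (hn : 0 < μ.card) :
    IsFamily DoubleAlg.T DoubleAlg.X hn (nonsym (μ := μ)) := by
  have hN := nonsym_spec (μ := μ) hn
  refine ⟨fun τ i h => ?_, fun τ => ?_⟩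
  · obtain ⟨h1, h2⟩ := (PSYT.isSwap_lt_iff hn).2 ⟨h, rfl⟩
    rw [← hN.swap i τ _ h1 h2, opB_smul]
    rfl
  · obtain ⟨v, hv, hv'⟩ := hN.psi τ ⟨0, hn⟩ ⟨μ.card - 1, by omega⟩ rfl (by simp only; omega)
    have e := piElt_smul_descProd hn (boxWeight_ne_zero τ.wt (τ.box ⟨0, hn⟩)) (hN.weight τ _)
    rw [hv', piElt_injective hn (hv.trans e.symm), opY, smul_assoc, mul_smul,
      smul_comm (DoubleAlg.X _) (_ : K), smul_smul (q ^ _), smul_smul (_⁻¹ : K)]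
    congr 1
    have := pow_ne_zero (τ.w ⟨0, hn⟩) q_ne_zero
    have := zpow_ne_zero (τ.c ⟨0, hn⟩) t_ne_zero
    have := pow_ne_zero (μ.card - 1) t_ne_zero
    change q ^ τ.w ⟨0, hn⟩ * (t ^ (μ.card - 1) * (q ^ τ.w ⟨0, hn⟩ * t ^ τ.c ⟨0, hn⟩))⁻¹ = _
    field_simp

theorem nonsym_isEigenFamily (hn : 0 < μ.card) :
    IsEigenFamily DoubleAlg.T DoubleAlg.theta (nonsym (μ := μ)) := by
  have hN := nonsym_spec (μ := μ) hn
  refine ⟨(nonsym_isFamily hn).up, hN.weight,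
    (nonsym_isFamily hn).adjacent DoubleAlg.rel fun τ i h => ?_⟩
  rw [hN.std, V.adjacent_vec τ i h]

end

end VVMacdonald

/-! ### Symmetric Macdonald polynomials and the Pieri rule. -/

namespace VVMacdonald

noncomputable section

open Classical TensorProduct

variable {μ : YoungDiagram}

/-! ### Symmetric Macdonald polynomials -/

/-- An element of the image of ε is invariant, hence a multiple of `symVec`, and the coefficient 1
at Top(S) fixes the multiple. -/
theorem symP_eq {S : Box μ → ℕ} (hn : 0 < μ.card) (hS : IsRSSYT S) :
    symP S = symVec nonsym S := by
  have hF := nonsym_isEigenFamily (μ := μ) hn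
  have hT := DoubleAlg.heckeRel (n := μ.card)
  have htop := topT_mem hn hS
  have hinv := hF.T_smul_symVec hT hS
  let a : PSYTOf S := ⟨PSYT.topT S, htop.1⟩
  have hsplit : ∀ c : PSYTOf S → K, ∑ τ : PSYTOf S, c τ • nonsym τ.1 =
      c a • nonsym (PSYT.topT S) +
        ∑ y : PSYTOf S with y.1 ≠ PSYT.topT S, c y • nonsym y.1 := by
    intro c
    rw [← Finset.add_sum_erase _ _ (Finset.mem_univ a)]
    congr 1
    refine Finset.sum_congr ?_ fun _ _ => rfl
    ext y
    simp [a, Subtype.ext_iff]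
  have hex : IsSymmetric S (symVec nonsym S) := by
    refine ⟨⟨symVec nonsym S, ?_, (trivIdem_smul_of_invariant hT hinv).symm⟩,
      fun τ => symCoeff τ.1, ?_⟩
    · exact Submodule.sum_mem _ fun τ _ =>
        Submodule.smul_mem _ _ (Submodule.subset_span ⟨τ, rfl⟩)
    · rw [symVec, hsplit, symCoeff_top htop.2, one_smul]
  obtain ⟨⟨u, -, hu⟩, κ, hκ⟩ : IsSymmetric S (symP S) := Classical.epsilon_spec ⟨_, hex⟩
  let c : PSYTOf S → K := fun y => if y = a then 1 else κ y
  have hc : symP S = ∑ τ : PSYTOf S, c τ • nonsym τ.1 := by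
    rw [hκ, hsplit]
    simp only [c, if_true, one_smul]
    congr 1
    refine Finset.sum_congr rfl fun y hy => ?_
    rw [if_neg]
    rintro rfl
    exact (Finset.mem_filter.1 hy).2 rfl
  have := hF.invariant_eq hT hn hS c fun i => by
    rw [← hc, hu, ← mul_smul, T_mul_trivIdem hT]
  rw [hc, this]
  simp [c, a]

/-! ### Powers of `Ψ` -/

/-- During the first `r ≤ n` rotations exactly the labels below `r` pass through the first place,
each of them once. -/
theorem psi_iterate_wt (τ : PSYT μ) {r : ℕ} (hr : r ≤ μ.card) (b : Box μ) :
    (PSYT.Psi^[r] τ).wt b = τ.wt b + if (τ.label b).1 < r then 1 else 0 := by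
  induction r generalizing τ with
  | zero => simp
  | succ r ih =>
    rw [Function.iterate_succ_apply, ih _ (by omega)]
    have h1 : (τ.Psi.label b).1 = if (τ.label b).1 = 0 then μ.card - 1 else (τ.label b).1 - 1 :=
      PSYT.val_finRotate_symm _
    have h2 : τ.Psi.wt b = τ.wt b + if (τ.label b).1 = 0 then 1 else 0 := rfl
    rw [h1, h2]
    split_ifs <;> omega

theorem opY_pow_smul_nonsym (hn : 0 < μ.card) (τ : PSYT μ) {r : ℕ} (hr : r ≤ μ.card) :
    opY DoubleAlg.T DoubleAlg.X hn ^ r • nonsym τ =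
      t ^ (∑ i : Fin μ.card with i.1 < r, τ.c i) • nonsym (PSYT.Psi^[r] τ) := by
  -- Summing over `Fin r` lets the content of the first label be split off; the remaining contents
  -- are the first `r` ones of Ψ(τ).
  have e : ∀ (r : ℕ) (hr : r ≤ μ.card) (τ : PSYT μ), ∑ i : Fin μ.card with i.1 < r, τ.c i =
      ∑ k : Fin r, τ.c ⟨k.1, k.2.trans_le hr⟩ := by
    intro r hr τ
    symm
    refine Finset.sum_bij (fun k _ => ⟨k.1, k.2.trans_le hr⟩) ?_ ?_ ?_ ?_
    · intro k _
      simp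
    · intro k _ l _ h
      exact Fin.ext (Fin.mk.inj_iff.1 h)
    · intro i hi'
      exact ⟨⟨i.1, (Finset.mem_filter.1 hi').2⟩, Finset.mem_univ _, rfl⟩
    · intro _ _
      rfl
  induction r generalizing τ with
  | zero => simp
  | succ r ih =>
    rw [pow_succ, mul_smul, (nonsym_isFamily hn).opY_smul, smul_comm, ih _ (by omega), smul_smul,
      Function.iterate_succ_apply, ← zpow_add₀ t_ne_zero, e _ hr, e _ (by omega),
      Fin.sum_univ_succ]
    congr 3
    refine Finset.sum_congr rfl fun k _ => ?_
    change (τ.Psi.box _).content = (τ.box _).content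
    rw [τ.psi_box_lt (y := ⟨k.1 + 1, by omega⟩) rfl]
    rfl

/-- The Pieri rule. -/
theorem pieri {T : Box μ → ℕ} (hT : IsRSSYT T) (hn : 0 < μ.card) {r : ℕ} (hr : r ≤ μ.card) :
    elemX μ.card r • symP T = ∑ S ∈ addOnes T r, pieriCoeff r S T • symP S := by
  have hF := nonsym_isEigenFamily (μ := μ) hn
  have hH := DoubleAlg.heckeRel (n := μ.card)
  have hinv := hF.T_smul_symVec hH hT
  -- `f τ` is the contribution of `τ` to ε Y^r P_T; grouping by the exponents of Ψ^r(τ) produces the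
  -- Pieri coefficients.
  let f : PSYTOf T → V μ := fun τ =>
    (t ^ (∑ i : Fin μ.card with i.1 < r, τ.1.c i) * symCoeff τ.1) •
      (trivIdem (n := μ.card) DoubleAlg.T • nonsym (PSYT.Psi^[r] τ.1))
  have h1 : elemX μ.card r • symP T = elemT μ.card r • ∑ τ, f τ := by
    have := elem_smul_eq DoubleAlg.rel hn (trivIdem_mul_T hH)
      (fun p hp => trivIdem_smul_of_invariant (M := V μ) hH hp) hinv hr
    rw [symP_eq hn hT]
    refine this.trans ?_
    congr 1
    rw [symVec, Finset.smul_sum, Finset.smul_sum]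
    refine Finset.sum_congr rfl fun τ _ => ?_
    rw [smul_comm _ (_ : K), opY_pow_smul_nonsym hn _ hr, smul_smul, smul_comm _ (_ : K),
      mul_comm (symCoeff _)]
  have h2 : ∀ S ∈ addOnes T r, pieriCoeff r S T • symP S =
      elemT μ.card r • ∑ τ, if (PSYT.Psi^[r] τ.1).wt = S then f τ else 0 := by
    intro S hS
    have hS' : IsRSSYT S := (Finset.mem_filter.1 hS).2
    rw [pieriCoeff, mul_assoc, mul_smul, symP_eq hn hS', ← Finset.sum_filter, Finset.mul_sum,
      Finset.sum_smul]
    congr 1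
    refine Finset.sum_congr rfl fun τ hτ => ?_
    obtain rfl := (Finset.mem_filter.1 hτ).2
    simp only [f]
    rw [hF.trivIdem_smul hH hn hS', smul_smul, symCoeff, τ.2]
    congr 1
    ring
  rw [h1, Finset.sum_congr rfl h2, ← Finset.smul_sum, Finset.sum_comm]
  congr 1
  refine Finset.sum_congr rfl fun τ _ => ?_
  rw [Finset.sum_ite_eq]
  split_ifs with h
  · rfl
  · simp only [f]
    -- If the exponents of Ψ^r(τ) do not occur in `addOnes T r`, they are not reverse semistandard:
    -- they do arise by adding ones, namely to the boxes with labels below `r`.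
    rw [hF.trivIdem_smul_eq_zero hH hn, smul_zero]
    intro hS
    refine h (Finset.mem_filter.2 ⟨Finset.mem_image.2 ⟨Finset.univ.filter fun b =>
      (τ.1.label b).1 < r, ?_, ?_⟩, hS⟩)
    · rw [Finset.mem_powersetCard]
      refine ⟨Finset.subset_univ _, ?_⟩
      rw [← Fintype.card_subtype]
      have e : {b // (τ.1.label b).1 < r} ≃ Fin r :=
        { toFun := fun b => ⟨_, b.2⟩
          invFun := fun k => ⟨τ.1.box ⟨k.1, k.2.trans_le hr⟩, by simp⟩
          left_inv := fun b => Subtype.ext (by simp)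
          right_inv := fun k => by simp }
      rw [Fintype.card_congr e, Fintype.card_fin]
    · funext b
      rw [psi_iterate_wt _ hr, τ.2]
      simp

end

end VVMacdonald

theorem mainTheorem4 (μ : YoungDiagram) (T : VVMacdonald.Box μ → ℕ)
    (hT : VVMacdonald.IsRSSYT T) (r : ℕ) (hr : 1 ≤ r) (hrn : r ≤ μ.card) :
    VVMacdonald.elemX μ.card r • VVMacdonald.symP T =
      ∑ S ∈ VVMacdonald.addOnes T r, VVMacdonald.pieriCoeff r S T • VVMacdonald.symP S := by
  exact VVMacdonald.pieri hT (by omega) hrn
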